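/- Let $X$ be a connected, second countable, Hausdorff smooth $l$-manifold without boundary, and let $W$ be a group acting faithfully, smoothly and properly discontinuously on $X$, generated by finitely many reflections. Here a reflection is an involution $r\in W$ whose fixed point set $X_r$ (its wall) separates $X$. Let $R$ be the set of all reflections in $W$ and $\mathcal{A}=\{X_r\mid r\in R\}$. *Faces.* The chambers are the connected components of $X\setminus\bigcup_{r\in R}X_r$; let $\mathcal{C}(\mathcal{A})$ be the set of chambers. Let $\mathcal{L}^d$ be the set of non-empty intersections of codimension $d$ of connected components of walls, with $\mathcal{L}^0=\{X\}$. The codimension-$d$ faces are the connected components of $\bigcup\mathcal{L}^d\setminus\bigcup\mathcal{L}^{d+1}$. Let $\mathcal{F}(\mathcal{A})$ be the set of all faces, ordered by $F\le G\iff F\subseteq\overline{G}$. Assume that $\mathcal{A}$ is a manifold reflection arrangement: the faces are the open cells of a regular cell complex structure on $X$, and for each chamber $C$ the poset $\mathcal{F}(C)=\{F\in\mathcal{F}(\mathcal{A})\mid F\le C\}$ is isomorphic to the poset of non-empty faces of a simple convex polytope. *Salvetti poset.* $\mathrm{Sal}_0(\mathcal{A})=\{(F,C)\in\mathcal{F}(\mathcal{A})\times\mathcal{C}(\mathcal{A})\mid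 F\le C\}$ with $(F,C)\preceq(G,D)$ iff $F\le G$ and $C_F\subseteq D_G$, where $C_F$ is the connected component of $X\setminus\bigcup_{r\in R,\,F\subseteq X_r}X_r$ that contains $C$. *Coxeter data.* Fix a chamber $C$. For a reflection $s$ put $C_s=\overline{C}\cap X_s$, and let $S$ be the set of $s\in R$ such that $C_s$ contains a codimension-one face. Assume that each mirror $C_s$, $s\in S$, is the closure of a single codimension-one face. For $T\subseteq S$ let $W_T$ be the subgroup generated by $T$, and let $\ell$ be the word length on $W$ with respect to $S$. For $F\in\mathcal{F}(C)$ put $\sigma(F)=\{s\in S\mid F\subseteq C_s\}$. Let $\mathcal{S}^f_X$ be the set of those $T\subseteq S$ for which $W_T$ is finite and $\bigcap_{s\in T}C_s$ is a non-empty closed face of $\overline{C}$ (the intersection being $\overline{C}$ for $T=\emptyset$). An element $w\in W$ is $(\emptyset,T)$-minimal if it has minimal length in $wW_T$. Define a relation on $\mathcal{S}^f_X\times W$ by $$(T,v)\preceq(U,w)\iff T\subseteq U,\ w^{-1}v\in W_U\ \text{and}\ w^{-1}v\ \text{is}\ (\emptyset,T)\text{-minimal}.$$ **Theorem.** Every element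 of $\mathrm{Sal}_0(\mathcal{A})$ can be written in exactly one way as $(wF,wC)$ with $w\in W$ and $F\in\mathcal{F}(C)$, and all such pairs belong to $\mathrm{Sal}_0(\mathcal{A})$. Both relations $\preceq$ are partial orders, and the map $$\Phi\colon\mathrm{Sal}_0(\mathcal{A})\to\mathcal{S}^f_X\times W,\qquad \Phi(wF,wC)=(\sigma(F),w),$$ is a well-defined order-reversing poset isomorphism: it is bijective, and $p\preceq q\iff\Phi(q)\preceq\Phi(p)$ for all $p,q\in\mathrm{Sal}_0(\mathcal{A})$. -/

import Mathlib

open scoped Manifold ContDiff Pointwise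

noncomputable section

namespace ReflArr

/-! ### Convex polytopes -/

/-- The nonempty faces of a convex polytope `P` (including `P` itself). -/
def polytopeFaces {l : ℕ} (P : Set (EuclideanSpace ℝ (Fin l))) :
    Set (Set (EuclideanSpace ℝ (Fin l))) :=
  {Q | Q.Nonempty ∧ IsExposed ℝ P Q}

/-- The facets of an `l`-dimensional polytope `P` in `ℝ^l`: its faces of dimension `l - 1`. -/
def polytopeFacets {l : ℕ} (P : Set (EuclideanSpace ℝ (Fin l))) :
    Set (Set (EuclideanSpace ℝ (Fin l))) :=
  {Q | Q ∈ polytopeFaces P ∧ Module.finrank ℝ (vectorSpan ℝ Q) + 1 = l}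

/-- `P` is a simple convex polytope of dimension `l` in `ℝ^l`: the convex hull of finitely many
points, with nonempty interior, each of whose vertices lies in exactly `l` facets. -/
def IsSimplePolytope {l : ℕ} (P : Set (EuclideanSpace ℝ (Fin l))) : Prop :=
  (∃ V : Set (EuclideanSpace ℝ (Fin l)), V.Finite ∧ P = convexHull ℝ V) ∧
  (interior P).Nonempty ∧
  ∀ v ∈ P.extremePoints ℝ, {Q | Q ∈ polytopeFacets P ∧ v ∈ Q}.encard = (l : ℕ∞)

/-! ### Reflections, walls, chambers -/

section Action

variable (W : Type*) [Group W] (X : Type*) [TopologicalSpace X] [MulAction W X]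

/-- The fixed point set `X_w` of `w`. For a reflection this is its wall. -/
def wall {W : Type*} [Group W] (X : Type*) [MulAction W X] (w : W) : Set X :=
  {x | w • x = x}

/-- The (dissecting) reflections in `W`: involutions whose fixed point set separates `X`.
Local smoothness is automatic for a smooth action of a finite group. -/
def reflections : Set W :=
  {r | r * r = 1 ∧ ¬ IsPreconnected (wall X r)ᶜ}

/-- The chambers: connected components of the complement of the union of all walls. -/
def chambers : Set (Set X) :=
  {C | ∃ x ∈ (⋃ r ∈ reflections W X, wall X r)ᶜ,
    C = connectedComponentIn (⋃ r ∈ reflections W X, wall X r)ᶜ x}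

/-- The set of all connected components `H_i` of walls. -/
def wallComponents : Set (Set X) :=
  {H | ∃ r ∈ reflections W X, ∃ x ∈ wall X r, H = connectedComponentIn (wall X r) x}

end Action

/-! ### Strata -/

section Strata

variable (l : ℕ) (W : Type*) [Group W] (X : Type*) [TopologicalSpace X]
  [ChartedSpace (EuclideanSpace ℝ (Fin l)) X] [MulAction W X]

/-- Near its point `x`, the set `Y` is a smooth submanifold of `X` of codimension `d`. -/
def HasCodimAt {X : Type*} [TopologicalSpace X] [ChartedSpace (EuclideanSpace ℝ (Fin l)) X]
    (Y : Set X) (d : ℕ) (x : X) : Prop :=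
  x ∈ Y ∧ ∃ e ∈ IsManifold.maximalAtlas (𝓡 l) ∞ X, x ∈ e.source ∧
    ∃ V : Submodule ℝ (EuclideanSpace ℝ (Fin l)), Module.finrank ℝ V + d = l ∧
      ∀ y ∈ e.source, (y ∈ Y ↔ e y - e x ∈ V)

/-- The union of the codimension `d` intersections of components of walls: the points at which
some such intersection has codimension `d`. The empty intersection is `X`. -/
def codimUnion (d : ℕ) : Set X :=
  {x | ∃ 𝓗 ⊆ wallComponents W X, HasCodimAt l (⋂₀ 𝓗) d x}

/-- The strata (faces) of codimension `d`. -/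
def strata (d : ℕ) : Set (Set X) :=
  {F | ∃ x ∈ codimUnion l W X d \ codimUnion l W X (d + 1),
    F = connectedComponentIn (codimUnion l W X d \ codimUnion l W X (d + 1)) x}

/-- The faces of the arrangement. They are ordered by `F ≤ G ↔ F ⊆ closure G`. -/
def faces : Set (Set X) :=
  {F | ∃ d, F ∈ strata l W X d}

/-- The faces `F ≤ C` of a chamber `C`, i.e. those of the closed chamber. -/
def facesOf {X : Type*} [TopologicalSpace X]
    [ChartedSpace (EuclideanSpace ℝ (Fin l)) X] [MulAction W X] (C : Set X) : Set (Set X) :=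
  {F | F ∈ faces l W X ∧ F ⊆ closure C}

/-! ### Coxeter transformation groups and manifold reflection arrangements -/

/-- `W` acts faithfully and smoothly on the `l`-manifold `X` and is generated by finitely many
reflections. (Properness of the action is required separately, by `ProperlyDiscontinuousSMul`.) -/
structure IsCoxeterTransformationGroup : Prop where
  faithful : FaithfulSMul W X
  smooth : ∀ w : W, ContMDiff (𝓡 l) (𝓡 l) ∞ (fun x : X => w • x)
  generated : ∃ A : Set W, A.Finite ∧ A ⊆ reflections W X ∧ Subgroup.closure A = ⊤

/-- The strata are the open cells of a regular CW structure on `X` (a CW structure all of whose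
characteristic maps are injective on the closed ball), the strata of codimension `l - n` being
the open `n`-cells. -/
def StrataFormRegularCellComplex : Prop :=
  ∃ cw : Topology.CWComplex (Set.univ : Set X),
    (∀ n (i : cw.cell n), Set.InjOn (cw.map n i) (Metric.closedBall 0 1)) ∧
    ∀ n, Set.range (fun i : cw.cell n => cw.map n i '' Metric.ball 0 1) =
      {F | ∃ d, n + d = l ∧ F ∈ strata l W X d}

/-- The closed chamber is combinatorially equivalent to a simple convex polytope: the face posets
are isomorphic. -/
def IsCombinatoriallySimplePolytope {X : Type*} [TopologicalSpace X]
    [ChartedSpace (EuclideanSpace ℝ (Fin l)) X] [MulAction W X] (C : Set X) : Prop :=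
  ∃ P : Set (EuclideanSpace ℝ (Fin l)), IsSimplePolytope P ∧
    ∃ φ : facesOf l W C ≃ polytopeFaces P,
      ∀ F G : facesOf l W C, F.1 ⊆ closure G.1 ↔ (φ F).1 ⊆ (φ G).1

/-- The walls of `W` form a manifold reflection arrangement in `X`. -/
structure IsReflectionArrangement : Prop where
  group : IsCoxeterTransformationGroup l W X
  regular : StrataFormRegularCellComplex l W X
  polytopal : ∀ C ∈ chambers W X, IsCombinatoriallySimplePolytope l W C

end Strata

/-! ### The Salvetti poset -/

section Salvetti

variable (l : ℕ) (W : Type*) [Group W] (X : Type*) [TopologicalSpace X]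
  [ChartedSpace (EuclideanSpace ℝ (Fin l)) X] [MulAction W X]

/-- For a chamber `C`, the chamber `C_F` of the local arrangement `{X_r | F ⊆ X_r}` which
contains `C`. -/
def localChamber {X : Type*} [TopologicalSpace X] [MulAction W X] (F C : Set X) : Set X :=
  {y | ∃ x ∈ C, y ∈
    connectedComponentIn (⋃ r ∈ {r | r ∈ reflections W X ∧ F ⊆ wall X r}, wall X r)ᶜ x}

/-- The pairs `(F, C)` of a face and a chamber with `F ≤ C`. -/
def Sal : Set (Set X × Set X) :=
  {p | p.1 ∈ faces l W X ∧ p.2 ∈ chambers W X ∧ p.1 ⊆ closure p.2}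

/-- `(F, C) ≼ (G, D)` iff `F ≤ G` and `C_F ⊆ D_G`. -/
def salLE (p q : Sal l W X) : Prop :=
  p.1.1 ⊆ closure q.1.1 ∧ localChamber W p.1.1 p.1.2 ⊆ localChamber W q.1.1 q.1.2

end Salvetti

/-! ### The Coxeter data of a fundamental chamber -/

section Coxeter

variable (l : ℕ) (W : Type*) [Group W] {X : Type*} [TopologicalSpace X]
  [ChartedSpace (EuclideanSpace ℝ (Fin l)) X] [MulAction W X]

/-- The mirror `C_s` of the closed chamber. -/
def mirror {W : Type*} [Group W] {X : Type*} [TopologicalSpace X] [MulAction W X]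
    (C : Set X) (s : W) : Set X :=
  closure C ∩ wall X s

/-- The simple reflections: those `s` for which `X_s` is a wall of `C`, that is, for which the
mirror `C_s` contains a face of codimension one. -/
def simpleReflections (C : Set X) : Set W :=
  {s | s ∈ reflections W X ∧ ∃ F ∈ strata l W X 1, F ⊆ mirror C s}

/-- Each mirror of the chamber is a single closed codimension one face. -/
def MirrorsAreFaces (C : Set X) : Prop :=
  ∀ s ∈ simpleReflections l W C, ∃ F ∈ strata l W X 1, mirror C s = closure F

/-- The Coxeter equipment: `σ(F)` is the set of the simple reflections `s` with `F ⊆ C_s`. -/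
def sigma (C F : Set X) : Set W :=
  {s | s ∈ simpleReflections l W C ∧ F ⊆ mirror C s}

/-- The acceptable subsets `T` of `S`: `W_T` is finite and the intersection of the mirrors `C_s`,
`s ∈ T`, is a (closed) face of `C`; for `T = ∅` the intersection is the closed chamber. -/
def acceptable (C : Set X) : Set (Set W) :=
  {T | T ⊆ simpleReflections l W C ∧ Finite (Subgroup.closure T) ∧
    ∃ F ∈ facesOf l W C, closure C ∩ ⋂ s ∈ T, mirror C s = closure F}

/-- The length of `w` as a word over `S` (for `S` a generating set consisting of involutions). -/
def wordLength {W : Type*} [Group W] (S : Set W) (w : W) : ℕ :=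
  sInf {n | ∃ L : List W, (∀ s ∈ L, s ∈ S) ∧ L.prod = w ∧ L.length = n}

/-- `w` is `(∅, T)`-minimal: it has minimal length (over `S`) in `w W_T`. -/
def IsMinimal {W : Type*} [Group W] (S T : Set W) (w : W) : Prop :=
  ∀ u ∈ Subgroup.closure T, wordLength S w ≤ wordLength S (w * u)

/-- `(T, v) ≼ (U, w)` iff `T ⊆ U`, `w⁻¹ v ∈ W_U` and `w⁻¹ v` is `(∅, T)`-minimal. -/
def coxLE (C : Set X) (p q : acceptable l W C × W) : Prop :=
  (p.1 : Set W) ⊆ q.1 ∧ q.2⁻¹ * p.2 ∈ Subgroup.closure (q.1 : Set W) ∧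
    IsMinimal (simpleReflections l W C) (p.1 : Set W) (q.2⁻¹ * p.2)

end Coxeter

end ReflArr

end

open scoped Manifold ContDiff Pointwise

namespace ReflArr

/-! ### Words and separating reflections -/

section Words

/-! Both orders record which walls a gallery from one chamber to another has to cross, so the
theorem follows once `W` is known to act simply transitively on the chambers, with the closed
chamber as strict fundamental domain and with lengths counted by separating walls.

Local geometry. Averaging a chart over the finite stabiliser of a point makes that stabiliser act
linearly (`exists_linModel`). A reflection fixing the point becomes a linear reflection, and because
its fixed set separates `X`, that set is a full hyperplane in the chart (`LinModel.exists_root`).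
Near a point the chambers are therefore cones cut out by finitely many roots. Reflecting in a
violated panel increases an invariant inner product with a fixed point of the chamber, so the panel
reflections act transitively on the chambers near the point (`LocalModel.exists_smul_mem`).
Connectedness of `X` makes this global, and the panel reflections generate `W`
(`exists_smul_mem_chamber`, `closure_panelReflections`).

Combinatorics. Let `N w` be the set of reflections separating `C` from `wC`. Each wall has exactly
two sides, so `N` is a cocycle; crossing a panel crosses a single wall, so `N s = {s}`
(`isSeparation`). These facts alone give the exchange property, that `N w = ∅` forces `w = 1`, the
description of minimal coset representatives by separating reflections
(`IsSeparation.isMinimal_iff`), and galleries avoiding every wall that does not separate their ends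
(`IsSeparation.gallery`).

Faces. The walls through a point do not change along a face. In a polytope a face is cut out by the
maximal proper faces above it, and the maximal proper faces of a chamber fill out its mirrors, so a
closed face is the intersection of the mirrors containing it (`mem_closure_face`) and `σ` is
injective. It reaches every acceptable `T`, because averaging a point of the chamber over `W_T`
produces a point on the mirrors of `T` and on no others (`eq_sigma_of_inter_eq`).

Orders. The inclusion of `wF` in the closure of `vG` says that `σ(G) ⊆ σ(F)` and `w⁻¹v ∈ W_{σ(F)}`.
Given it, the inclusion of local chambers says that no wall through `vG` separates `wC` from `vC`,
which is minimality of `w⁻¹v` (`salLE_iff`). -/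

/-- `N w` plays the role of the set of reflections separating the base chamber from its translate
by `w`: it is a cocycle, and a generator is separated only by itself. -/
structure IsSeparation {W : Type*} [Group W] (S : Set W) (N : W → Set W) : Prop where
  mul_self : ∀ s ∈ S, s * s = 1
  simple : ∀ s ∈ S, N s = {s}
  mul : ∀ v w r, r ∈ N (v * w) ↔ Xor (r ∈ N v) (v⁻¹ * r * v ∈ N w)

namespace IsSeparation

variable {W : Type*} [Group W] {S : Set W} {N : W → Set W}

theorem inv_eq (h : IsSeparation S N) {s : W} (hs : s ∈ S) : s⁻¹ = s :=
  inv_eq_of_mul_eq_one_left (h.mul_self s hs)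

theorem one (h : IsSeparation S N) : N 1 = ∅ := by
  ext r
  have := h.mul 1 1 r
  simp only [mul_one, inv_one, one_mul] at this
  simp only [Set.mem_empty_iff_false, iff_false]
  intro hr
  have h2 := this.1 hr
  simp [Xor, hr] at h2

theorem mul_simple (h : IsSeparation S N) {s : W} (hs : s ∈ S) (w r : W) :
    r ∈ N (s * w) ↔ Xor (r = s) (s * r * s ∈ N w) := by
  rw [h.mul, h.simple s hs, h.inv_eq hs, Set.mem_singleton_iff]

theorem exists_list (h : IsSeparation S N) {T : Set W} (hT : T ⊆ S) {w : W}
    (hw : w ∈ Subgroup.closure T) : ∃ L : List W, (∀ s ∈ L, s ∈ T) ∧ L.prod = w := by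
  rw [← Subgroup.mem_toSubmonoid, Subgroup.closure_toSubmonoid] at hw
  obtain ⟨L, hL, rfl⟩ := Submonoid.exists_list_of_mem_closure hw
  refine ⟨L, fun s hs => ?_, rfl⟩
  rcases hL s hs with h1 | h1
  · exact h1
  · have h2 := h.inv_eq (hT (Set.mem_inv.1 h1))
    rw [inv_inv] at h2
    exact h2 ▸ Set.mem_inv.1 h1

/-- Read the word as a gallery: if `r` separates its ends, some letter crosses the wall of `r`, and
multiplying by `r` deletes that letter. The cocycle rule finds it by induction on the word. -/
theorem exchange (h : IsSeparation S N) {r : W} (L : List W) (hL : ∀ s ∈ L, s ∈ S)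
    (hr : r ∈ N L.prod) :
    ∃ L' : List W, (∀ s ∈ L', s ∈ L) ∧ L'.length + 1 = L.length ∧ r * L.prod = L'.prod := by
  induction L generalizing r with
  | nil => simp [h.one] at hr
  | cons s L ih =>
    have hs : s ∈ S := hL s (by simp)
    rw [List.prod_cons, h.mul_simple hs] at hr
    rcases hr with ⟨rfl, -⟩ | ⟨hr, -⟩
    · exact ⟨L, fun t ht => by simp [ht], by simp, by
        rw [List.prod_cons, ← mul_assoc, h.mul_self _ hs, one_mul]⟩
    · obtain ⟨L', h1, h2, h3⟩ := ih (fun t ht => hL t (by simp [ht])) hr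
      refine ⟨s :: L', ?_, by simp [h2], ?_⟩
      · intro t ht
        rcases List.mem_cons.1 ht with rfl | ht
        · simp
        · simp [h1 t ht]
      · rw [List.prod_cons, List.prod_cons, ← h3]
        simp only [← mul_assoc, h.mul_self s hs, one_mul]

/-- Peeling off the first letter of a shortest word. -/
theorem exists_first_letter (h : IsSeparation S N) {T : Set W} (hT : T ⊆ S) {w : W}
    (hw : w ∈ Subgroup.closure T) (hne : w ≠ 1) :
    ∃ s ∈ T, s ∈ N w ∧ s * w ∈ Subgroup.closure T ∧ wordLength T (s * w) < wordLength T w := by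
  have hmem : {n | ∃ L : List W, (∀ s ∈ L, s ∈ T) ∧ L.prod = w ∧ L.length = n}.Nonempty := by
    obtain ⟨L, h1, h2⟩ := h.exists_list hT hw
    exact ⟨_, L, h1, h2, rfl⟩
  obtain ⟨L, h1, h2, h3⟩ := Nat.sInf_mem hmem
  cases L with
  | nil => exact absurd (by simpa using h2.symm) hne
  | cons s L =>
    have hs : s ∈ T := h1 s (by simp)
    have hsw : s * w = L.prod := by
      rw [← h2, List.prod_cons, ← mul_assoc, h.mul_self s (hT hs), one_mul]
    refine ⟨s, hs, ?_, mul_mem (Subgroup.subset_closure hs) hw, ?_⟩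
    · rw [← h2, List.prod_cons, h.mul_simple (hT hs)]
      -- If `s` also separated for the tail, exchange would write `w` with two letters fewer,
      -- against the choice of a shortest word.
      refine Or.inl ⟨rfl, fun hN => ?_⟩
      rw [h.mul_self s (hT hs), one_mul] at hN
      obtain ⟨L', h4, h5, h6⟩ := h.exchange L (fun t ht => hT (h1 t (by simp [ht]))) hN
      have : wordLength T w ≤ L'.length :=
        Nat.sInf_le ⟨L', fun t ht => h1 t (by simp [h4 t ht]), by rw [← h6, ← h2]; simp, rfl⟩
      rw [wordLength, ← h3] at this
      simp at this
      omega
    · have : wordLength T (s * w) ≤ L.length :=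
        Nat.sInf_le ⟨L, fun t ht => h1 t (by simp [ht]), hsw.symm, rfl⟩
      rw [List.length_cons] at h3
      rw [wordLength, wordLength, ← h3]
      rw [wordLength] at this
      omega

theorem eq_one_of_empty (h : IsSeparation S N) {w : W} (hw : w ∈ Subgroup.closure S)
    (hN : N w = ∅) : w = 1 := by
  by_contra hne
  obtain ⟨s, -, hs, -⟩ := h.exists_first_letter subset_rfl hw hne
  simp [hN] at hs

/-- The first letter of a shortest `T`-word for `s` lies in `N s = {s}`, hence is `s`. This is what
lets `T` be recovered from `W_T`. -/
theorem mem_of_mem_closure (h : IsSeparation S N) {T : Set W} (hT : T ⊆ S) {s : W} (hs : s ∈ S)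
    (hsT : s ∈ Subgroup.closure T) : s ∈ T := by
  have hne : s ≠ 1 := by
    rintro rfl
    have := h.simple 1 hs
    rw [h.one] at this
    exact (Set.singleton_ne_empty _ this.symm).elim
  obtain ⟨t, ht, htN, -⟩ := h.exists_first_letter hT hsT hne
  rw [h.simple s hs, Set.mem_singleton_iff] at htN
  exact htN ▸ ht

/-- A wall crossed by a gallery with letters in `T` belongs to the conjugate of a letter by an
initial subword. -/
theorem subset_closure (h : IsSeparation S N) {T : Set W} (hT : T ⊆ S) {w : W}
    (hw : w ∈ Subgroup.closure T) : N w ⊆ Subgroup.closure T := by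
  obtain ⟨L, hL, rfl⟩ := h.exists_list hT hw
  clear hw
  induction L with
  | nil => simp [h.one]
  | cons s L ih =>
    have hs : s ∈ T := hL s (by simp)
    have hs' := Subgroup.subset_closure (k := T) hs
    intro r hr
    rw [List.prod_cons, h.mul_simple (hT hs)] at hr
    rcases hr with ⟨rfl, -⟩ | ⟨hr, -⟩
    · exact hs'
    · have := ih (fun t ht => hL t (by simp [ht])) hr
      have := mul_mem (mul_mem hs' this) hs'
      simp only [← mul_assoc, h.mul_self s (hT hs), one_mul] at this
      rwa [mul_assoc, h.mul_self s (hT hs), mul_one] at this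

theorem wordLength_mul_lt (h : IsSeparation S N) {w r : W} (hw : w ∈ Subgroup.closure S)
    (hr : r ∈ N w) : wordLength S (r * w) < wordLength S w := by
  have hmem : {n | ∃ L : List W, (∀ s ∈ L, s ∈ S) ∧ L.prod = w ∧ L.length = n}.Nonempty := by
    obtain ⟨L, h1, h2⟩ := h.exists_list subset_rfl hw
    exact ⟨_, L, h1, h2, rfl⟩
  obtain ⟨L, h1, h2, h3⟩ := Nat.sInf_mem hmem
  obtain ⟨L', h4, h5, h6⟩ := h.exchange (r := r) L h1 (by rwa [h2])
  have : wordLength S (r * w) ≤ L'.length :=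
    Nat.sInf_le ⟨L', fun t ht => h1 t (h4 t ht), by rw [← h6, h2], rfl⟩
  rw [wordLength, wordLength, ← h3]
  rw [wordLength] at this
  omega

/-- A coset representative is minimal iff no reflection of the conjugate parabolic subgroup
separates. -/
theorem isMinimal_iff (h : IsSeparation S N) (hS : Subgroup.closure S = ⊤) {T : Set W}
    (hT : T ⊆ S) (u : W) :
    IsMinimal S T u ↔ ∀ r ∈ N u, u⁻¹ * r * u ∉ Subgroup.closure T := by
  have key : ∀ u, IsMinimal S T u → ∀ r ∈ N u, u⁻¹ * r * u ∉ Subgroup.closure T := by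
    intro u hu r hr hrT
    have h1 := h.wordLength_mul_lt (hS ▸ Subgroup.mem_top u) hr
    have h2 := hu _ hrT
    have h3 : u * (u⁻¹ * r * u) = r * u := by group
    rw [h3] at h2
    omega
  refine ⟨key u, fun hu => ?_⟩
  obtain ⟨x, hx, hmin⟩ : ∃ x ∈ Subgroup.closure T, ∀ y ∈ Subgroup.closure T,
      wordLength S (u * x) ≤ wordLength S (u * y) := by
    obtain ⟨n, ⟨x, hx, rfl⟩, hn⟩ := WellFounded.has_min (r := (· < ·)) wellFounded_lt
      {n | ∃ x ∈ Subgroup.closure T, wordLength S (u * x) = n} ⟨_, 1, one_mem _, rfl⟩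
    exact ⟨x, hx, fun y hy => not_lt.1 (hn _ ⟨y, hy, rfl⟩)⟩
  have hm : IsMinimal S T (u * x) := by
    intro y hy
    rw [mul_assoc]
    exact hmin _ (mul_mem hx hy)
  -- With `u * x` shortest in the coset, suppose `r` separates for `x⁻¹`. Then `r ∈ W_T`, and its
  -- conjugate by `u * x` separates for `u` or for `u * x` by the cocycle rule for `u = (u * x) *
  -- x⁻¹`. The hypothesis on `u` excludes the first, minimality the second.
  have hx1 : x⁻¹ = 1 := by
    refine h.eq_one_of_empty (hS ▸ Subgroup.mem_top _) (Set.eq_empty_iff_forall_notMem.2 ?_)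
    intro r hr
    have hrT : r ∈ Subgroup.closure T := h.subset_closure hT (inv_mem hx) hr
    have h1 := h.mul (u * x) x⁻¹ (u * x * r * (u * x)⁻¹)
    have e1 : (u * x)⁻¹ * (u * x * r * (u * x)⁻¹) * (u * x) = r := by group
    have e2 : u * x * x⁻¹ = u := by group
    rw [e1, e2] at h1
    have h2 : u * x * r * (u * x)⁻¹ ∉ N (u * x) := fun hc => key _ hm _ hc (by rwa [e1])
    have h3 : u * x * r * (u * x)⁻¹ ∉ N u := by
      intro hc
      refine hu _ hc ?_
      have : u⁻¹ * (u * x * r * (u * x)⁻¹) * u = x * r * x⁻¹ := by group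
      rw [this]
      exact mul_mem (mul_mem hx hrT) (inv_mem hx)
    exact h3 (h1.2 (Or.inr ⟨hr, h2⟩))
  rw [inv_eq_one] at hx1
  rwa [hx1, mul_one] at hm

/-- Induction along a gallery: if no element of `A` separates then one can walk from `g` to `g * w`
through simple steps avoiding `A`. -/
theorem gallery (h : IsSeparation S N) {A : Set W} {P : W → W → Prop} (hrefl : ∀ g, P g g)
    (htrans : ∀ g g' g'', P g g' → P g' g'' → P g g'')
    (hstep : ∀ g, ∀ s ∈ S, g * s * g⁻¹ ∉ A → P g (g * s)) (w : W)
    (hw : w ∈ Subgroup.closure S) (g : W) (hA : ∀ r ∈ A, g⁻¹ * r * g ∉ N w) : P g (g * w) := by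
  induction hn : wordLength S w using Nat.strong_induction_on generalizing w g with
  | _ n ih =>
    by_cases hne : w = 1
    · rw [hne, mul_one]
      exact hrefl g
    obtain ⟨s, hs, hsN, hsw, hlt⟩ := h.exists_first_letter subset_rfl hw hne
    have hss := h.mul_self s hs
    have e : s * (s * w) = w := by rw [← mul_assoc, hss, one_mul]
    -- The first step crosses the wall of `g * s * g⁻¹`, which is not in `A` because `s ∈ N w`. What
    -- remains is `s * w` starting at `g * s`, and the cocycle rule transfers the assumption on `A`
    -- to it.
    refine htrans _ _ _ (hstep g s hs fun hc => hA _ hc ?_) ?_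
    · convert hsN using 1
      group
    · have h2 := ih _ (hn ▸ hlt) (s * w) hsw (g * s) ?_ rfl
      · rwa [mul_assoc, e] at h2
      · intro r hr hc
        have hrA := hA r hr
        have h3 := h.mul_simple hs (s * w) (g⁻¹ * r * g)
        rw [e] at h3
        refine hrA (h3.2 (Or.inr ⟨?_, fun heq => hrA (heq ▸ hsN)⟩))
        convert hc using 1
        rw [mul_inv_rev, h.inv_eq hs]
        group

end IsSeparation

end Words

/-! ### Faces of polytopes -/

section Polytope

variable {l : ℕ} {V : Set (EuclideanSpace ℝ (Fin l))}

/-- A functional describing a face, normalised at a point of the face. -/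
theorem exists_functional {P Q : Set (EuclideanSpace ℝ (Fin l))} (hQ : Q ∈ polytopeFaces P)
    {m : EuclideanSpace ℝ (Fin l)} (hm : m ∈ Q) :
    ∃ f : StrongDual ℝ (EuclideanSpace ℝ (Fin l)), (∀ x ∈ P, f x ≤ f m) ∧
      ∀ x, x ∈ Q ↔ x ∈ P ∧ f x = f m := by
  obtain ⟨f, hf⟩ := hQ.2 hQ.1
  have hm' : m ∈ {x ∈ P | ∀ y ∈ P, f y ≤ f x} := hf ▸ hm
  refine ⟨f, hm'.2, fun x => ?_⟩
  rw [hf]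
  constructor
  · rintro ⟨h1, h2⟩
    exact ⟨h1, le_antisymm (hm'.2 x h1) (h2 m hm'.1)⟩
  · rintro ⟨h1, h2⟩
    exact ⟨h1, fun y hy => h2 ▸ hm'.2 y hy⟩

theorem le_of_forall_vertex (f : StrongDual ℝ (EuclideanSpace ℝ (Fin l))) {c : ℝ}
    (h : ∀ v ∈ V, f v ≤ c) {x : EuclideanSpace ℝ (Fin l)} (hx : x ∈ convexHull ℝ V) : f x ≤ c := by
  have : Convex ℝ {x | f x ≤ c} := convex_halfSpace_le f.toLinearMap.isLinear c
  exact convexHull_min (s := V) (t := {x | f x ≤ c}) h this hx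

theorem mem_polytopeFaces {P : Set (EuclideanSpace ℝ (Fin l))}
    (f : StrongDual ℝ (EuclideanSpace ℝ (Fin l))) {m : EuclideanSpace ℝ (Fin l)} (hm : m ∈ P)
    (h : ∀ x ∈ P, f x ≤ f m) : {x | x ∈ P ∧ f x = f m} ∈ polytopeFaces P := by
  refine ⟨⟨m, hm, rfl⟩, fun _ => ⟨f, ?_⟩⟩
  ext x
  constructor
  · rintro ⟨h1, h2⟩
    exact ⟨h1, fun y hy => h2 ▸ h y hy⟩
  · rintro ⟨h1, h2⟩
    exact ⟨h1, le_antisymm (h x h1) (h2 m hm)⟩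

/-- Write a point of `Q` as a convex combination of `V`. Since the functional of `Q` is maximal
there, only generators in `Q` carry weight; these lie in `Q₁`, so the functional of `Q₁` is maximal
at the point too. -/
theorem face_subset_of_vertices (hV : V.Finite) {Q Q₁ : Set (EuclideanSpace ℝ (Fin l))}
    (hQ : Q ∈ polytopeFaces (convexHull ℝ V)) (hQ₁ : Q₁ ∈ polytopeFaces (convexHull ℝ V))
    (h : Q ∩ V ⊆ Q₁) : Q ⊆ Q₁ := by
  intro x hx
  obtain ⟨f, hf, hfQ⟩ := exists_functional hQ hx
  obtain ⟨m, hm⟩ := hQ₁.1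
  obtain ⟨g, hg, hgQ⟩ := exists_functional hQ₁ hm
  have hxP := ((hfQ x).1 hx).1
  refine (hgQ x).2 ⟨hxP, ?_⟩
  have hxV : x ∈ convexHull ℝ (hV.toFinset : Set (EuclideanSpace ℝ (Fin l))) := by simpa using hxP
  obtain ⟨w, hw0, hw1, hwx⟩ := (Finset.mem_convexHull' (R := ℝ)).1 hxV
  have hVP : ∀ v ∈ hV.toFinset, v ∈ convexHull ℝ V := fun v hv =>
    subset_convexHull ℝ V (hV.mem_toFinset.1 hv)
  have hsum : ∀ k : StrongDual ℝ (EuclideanSpace ℝ (Fin l)), ∀ c : ℝ,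
      ∑ v ∈ hV.toFinset, w v * (c - k v) = c - k x := by
    intro k c
    rw [← hwx, map_sum]
    simp only [mul_sub, Finset.sum_sub_distrib, ← Finset.sum_mul, hw1, one_mul, map_smul,
      smul_eq_mul]
  have h0 := hsum f (f x)
  rw [sub_self, Finset.sum_eq_zero_iff_of_nonneg
    (fun v hv => mul_nonneg (hw0 v hv) (sub_nonneg.2 (hf v (hVP v hv))))] at h0
  have h1 := hsum g (g m)
  rw [Finset.sum_eq_zero] at h1
  · linarith
  · intro v hv
    rcases mul_eq_zero.1 (h0 v hv) with h2 | h2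
    · rw [h2, zero_mul]
    · have hvQ : v ∈ Q := (hfQ v).2 ⟨hVP v hv, by linarith⟩
      rw [((hgQ v).1 (h ⟨hvQ, hV.mem_toFinset.1 hv⟩)).2, sub_self, mul_zero]

/-- The face lattice of a polytope is coatomic: a face is separated from any face not contained
in it by a maximal proper face. -/
theorem exists_coatom_face (hV : V.Finite) {Q Q' : Set (EuclideanSpace ℝ (Fin l))}
    (hQ : Q ∈ polytopeFaces (convexHull ℝ V)) (hQ' : Q' ∈ polytopeFaces (convexHull ℝ V))
    (h : ¬ Q' ⊆ Q) :
    ∃ M ∈ polytopeFaces (convexHull ℝ V), Q ⊆ M ∧ ¬ Q' ⊆ M ∧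
      ∀ M₁ ∈ polytopeFaces (convexHull ℝ V), M ⊆ M₁ → M₁ = M ∨ M₁ = convexHull ℝ V := by
  obtain ⟨q, hq', hq⟩ := Set.not_subset.1 h
  have hqP : q ∈ convexHull ℝ V := hQ'.2.subset hq'
  -- Maximality is measured by the number of generators in the face, which is bounded since `V` is
  -- finite and determines inclusion of faces.
  obtain ⟨M, ⟨hMf, hQM, hqM⟩, hmax⟩ :
      ∃ M, (M ∈ polytopeFaces (convexHull ℝ V) ∧ Q ⊆ M ∧ q ∉ M) ∧
        ∀ M₁, (M₁ ∈ polytopeFaces (convexHull ℝ V) ∧ Q ⊆ M₁ ∧ q ∉ M₁) →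
          (M₁ ∩ V).ncard ≤ (M ∩ V).ncard := by
    have hfin : {n | ∃ M, (M ∈ polytopeFaces (convexHull ℝ V) ∧ Q ⊆ M ∧ q ∉ M) ∧
        (M ∩ V).ncard = n}.Finite := by
      refine (Set.finite_Iic V.ncard).subset ?_
      rintro _ ⟨M, -, rfl⟩
      exact Set.ncard_le_ncard Set.inter_subset_right hV
    obtain ⟨n, ⟨M, hM, rfl⟩, hn⟩ := hfin.exists_maximal ⟨_, Q, ⟨hQ, subset_rfl, hq⟩, rfl⟩
    refine ⟨M, hM, fun M₁ h1 => ?_⟩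
    by_contra hlt
    exact hlt (hn ⟨M₁, h1, rfl⟩ (not_le.1 hlt).le)
  have hstrict : ∀ M₁ ∈ polytopeFaces (convexHull ℝ V), M ⊆ M₁ → q ∉ M₁ → M₁ = M := by
    intro M₁ h1 h2 h3
    refine (face_subset_of_vertices hV h1 hMf fun v hv => ?_).antisymm h2
    by_contra hvM
    have : (M ∩ V) ⊂ (M₁ ∩ V) := by
      refine ⟨Set.inter_subset_inter_left _ h2, fun hc => hvM (hc hv).1⟩
    exact absurd (hmax M₁ ⟨h1, hQM.trans h2, h3⟩)
      (not_le.2 (Set.ncard_lt_ncard this (hV.subset Set.inter_subset_right)))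
  refine ⟨M, hMf, hQM, fun hc => hqM (hc hq'), fun M₁ h1 h2 => ?_⟩
  by_contra! hne
  have hqM₁ : q ∈ M₁ := by
    by_contra hc
    exact hne.1 (hstrict M₁ h1 h2 hc)
  obtain ⟨m, hm⟩ := hMf.1
  obtain ⟨f, hf, hfM⟩ := exists_functional hMf hm
  obtain ⟨g, hg, hgM⟩ := exists_functional h1 (h2 hm)
  have hVP : ∀ v ∈ V, v ∈ convexHull ℝ V := fun v hv => subset_convexHull ℝ V hv
  obtain ⟨v₀, hv₀, hv₀M⟩ : ∃ v ∈ V, v ∉ M₁ := by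
    by_contra! hc
    refine hne.2 (h1.2.subset.antisymm ?_)
    have hPP : convexHull ℝ V ∈ polytopeFaces (convexHull ℝ V) :=
      ⟨⟨q, hqP⟩, IsExposed.refl _⟩
    exact face_subset_of_vertices hV hPP h1 fun v hv => hc v hv.2
  -- Tilt the supporting functional `f` of `M` by `-t • g`, with `g` supporting `M₁`, until a
  -- generator `v` outside `M₁` is first reached; `t` is the smallest ratio. Since `q ∈ M₁`, the
  -- tilt leaves `f m - f q` unchanged, so the new face contains `M` and `v` but not `q`,
  -- contradicting maximality of `M`.
  obtain ⟨v, ⟨hv, hvM⟩, hvmin⟩ := Set.exists_min_image {v | v ∈ V ∧ v ∉ M₁}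
    (fun v => (f m - f v) / (g m - g v)) (hV.subset fun v hv => hv.1) ⟨v₀, hv₀, hv₀M⟩
  have hgpos : ∀ v, v ∈ V → v ∉ M₁ → 0 < g m - g v := by
    intro v hv hvM
    rcases (hg v (hVP v hv)).lt_or_eq with h3 | h3
    · linarith
    · exact absurd ((hgM v).2 ⟨hVP v hv, h3⟩) hvM
  set t := (f m - f v) / (g m - g v) with ht
  have ht0 : 0 ≤ t := div_nonneg (by linarith [hf v (hVP v hv)]) (hgpos v hv hvM).le
  have htv : t * (g m - g v) = f m - f v := div_mul_cancel₀ _ (hgpos v hv hvM).ne'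
  have hle : ∀ x ∈ convexHull ℝ V, (f - t • g) x ≤ (f - t • g) m := by
    intro x hx
    refine le_of_forall_vertex _ (fun u hu => ?_) hx
    simp only [sub_apply, smul_apply, smul_eq_mul]
    by_cases huM : u ∈ M₁
    · have := ((hgM u).1 huM).2
      rw [this]
      linarith [hf u (hVP u hu)]
    · have h3 := hvmin u ⟨hu, huM⟩
      rw [le_div_iff₀ (hgpos u hu huM)] at h3
      linarith
  have hface := mem_polytopeFaces (f - t • g) ((hfM m).1 hm).1 hle
  have hM₂ := hstrict _ hface ?_ ?_
  · refine hvM (h2 (hM₂ ▸ ⟨hVP v hv, ?_⟩))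
    simp only [sub_apply, smul_apply, smul_eq_mul]
    linarith
  · intro x hx
    refine ⟨((hfM x).1 hx).1, ?_⟩
    simp only [sub_apply, smul_apply, smul_eq_mul]
    rw [((hfM x).1 hx).2, ((hgM x).1 (h2 hx)).2]
  · rintro ⟨-, h3⟩
    simp only [sub_apply, smul_apply, smul_eq_mul] at h3
    rw [((hgM q).1 hqM₁).2] at h3
    exact hqM ((hfM q).2 ⟨hqP, by linarith⟩)

end Polytope

/-! ### Linearisation of the stabilisers -/

section Linearisation

open Topology

set_option linter.unusedSectionVars false

/-- A chart around `x` in which the stabiliser of `x` acts linearly. -/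
structure LinModel (l : ℕ) (W : Type*) [Group W] {X : Type*} [TopologicalSpace X]
    [ChartedSpace (EuclideanSpace ℝ (Fin l)) X] [MulAction W X] (x : X) where
  /-- the chart -/
  e : OpenPartialHomeomorph X (EuclideanSpace ℝ (Fin l))
  mem_atlas : e ∈ IsManifold.maximalAtlas (𝓡 l) ∞ X
  mem_source : x ∈ e.source
  map_self : e x = 0
  /-- the linear action -/
  ρ : W → EuclideanSpace ℝ (Fin l) →ₗ[ℝ] EuclideanSpace ℝ (Fin l)
  ρ_one : ρ 1 = LinearMap.id
  ρ_mul : ∀ g h : W, g • x = x → h • x = x → ρ (g * h) = ρ g ∘ₗ ρ h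
  smul_mem : ∀ g : W, g • x = x → ∀ y ∈ e.source, g • y ∈ e.source
  e_smul : ∀ g : W, g • x = x → ∀ y ∈ e.source, e (g • y) = ρ g (e y)
  convex : Convex ℝ e.target
  eq_of_mem : ∀ (g : W) (y : X), y ∈ e.source → g • y ∈ e.source → g • x = x

variable {l : ℕ} {W : Type*} [Group W] {X : Type*} [TopologicalSpace X] [T2Space X]
  [ChartedSpace (EuclideanSpace ℝ (Fin l)) X] [MulAction W X]

theorem finite_stabilizer [ProperlyDiscontinuousSMul W X] (x : X) :
    {g : W | g • x = x}.Finite := by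
  have := ProperlyDiscontinuousSMul.finite_disjoint_inter_image (Γ := W)
    (isCompact_singleton (x := x)) (isCompact_singleton (x := x))
  refine this.subset fun g hg => ?_
  exact ⟨x, ⟨x, rfl, hg⟩, rfl⟩

/-- Only finitely many elements bring a compact neighbourhood back to itself, and the Hausdorff
property pushes away each of those that moves `x`. As a consequence every wall meeting a small chart
passes through its centre. -/
theorem exists_nhds_eq_of_mem [LocallyCompactSpace X] [ProperlyDiscontinuousSMul W X] [ContinuousConstSMul W X] (x : X) :
    ∃ N ∈ 𝓝 x, ∀ (g : W) (y : X), y ∈ N → g • y ∈ N → g • x = x := by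
  obtain ⟨K, hK, hxK⟩ := exists_compact_mem_nhds x
  have hfin := ProperlyDiscontinuousSMul.finite_disjoint_inter_image (Γ := W) hK hK
  have hN : ∀ g : W, ∃ N ∈ 𝓝 x, g • x ≠ x → ∀ y ∈ N, g • y ∉ N := by
    intro g
    by_cases hg : g • x = x
    · exact ⟨Set.univ, Filter.univ_mem, fun h => absurd hg h⟩
    obtain ⟨U, V, hU, hV, hgU, hxV, hd⟩ := t2_separation hg
    refine ⟨V ∩ (fun y => g • y) ⁻¹' U, Filter.inter_mem (hV.mem_nhds hxV)
      ((hU.preimage (continuous_const_smul g)).mem_nhds hgU), fun _ y hy hgy => ?_⟩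
    exact Set.disjoint_left.1 hd hy.2 hgy.1
  choose N hN hN' using hN
  refine ⟨K ∩ ⋂ g ∈ {g : W | ((g • ·) '' K ∩ K).Nonempty}, N g, Filter.inter_mem hxK
    ((Filter.biInter_mem hfin).2 fun g _ => hN g), fun g y hy hgy => ?_⟩
  by_contra hne
  have hg : g ∈ {g : W | ((g • ·) '' K ∩ K).Nonempty} := ⟨g • y, ⟨y, hy.1, rfl⟩, hgy.1⟩
  exact hN' g hne y (Set.mem_iInter₂.1 hy.2 g hg) (Set.mem_iInter₂.1 hgy.2 g hg)

variable [IsManifold (𝓡 l) ∞ X]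

/-! ### Averaging a chart over a stabiliser -/

/-- The action of `g` read in the chart at `x`. -/
def chartAction (l : ℕ) {W : Type*} [Group W] {X : Type*} [TopologicalSpace X]
    [ChartedSpace (EuclideanSpace ℝ (Fin l)) X] [MulAction W X] (x : X) (g : W) :
    EuclideanSpace ℝ (Fin l) → EuclideanSpace ℝ (Fin l) :=
  fun v => chartAt (EuclideanSpace ℝ (Fin l)) x
    (g • (chartAt (EuclideanSpace ℝ (Fin l)) x).symm v)

/-- The derivative at `x` of the action of `g`. -/
noncomputable def isotropy (l : ℕ) {W : Type*} [Group W] {X : Type*} [TopologicalSpace X]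
    [ChartedSpace (EuclideanSpace ℝ (Fin l)) X] [MulAction W X] (x : X) (g : W) :
    EuclideanSpace ℝ (Fin l) →L[ℝ] EuclideanSpace ℝ (Fin l) :=
  fderiv ℝ (chartAction l x g) (chartAt (EuclideanSpace ℝ (Fin l)) x x)

theorem chartAction_self (x : X) {g : W} (hg : g • x = x) :
    chartAction l x g (chartAt (EuclideanSpace ℝ (Fin l)) x x)
      = chartAt (EuclideanSpace ℝ (Fin l)) x x := by
  simp [chartAction, hg]

theorem contDiffAt_chartAction (hs : ∀ w : W, ContMDiff (𝓡 l) (𝓡 l) ∞ (fun x : X => w • x))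
    (x : X) (g : W) {v : EuclideanSpace ℝ (Fin l)}
    (hv : v ∈ (chartAt (EuclideanSpace ℝ (Fin l)) x).target)
    (hgv : g • (chartAt (EuclideanSpace ℝ (Fin l)) x).symm v ∈
      (chartAt (EuclideanSpace ℝ (Fin l)) x).source) :
    ContDiffAt ℝ ∞ (chartAction l x g) v := by
  rw [← contMDiffAt_iff_contDiffAt]
  have hc : chartAt (EuclideanSpace ℝ (Fin l)) x ∈ IsManifold.maximalAtlas (𝓡 l) ∞ X :=
    IsManifold.chart_mem_maximalAtlas x
  exact (contMDiffAt_of_mem_maximalAtlas hc hgv).comp v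
    ((hs g).contMDiffAt.comp v (contMDiffAt_symm_of_mem_maximalAtlas hc hv))

theorem hasFDerivAt_chartAction (hs : ∀ w : W, ContMDiff (𝓡 l) (𝓡 l) ∞ (fun x : X => w • x))
    (x : X) {g : W} (hg : g • x = x) : HasFDerivAt (chartAction l x g) (isotropy l x g)
      (chartAt (EuclideanSpace ℝ (Fin l)) x x) := by
  refine ((contDiffAt_chartAction hs x g (by simp) ?_).differentiableAt (by simp)).hasFDerivAt
  simp [hg]

theorem isotropy_one (x : X) : isotropy l x (1 : W) = ContinuousLinearMap.id ℝ _ := by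
  have : chartAction l x (1 : W) =ᶠ[𝓝 (chartAt (EuclideanSpace ℝ (Fin l)) x x)] id := by
    filter_upwards [(chartAt (EuclideanSpace ℝ (Fin l)) x).open_target.mem_nhds
      (mem_chart_target _ x)] with v hv
    simp [chartAction, hv]
  rw [isotropy, this.fderiv_eq, fderiv_id]

theorem isotropy_mul (hs : ∀ w : W, ContMDiff (𝓡 l) (𝓡 l) ∞ (fun x : X => w • x)) (x : X)
    {g h : W} (hg : g • x = x) (hh : h • x = x) :
    isotropy l x (g * h) = (isotropy l x g).comp (isotropy l x h) := by
  have hc := hasFDerivAt_chartAction hs x hg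
  rw [← chartAction_self x hh] at hc
  have hcomp := hc.comp _ (hasFDerivAt_chartAction hs x hh)
  refine HasFDerivAt.fderiv (hcomp.congr_of_eventuallyEq ?_)
  have hcont : ContinuousAt (fun v => h • (chartAt (EuclideanSpace ℝ (Fin l)) x).symm v)
      (chartAt (EuclideanSpace ℝ (Fin l)) x x) :=
    (hs h).continuous.continuousAt.comp
      ((chartAt (EuclideanSpace ℝ (Fin l)) x).continuousAt_symm (mem_chart_target _ x))
  filter_upwards [hcont ((chartAt (EuclideanSpace ℝ (Fin l)) x).open_source.mem_nhds
    (by simp [hh]))] with v hv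
  simp only [chartAction, Function.comp]
  rw [(chartAt (EuclideanSpace ℝ (Fin l)) x).left_inv hv, mul_smul]

/-- The average over the stabiliser of the chart at `x`. -/
noncomputable def averagedChart (l : ℕ) {W : Type*} [Group W] {X : Type*} [TopologicalSpace X]
    [ChartedSpace (EuclideanSpace ℝ (Fin l)) X] [MulAction W X] (x : X) (G : Finset W) (y : X) :
    EuclideanSpace ℝ (Fin l) :=
  ∑ g ∈ G, isotropy l x g⁻¹ (chartAt (EuclideanSpace ℝ (Fin l)) x (g • y) -
    chartAt (EuclideanSpace ℝ (Fin l)) x x)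

/-- Replacing `y` by `h • y` only reindexes the sum by `g ↦ g * h`, leaving a factor `isotropy l x
h` outside. -/
theorem averagedChart_smul (hs : ∀ w : W, ContMDiff (𝓡 l) (𝓡 l) ∞ (fun x : X => w • x)) (x : X)
    {G : Finset W} (hG : ∀ g, g ∈ G ↔ g • x = x) {h : W} (hh : h • x = x) (y : X) :
    averagedChart l x G (h • y) = isotropy l x h (averagedChart l x G y) := by
  have hinv : ∀ {g : W}, g • x = x → g⁻¹ • x = x := fun hg => by rw [inv_smul_eq_iff, hg]
  rw [averagedChart, averagedChart, map_sum]
  refine Finset.sum_equiv (Equiv.mulRight h) (fun g => ?_) (fun g hg => ?_)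
  · rw [hG, hG, Equiv.coe_mulRight, mul_smul, hh]
  · have hg' := (hG g).1 hg
    rw [Equiv.coe_mulRight, mul_inv_rev, isotropy_mul hs x (hinv hh) (hinv hg'),
      ContinuousLinearMap.comp_apply, ← ContinuousLinearMap.comp_apply (isotropy l x h),
      ← isotropy_mul hs x hh (hinv hh), mul_inv_cancel, isotropy_one, mul_smul]
    rfl

theorem averagedChart_self (x : X) {G : Finset W} (hG : ∀ g, g ∈ G ↔ g • x = x) :
    averagedChart l x G x = 0 := by
  refine Finset.sum_eq_zero fun g hg => ?_
  rw [(hG g).1 hg, sub_self, map_zero]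

theorem averagedChart_symm (x : X) (G : Finset W) (v : EuclideanSpace ℝ (Fin l)) :
    averagedChart l x G ((chartAt (EuclideanSpace ℝ (Fin l)) x).symm v) =
      ∑ g ∈ G, isotropy l x g⁻¹ (chartAction l x g v -
        chartAt (EuclideanSpace ℝ (Fin l)) x x) := rfl

theorem contDiffAt_averagedChart
    (hs : ∀ w : W, ContMDiff (𝓡 l) (𝓡 l) ∞ (fun x : X => w • x)) (x : X)
    (G : Finset W) {v : EuclideanSpace ℝ (Fin l)}
    (hv : v ∈ (chartAt (EuclideanSpace ℝ (Fin l)) x).target)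
    (hgv : ∀ g ∈ G, g • (chartAt (EuclideanSpace ℝ (Fin l)) x).symm v ∈
      (chartAt (EuclideanSpace ℝ (Fin l)) x).source) :
    ContDiffAt ℝ ∞ (fun v => averagedChart l x G
      ((chartAt (EuclideanSpace ℝ (Fin l)) x).symm v)) v := by
  simp only [averagedChart_symm]
  refine ContDiffAt.sum fun g hg => ?_
  exact (isotropy l x g⁻¹).contDiff.contDiffAt.comp v
    ((contDiffAt_chartAction hs x g hv (hgv g hg)).sub contDiffAt_const)

/-- Each summand has derivative `dg⁻¹ ∘ dg = id` at the centre. The sum is therefore invertible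
there, so the inverse function theorem applies. -/
theorem hasFDerivAt_averagedChart
    (hs : ∀ w : W, ContMDiff (𝓡 l) (𝓡 l) ∞ (fun x : X => w • x)) (x : X)
    {G : Finset W} (hG : ∀ g, g ∈ G ↔ g • x = x) :
    HasFDerivAt (fun v => averagedChart l x G
      ((chartAt (EuclideanSpace ℝ (Fin l)) x).symm v))
      ((G.card : ℝ) • ContinuousLinearMap.id ℝ (EuclideanSpace ℝ (Fin l)))
      (chartAt (EuclideanSpace ℝ (Fin l)) x x) := by
  simp only [averagedChart_symm]
  have hinv : ∀ {g : W}, g • x = x → g⁻¹ • x = x := fun hg => by rw [inv_smul_eq_iff, hg]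
  have : ((G.card : ℝ) • ContinuousLinearMap.id ℝ (EuclideanSpace ℝ (Fin l))) =
      ∑ g ∈ G, (isotropy l x g⁻¹).comp (isotropy l x g) := by
    rw [Finset.sum_congr rfl (g := fun _ => ContinuousLinearMap.id ℝ _)]
    · rw [Finset.sum_const]
      ext v : 1
      exact Nat.cast_smul_eq_nsmul ℝ _ v
    · intro g hg
      have hg' := (hG g).1 hg
      rw [← isotropy_mul hs x (hinv hg') hg', inv_mul_cancel, isotropy_one]
  rw [this]
  refine HasFDerivAt.fun_sum fun g hg => ?_
  have h1 := (hasFDerivAt_chartAction hs x ((hG g).1 hg)).sub_const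
    (chartAt (EuclideanSpace ℝ (Fin l)) x x)
  exact (isotropy l x g⁻¹).hasFDerivAt.comp _ h1

/-- Averaging the chart gives a local diffeomorphism. -/
theorem exists_averaged_homeomorph
    (hs : ∀ w : W, ContMDiff (𝓡 l) (𝓡 l) ∞ (fun x : X => w • x)) (x : X)
    {G : Finset W} (hG : ∀ g, g ∈ G ↔ g • x = x) :
    ∃ e ∈ IsManifold.maximalAtlas (𝓡 l) ∞ X, x ∈ e.source ∧
      ∀ y ∈ e.source, e y = averagedChart l x G y := by
  set c := chartAt (EuclideanSpace ℝ (Fin l)) x with hc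
  have hcA : c ∈ IsManifold.maximalAtlas (𝓡 l) ∞ X := IsManifold.chart_mem_maximalAtlas x
  set f : EuclideanSpace ℝ (Fin l) → EuclideanSpace ℝ (Fin l) :=
    fun v => averagedChart l x G (c.symm v) with hf
  have hxc : x ∈ c.source := mem_chart_source _ x
  have hcard : (G.card : ℝ) ≠ 0 := by
    have : (1 : W) ∈ G := (hG 1).2 (one_smul _ _)
    exact Nat.cast_ne_zero.2 (Finset.card_ne_zero_of_mem this)
  set O : Set (EuclideanSpace ℝ (Fin l)) :=
    c.target ∩ c.symm ⁻¹' (⋂ g ∈ G, (fun y => g • y) ⁻¹' c.source) with hO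
  have hOo : IsOpen O := by
    refine c.symm.isOpen_inter_preimage (isOpen_biInter_finset fun g _ => ?_)
    exact c.open_source.preimage (hs g).continuous
  have hmemO : ∀ y, y ∈ c.source → (∀ g ∈ G, g • y ∈ c.source) → c y ∈ O := fun y hy hgy =>
    ⟨c.map_source hy, by simpa [c.left_inv hy] using hgy⟩
  have hfO : ∀ v ∈ O, ContDiffAt ℝ ∞ f v := fun v hv =>
    contDiffAt_averagedChart hs x G hv.1 (by simpa using hv.2)
  have hxO : c x ∈ O := hmemO x hxc fun g hg => by rwa [(hG g).1 hg]
  have hfx := hasFDerivAt_averagedChart hs x hG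
  let L : EuclideanSpace ℝ (Fin l) ≃L[ℝ] EuclideanSpace ℝ (Fin l) :=
    ContinuousLinearEquiv.smulLeft (Units.mk0 (G.card : ℝ) hcard)
  have hL : ((G.card : ℝ) • ContinuousLinearMap.id ℝ (EuclideanSpace ℝ (Fin l))) = L := by
    ext v; rfl
  rw [hL] at hfx
  have hfx' : HasFDerivAt f (L : EuclideanSpace ℝ (Fin l) →L[ℝ] _) (c x) := hfx
  set k := (hfO _ hxO).toOpenPartialHomeomorph f hfx' (by simp) with hk
  have hkf : ∀ v, k v = f v := fun v => rfl
  have hxk : c x ∈ k.source := (hfO _ hxO).mem_toOpenPartialHomeomorph_source hfx' (by simp)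
  -- Membership in the smooth atlas needs a smooth inverse on the whole domain, so the domain is cut
  -- down to where the derivative stays invertible; this is an open condition.
  have hinvertible : ∀ᶠ v in 𝓝 (c x), fderiv ℝ f v ∈
      Set.range ((↑) : (EuclideanSpace ℝ (Fin l) ≃L[ℝ] EuclideanSpace ℝ (Fin l)) → _) := by
    have hcont : ContinuousAt (fderiv ℝ f) (c x) :=
      ((hfO _ hxO).fderiv_right (m := 0) (by simp)).continuousAt
    refine hcont ?_
    rw [hfx'.fderiv]
    exact ContinuousLinearEquiv.nhds L
  obtain ⟨O', hO', hO'o, hxO'⟩ := eventually_nhds_iff.1 hinvertible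
  set e := c.trans (k.restrOpen (O ∩ O') (hOo.inter hO'o)) with he
  have hsource : ∀ y, y ∈ e.source ↔ y ∈ c.source ∧ c y ∈ k.source ∧ c y ∈ O ∧ c y ∈ O' := by
    intro y
    simp [he]
  have hey : ∀ y ∈ c.source, e y = averagedChart l x G y := by
    intro y hy
    change f (c y) = _
    rw [hf]
    simp only [c.left_inv hy]
  refine ⟨e, e.mem_maximalAtlas_of_contMDiffOn ?_ ?_, (hsource x).2 ⟨hxc, hxk, hxO, hxO'⟩,
    fun y hy => hey y ((hsource y).1 hy).1⟩
  · intro y hy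
    obtain ⟨h1, -, h3, -⟩ := (hsource y).1 hy
    exact ((hfO _ h3).contMDiffAt.comp y
      (contMDiffAt_of_mem_maximalAtlas hcA h1)).contMDiffWithinAt
  · intro v hv
    obtain ⟨h1, h2, h3, h4⟩ := (hsource _).1 (e.map_target hv)
    have hv' : v ∈ k.target := by
      have := k.map_source h2
      have e1 : k (c (e.symm v)) = v := e.right_inv hv
      rwa [e1] at this
    have e2 : c (e.symm v) = k.symm v := by
      have := k.left_inv h2
      have e1 : k (c (e.symm v)) = v := e.right_inv hv
      rw [← this, e1]
    rw [e2] at h3 h4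
    obtain ⟨M, hM⟩ := hO' _ h4
    have hder : HasFDerivAt k (M : EuclideanSpace ℝ (Fin l) →L[ℝ] _) (k.symm v) := by
      rw [hM]
      exact ((hfO _ h3).differentiableAt (by simp)).hasFDerivAt
    have hks := k.contDiffAt_symm hv' hder (hfO _ h3)
    exact ((contMDiffAt_symm_of_mem_maximalAtlas hcA h3.1).comp v
      hks.contMDiffAt).contMDiffWithinAt

theorem exists_linModel [ProperlyDiscontinuousSMul W X]
    (hs : ∀ w : W, ContMDiff (𝓡 l) (𝓡 l) ∞ (fun x : X => w • x)) (x : X) :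
    Nonempty (LinModel l W x) := by
  have : LocallyCompactSpace X := ChartedSpace.locallyCompactSpace (EuclideanSpace ℝ (Fin l)) X
  have : ContinuousConstSMul W X := ⟨fun w => (hs w).continuous⟩
  obtain ⟨N, hN, hN'⟩ := exists_nhds_eq_of_mem (W := W) x
  set G : Finset W := (finite_stabilizer (W := W) x).toFinset with hGdef
  have hG : ∀ g, g ∈ G ↔ g • x = x := fun g => by simp [hGdef]
  have h1G : (1 : W) ∈ G := (hG 1).2 (one_smul _ _)
  obtain ⟨e, he, hxe, hey⟩ := exists_averaged_homeomorph hs x hG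
  have hex : e x = 0 := by rw [hey x hxe, averagedChart_self x hG]
  set V : Set X := ⋂ g ∈ G, (fun y => g • y) ⁻¹' (e.source ∩ interior N) with hV
  have hVo : IsOpen V := isOpen_biInter_finset fun g _ =>
    (e.open_source.inter isOpen_interior).preimage (continuous_const_smul g)
  have hxV : x ∈ V := Set.mem_iInter₂.2 fun g hg => by
    change g • x ∈ e.source ∩ interior N
    rw [(hG g).1 hg]
    exact ⟨hxe, mem_interior_iff_mem_nhds.2 hN⟩
  have hVsub : V ⊆ e.source ∩ interior N := fun y hy => by
    have := Set.mem_iInter₂.1 hy 1 h1G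
    simpa using this
  have hVinv : ∀ g : W, g • x = x → ∀ y ∈ V, g • y ∈ V := by
    intro g hg y hy
    refine Set.mem_iInter₂.2 fun h hh => ?_
    have hhg : h * g ∈ G := (hG _).2 (by rw [mul_smul, hg, (hG h).1 hh])
    have := Set.mem_iInter₂.1 hy _ hhg
    simpa only [Set.mem_preimage, mul_smul] using this
  have hopen : IsOpen (e.target ∩ e.symm ⁻¹' V) := e.symm.isOpen_inter_preimage hVo
  have h0 : (0 : EuclideanSpace ℝ (Fin l)) ∈ e.target ∩ e.symm ⁻¹' V := by
    rw [← hex]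
    exact ⟨e.map_source hxe, by rwa [Set.mem_preimage, e.left_inv hxe]⟩
  obtain ⟨ε, hε, hball⟩ := Metric.isOpen_iff.1 hopen 0 h0
  -- The isotropy maps need not be orthogonal, so a ball need not be invariant; the finite
  -- intersection of its preimages is invariant, open and still convex.
  set B : Set (EuclideanSpace ℝ (Fin l)) := ⋂ g ∈ G, isotropy l x g ⁻¹' Metric.ball 0 ε with hB
  have hBo : IsOpen B := isOpen_biInter_finset fun g _ =>
    Metric.isOpen_ball.preimage (isotropy l x g).continuous
  have hBsub : B ⊆ e.target ∩ e.symm ⁻¹' V := fun v hv => hball <| by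
    have := Set.mem_iInter₂.1 hv 1 h1G
    simpa [isotropy_one] using this
  have hBinv : ∀ g : W, g • x = x → ∀ v ∈ B, isotropy l x g v ∈ B := by
    intro g hg v hv
    refine Set.mem_iInter₂.2 fun h hh => ?_
    have hhg : h * g ∈ G := (hG _).2 (by rw [mul_smul, hg, (hG h).1 hh])
    have := Set.mem_iInter₂.1 hv _ hhg
    rwa [Set.mem_preimage, isotropy_mul hs x ((hG h).1 hh) hg] at this
  have hso : IsOpen (e.source ∩ e ⁻¹' B) := e.isOpen_inter_preimage hBo
  have hsrc : ∀ y, y ∈ (e.restr (e.source ∩ e ⁻¹' B)).source ↔ y ∈ e.source ∧ e y ∈ B := by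
    intro y
    rw [e.restr_source' _ hso]
    simp
  have hsV : ∀ y, y ∈ e.source → e y ∈ B → y ∈ V := by
    intro y hy hyB
    have := (hBsub hyB).2
    rwa [Set.mem_preimage, e.left_inv hy] at this
  have hequiv : ∀ g : W, g • x = x → ∀ y, y ∈ e.source → e y ∈ B → g • y ∈ e.source ∧
      e (g • y) = isotropy l x g (e y) := by
    intro g hg y hy hyB
    have h1 := (hVsub (hVinv g hg y (hsV y hy hyB))).1
    exact ⟨h1, by rw [hey _ h1, hey _ hy, averagedChart_smul hs x hG hg]⟩
  refine ⟨{ e := e.restr (e.source ∩ e ⁻¹' B)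
            mem_atlas := restr_mem_maximalAtlas _ he hso
            mem_source := (hsrc x).2 ⟨hxe, ?_⟩
            map_self := hex
            ρ := fun g => (isotropy l x g : _ →ₗ[ℝ] _)
            ρ_one := ?_
            ρ_mul := ?_
            smul_mem := ?_
            e_smul := ?_
            convex := ?_
            eq_of_mem := ?_ }⟩
  · rw [hex]
    refine Set.mem_iInter₂.2 fun g _ => ?_
    simpa using hε
  · rw [isotropy_one]; rfl
  · intro g h hg hh
    rw [isotropy_mul hs x hg hh]; rfl
  · intro g hg y hy
    obtain ⟨h1, h2⟩ := (hsrc y).1 hy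
    obtain ⟨h3, h4⟩ := hequiv g hg y h1 h2
    exact (hsrc _).2 ⟨h3, h4 ▸ hBinv g hg _ h2⟩
  · intro g hg y hy
    obtain ⟨h1, h2⟩ := (hsrc y).1 hy
    exact (hequiv g hg y h1 h2).2
  · have : (e.restr (e.source ∩ e ⁻¹' B)).target = B := by
      ext v
      rw [OpenPartialHomeomorph.restr_target, hso.interior_eq]
      constructor
      · rintro ⟨h1, -, h2⟩
        rwa [Set.mem_preimage, e.right_inv h1] at h2
      · intro hv
        have h1 := (hBsub hv).1
        exact ⟨h1, e.map_target h1, by rwa [Set.mem_preimage, e.right_inv h1]⟩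
    rw [this]
    exact convex_iInter₂ fun g _ => (convex_ball (0 : EuclideanSpace ℝ (Fin l)) ε).linear_preimage
      (isotropy l x g).toLinearMap
  · intro g y hy hgy
    obtain ⟨h1, h2⟩ := (hsrc y).1 hy
    obtain ⟨h3, h4⟩ := (hsrc _).1 hgy
    exact hN' g y (interior_subset (hVsub (hsV y h1 h2)).2)
      (interior_subset (hVsub (hsV _ h3 h4)).2)

end Linearisation

/-! ### The two sides of a wall -/

section Sides

open Topology

set_option linter.unusedSectionVars false

section General

variable {W : Type*} [Group W] {X : Type*} [TopologicalSpace X] [MulAction W X]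

/-- `y` and `z` lie in the same component of the complement of the wall of `r`. -/
def SameSide (r : W) (y z : X) : Prop := z ∈ connectedComponentIn (wall X r)ᶜ y

theorem mem_wall {r : W} {y : X} : y ∈ wall X r ↔ r • y = y := Iff.rfl

theorem smul_mem_wall_conj (g r : W) (y : X) : g • y ∈ wall X (g * r * g⁻¹) ↔ y ∈ wall X r := by
  rw [mem_wall, mem_wall, mul_smul, inv_smul_smul, mul_smul, smul_left_cancel_iff]

theorem isClosed_wall [T2Space X] [ContinuousConstSMul W X] (r : W) : IsClosed (wall X r) :=
  isClosed_eq (continuous_const_smul r) continuous_id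

namespace SameSide

theorem notMem_left {r : W} {y z : X} (h : SameSide r y z) : y ∉ wall X r :=
  connectedComponentIn_nonempty_iff.1 ⟨z, h⟩

theorem notMem_right {r : W} {y z : X} (h : SameSide r y z) : z ∉ wall X r :=
  connectedComponentIn_subset _ _ h

protected theorem refl {r : W} {y : X} (h : y ∉ wall X r) : SameSide r y y :=
  mem_connectedComponentIn h

protected theorem symm {r : W} {y z : X} (h : SameSide r y z) : SameSide r z y := by
  have := connectedComponentIn_eq h
  rw [SameSide, ← this]
  exact mem_connectedComponentIn h.notMem_left

protected theorem trans {r : W} {y z t : X} (h : SameSide r y z) (h' : SameSide r z t) :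
    SameSide r y t := by
  rw [SameSide, connectedComponentIn_eq h]
  exact h'

theorem of_isPreconnected {r : W} {A : Set X} (hA : IsPreconnected A)
    (hAr : ∀ a ∈ A, a ∉ wall X r) {y z : X} (hy : y ∈ A) (hz : z ∈ A) : SameSide r y z :=
  hA.subset_connectedComponentIn hy hAr hz

protected theorem smul [ContinuousConstSMul W X] {r : W} {y z : X} (h : SameSide r y z) (g : W) :
    SameSide (g * r * g⁻¹) (g • y) (g • z) := by
  refine of_isPreconnected (A := (fun x => g • x) '' connectedComponentIn (wall X r)ᶜ y)
    (isPreconnected_connectedComponentIn.image _ (continuous_const_smul g).continuousOn) ?_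
    ⟨y, SameSide.refl h.notMem_left, rfl⟩ ⟨z, h, rfl⟩
  rintro _ ⟨a, ha, rfl⟩ hc
  exact connectedComponentIn_subset _ _ ha ((smul_mem_wall_conj g r a).1 hc)

theorem smul_iff [ContinuousConstSMul W X] {r : W} {y z : X} (g : W) :
    SameSide (g * r * g⁻¹) (g • y) (g • z) ↔ SameSide r y z := by
  refine ⟨fun h => ?_, fun h => h.smul g⟩
  have := h.smul g⁻¹
  rw [inv_smul_smul, inv_smul_smul] at this
  convert this using 1
  group

theorem smul_self [ContinuousConstSMul W X] {r : W} {y z : X} (h : SameSide r y z) :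
    SameSide r (r • y) (r • z) := by
  have := h.smul r
  rwa [mul_inv_cancel_right] at this

end SameSide

theorem conj_mem_reflections [ContinuousConstSMul W X] {r : W} (hr : r ∈ reflections W X) (g : W) :
    g * r * g⁻¹ ∈ reflections W X := by
  refine ⟨?_, fun hc => hr.2 ?_⟩
  · have : g * r * g⁻¹ * (g * r * g⁻¹) = g * (r * r) * g⁻¹ := by group
    rw [this, hr.1, mul_one, mul_inv_cancel]
  · have := hc.image (fun x => g⁻¹ • x) (continuous_const_smul g⁻¹).continuousOn
    convert this using 1
    ext y
    constructor
    · intro hy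
      exact ⟨g • y, fun h => hy ((smul_mem_wall_conj g r y).1 h), inv_smul_smul g y⟩
    · rintro ⟨z, hz, rfl⟩ h
      refine hz ?_
      have := (smul_mem_wall_conj g r (g⁻¹ • z)).2 h
      rwa [smul_inv_smul] at this

theorem smul_smul_self {r : W} (hr : r ∈ reflections W X) (y : X) : r • r • y = y := by
  rw [smul_smul, hr.1, one_smul]

theorem inv_reflection {r : W} (hr : r ∈ reflections W X) : r⁻¹ = r :=
  inv_eq_of_mul_eq_one_left hr.1

end General

variable {l : ℕ} {W : Type*} [Group W] {X : Type*} [TopologicalSpace X] [T2Space X]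
  [ChartedSpace (EuclideanSpace ℝ (Fin l)) X] [MulAction W X]

namespace LinModel

variable {x : X} (M : LinModel l W x)

theorem tendsto_line {b : X} (hb : b ∈ M.e.source) (v : EuclideanSpace ℝ (Fin l)) :
    Filter.Tendsto (fun t : ℝ => M.e.symm (M.e b + t • v)) (𝓝 0) (𝓝 b) := by
  have h1 : Filter.Tendsto (fun t : ℝ => M.e b + t • v) (𝓝 0) (𝓝 (M.e b)) := by
    have : Continuous fun t : ℝ => M.e b + t • v := by fun_prop
    simpa using this.tendsto 0
  have h2 := M.e.continuousAt_symm (M.e.map_source hb)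
  have h3 := h2.tendsto.comp h1
  rwa [M.e.left_inv hb] at h3

theorem eventually_line {b : X} (hb : b ∈ M.e.source) (v : EuclideanSpace ℝ (Fin l)) :
    ∀ᶠ t : ℝ in 𝓝 0, M.e b + t • v ∈ M.e.target := by
  have : Continuous fun t : ℝ => M.e b + t • v := by fun_prop
  refine this.continuousAt.eventually (M.e.open_target.mem_nhds ?_)
  simpa using M.e.map_source hb

theorem isPreconnected_preimage {K : Set (EuclideanSpace ℝ (Fin l))} (hK : Convex ℝ K) :
    IsPreconnected {y | y ∈ M.e.source ∧ M.e y ∈ K} := by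
  have h1 : IsPreconnected (K ∩ M.e.target) := (hK.inter M.convex).isPreconnected
  have h2 := h1.image M.e.symm (M.e.continuousOn_symm.mono Set.inter_subset_right)
  convert h2 using 1
  ext y
  constructor
  · rintro ⟨hy, hyK⟩
    exact ⟨M.e y, ⟨hyK, M.e.map_source hy⟩, M.e.left_inv hy⟩
  · rintro ⟨v, ⟨hv, hvt⟩, rfl⟩
    exact ⟨M.e.map_target hvt, by rwa [M.e.right_inv hvt]⟩

theorem isPreconnected_source : IsPreconnected M.e.source := by
  simpa using M.isPreconnected_preimage (convex_univ (𝕜 := ℝ))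

theorem exists_ne {f : EuclideanSpace ℝ (Fin l) →ₗ[ℝ] ℝ} (hf : f ≠ 0) {O : Set X}
    (hO : IsOpen O) {b : X} (hb : b ∈ M.e.source) (hbO : b ∈ O) :
    ∃ b' ∈ O, b' ∈ M.e.source ∧ f (M.e b') ≠ 0 := by
  by_cases h0 : f (M.e b) = 0
  · obtain ⟨v, hv⟩ : ∃ v, f v ≠ 0 := by
      by_contra! hc
      exact hf (LinearMap.ext hc)
    have h1 := (M.tendsto_line hb v).eventually (hO.mem_nhds hbO)
    have h2 := M.eventually_line hb v
    obtain ⟨t, ⟨h3, h4⟩, ht⟩ :=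
      (((h1.and h2).filter_mono nhdsWithin_le_nhds).and self_mem_nhdsWithin).exists
        (f := 𝓝[≠] (0 : ℝ))
    refine ⟨_, h3, M.e.map_target h4, ?_⟩
    rw [M.e.right_inv h4, map_add, h0, zero_add, map_smul, smul_eq_mul]
    exact mul_ne_zero ht hv
  · exact ⟨b, hbO, hb, h0⟩

theorem ρ_eq_id_of_open {g : W} (hg : g • x = x) {O : Set X} (hO : IsOpen O) {b : X}
    (hb : b ∈ M.e.source) (hbO : b ∈ O) (h : ∀ y ∈ O, g • y = y) : M.ρ g = LinearMap.id := by
  have hρ : ∀ y ∈ M.e.source, y ∈ O → M.ρ g (M.e y) = M.e y := fun y hy hyO => by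
    rw [← M.e_smul g hg y hy, h y hyO]
  ext1 v
  have h1 := (M.tendsto_line hb v).eventually (hO.mem_nhds hbO)
  have h2 := M.eventually_line hb v
  obtain ⟨t, ⟨h3, h4⟩, ht⟩ :=
    (((h1.and h2).filter_mono nhdsWithin_le_nhds).and self_mem_nhdsWithin).exists
      (f := 𝓝[≠] (0 : ℝ))
  have h5 := hρ _ (M.e.map_target h4) h3
  rw [M.e.right_inv h4, map_add, hρ b hb hbO, map_smul] at h5
  exact smul_right_injective _ ht (add_left_cancel h5)

variable [IsManifold (𝓡 l) ∞ X] [ProperlyDiscontinuousSMul W X] [ConnectedSpace X]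

/-- An element acting trivially near a point is trivial. -/
theorem eq_one (hA : IsCoxeterTransformationGroup l W X) {g : W} (hg : g • x = x)
    (h : M.ρ g = LinearMap.id) : g = 1 := by
  have := hA.faithful
  have : ContinuousConstSMul W X := ⟨fun w => (hA.smooth w).continuous⟩
  -- The set where `g` is locally the identity is closed as well as open: at a limit point `g` acts
  -- linearly and fixes a nonempty open set, so its linear part is the identity. Connectedness and
  -- faithfulness finish.
  set Z : Set X := {y | ∀ᶠ z in 𝓝 y, g • z = z} with hZ
  have hZo : IsOpen Z := isOpen_setOfPred_eventually_nhds
  have key : ∀ (y : X) (M : LinModel l W y), M.ρ g = LinearMap.id → g • y = y → y ∈ Z := by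
    intro y M hM hy
    filter_upwards [M.e.open_source.mem_nhds M.mem_source] with z hz
    refine M.e.injOn (M.smul_mem g hy z hz) hz ?_
    rw [M.e_smul g hy z hz, hM]
    rfl
  have hZc : IsClosed Z := by
    refine isClosed_of_closure_subset fun y hy => ?_
    have hyg : g • y = y := by
      have : Z ⊆ wall X g := fun z hz => hz.self_of_nhds
      exact (isClosed_wall g).closure_subset_iff.2 this hy
    obtain ⟨M⟩ := exists_linModel hA.smooth y
    obtain ⟨b, hb, hbZ⟩ := mem_closure_iff.1 hy _ M.e.open_source M.mem_source
    exact key y M (M.ρ_eq_id_of_open hyg hZo hb hbZ fun z hz => hz.self_of_nhds) hyg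
  have huniv : Z = Set.univ := IsClopen.eq_univ ⟨hZc, hZo⟩ ⟨x, key x M h hg⟩
  refine FaithfulSMul.eq_of_smul_eq_smul (α := X) fun y => ?_
  rw [one_smul]
  have : y ∈ Z := huniv ▸ Set.mem_univ y
  exact this.self_of_nhds

/-- A nontrivial involution fixing `x` reverses some nonzero functional. -/
theorem exists_anti (hA : IsCoxeterTransformationGroup l W X) {r : W}
    (hr : r ∈ reflections W X) (hx : r • x = x) :
    ∃ f : EuclideanSpace ℝ (Fin l) →ₗ[ℝ] ℝ, f ≠ 0 ∧ ∀ v, f (M.ρ r v) = -f v := by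
  have hne : M.ρ r ≠ LinearMap.id := by
    intro hc
    have h1 : r = 1 := M.eq_one hA hx hc
    refine hr.2 ?_
    have : (wall X r)ᶜ = ∅ := by
      ext y
      simp [wall, h1]
    rw [this]
    exact isPreconnected_empty
  obtain ⟨u, hu⟩ : ∃ u, M.ρ r u ≠ u := by
    by_contra! hc
    exact hne (LinearMap.ext hc)
  have hρρ : ∀ v, M.ρ r (M.ρ r v) = v := by
    intro v
    have := M.ρ_mul r r hx hx
    rw [hr.1, M.ρ_one] at this
    exact (LinearMap.congr_fun this v).symm
  -- `id - ρ r` changes sign under precomposition with the involution `ρ r`; pairing with `u - ρ r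
  -- u` makes the value at `u` a nonzero squared norm.
  refine ⟨(innerₗ _ (u - M.ρ r u)) ∘ₗ (LinearMap.id - M.ρ r), ?_, ?_⟩
  · intro hc
    have := LinearMap.congr_fun hc u
    simp only [LinearMap.comp_apply, innerₗ_apply_apply, LinearMap.sub_apply, LinearMap.id_apply,
      LinearMap.zero_apply, inner_self_eq_zero, sub_eq_zero] at this
    exact hu this.symm
  · intro v
    simp only [LinearMap.comp_apply, LinearMap.sub_apply, LinearMap.id_apply, hρρ]
    rw [← map_neg, neg_sub]

end LinModel

variable [IsManifold (𝓡 l) ∞ X] [ProperlyDiscontinuousSMul W X] [ConnectedSpace X]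

theorem IsCoxeterTransformationGroup.continuousConstSMul
    (hA : IsCoxeterTransformationGroup l W X) : ContinuousConstSMul W X :=
  ⟨fun w => (hA.smooth w).continuous⟩

/-- The complement of a wall has at most two components, exchanged by the reflection. -/
theorem sameSide_or (hA : IsCoxeterTransformationGroup l W X) {r : W}
    (hr : r ∈ reflections W X) {y z : X} (hy : y ∉ wall X r) (hz : z ∉ wall X r) :
    SameSide r y z ∨ SameSide r y (r • z) := by
  have := hA.continuousConstSMul
  have : LocallyConnectedSpace X :=
    ChartedSpace.locallyConnectedSpace (EuclideanSpace ℝ (Fin l)) X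
  have hopen : ∀ y, IsOpen (connectedComponentIn (wall X r)ᶜ y) := fun y =>
    (isClosed_wall r).isOpen_compl.connectedComponentIn
  set B : Set X := {z | SameSide r y z ∨ SameSide r y (r • z)} with hB
  have hBr : ∀ z ∈ B, r • z ∈ B := by
    rintro z (h | h)
    · exact Or.inr (by rwa [smul_smul_self hr])
    · exact Or.inl h
  have hBside : ∀ a ∈ B, ∀ b, SameSide r a b → b ∈ B := by
    rintro a (h | h) b hab
    · exact Or.inl (h.trans hab)
    · exact Or.inr (h.trans hab.smul_self)
  have hBc : ∀ a, a ∉ wall X r → a ∈ closure B → a ∈ B := by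
    intro a ha hac
    obtain ⟨b, hb, hbB⟩ := mem_closure_iff.1 hac _ (hopen a) (SameSide.refl ha)
    exact hBside b hbB a (SameSide.symm hb)
  -- Near a wall point only a reversed functional `f` is available, and the wall might a priori be
  -- smaller than `ker f`. The half-charts `f > 0` and `f < 0` avoid the wall, are connected and are
  -- swapped by `r`; as `B` is `r`-stable and meets one of them, it contains both, and they are
  -- dense in the chart.
  have hco : IsOpen (closure B) := by
    rw [isOpen_iff_mem_nhds]
    intro a ha
    by_cases haw : a ∈ wall X r
    · obtain ⟨M⟩ := exists_linModel hA.smooth a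
      obtain ⟨f, hf, hfr⟩ := M.exists_anti hA hr haw
      have hwall : ∀ c ∈ M.e.source, f (M.e c) ≠ 0 → c ∉ wall X r := by
        intro c hc hfc hcw
        have := hfr (M.e c)
        rw [← M.e_smul r haw c hc, mem_wall.1 hcw] at this
        exact hfc (by linarith)
      obtain ⟨b, hb, hbB⟩ := mem_closure_iff.1 ha _ M.e.open_source M.mem_source
      have hbw : b ∉ wall X r := by
        rcases hbB with h | h
        · exact h.notMem_right
        · exact fun hc => h.notMem_right (by rwa [mem_wall.1 hc])
      obtain ⟨b', hb', hbs', hfb'⟩ := M.exists_ne hf (hopen b) hb (SameSide.refl hbw)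
      have hb'B : b' ∈ B := hBside b hbB b' hb'
      have hpos : ∀ c ∈ M.e.source, 0 < f (M.e c) → c ∈ B := by
        obtain ⟨d, hd, hdB, hfd⟩ : ∃ d ∈ M.e.source, d ∈ B ∧ 0 < f (M.e d) := by
          rcases hfb'.lt_or_gt with h | h
          · refine ⟨r • b', M.smul_mem r haw _ hbs', hBr _ hb'B, ?_⟩
            rw [M.e_smul r haw _ hbs', hfr]
            linarith
          · exact ⟨b', hbs', hb'B, h⟩
        intro c hc hfc
        refine hBside d hdB c (SameSide.of_isPreconnected
          (M.isPreconnected_preimage (convex_halfSpace_gt f.isLinear 0)) ?_ ⟨hd, hfd⟩ ⟨hc, hfc⟩)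
        rintro a ⟨h1, h2⟩
        exact hwall a h1 (ne_of_gt h2)
      have hne : ∀ c ∈ M.e.source, f (M.e c) ≠ 0 → c ∈ B := by
        intro c hc hfc
        rcases hfc.lt_or_gt with h | h
        · rw [← smul_smul_self hr c]
          refine hBr _ (hpos _ (M.smul_mem r haw _ hc) ?_)
          rw [M.e_smul r haw _ hc, hfr]
          linarith
        · exact hpos c hc h
      filter_upwards [M.e.open_source.mem_nhds M.mem_source] with c hc
      rw [mem_closure_iff]
      intro O hO hcO
      obtain ⟨d, hdO, hds, hfd⟩ := M.exists_ne hf hO hc hcO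
      exact ⟨d, hdO, hne d hds hfd⟩
    · filter_upwards [(hopen a).mem_nhds (SameSide.refl haw)] with b hb
      exact subset_closure (hBside a (hBc a haw ha) b hb)
  have huniv : closure B = Set.univ :=
    IsClopen.eq_univ ⟨isClosed_closure, hco⟩ ⟨y, subset_closure (Or.inl (SameSide.refl hy))⟩
  exact hBc z hz (huniv ▸ Set.mem_univ z)

/-- Otherwise the two candidate components of `sameSide_or` coincide and the complement of the wall
is connected, against the definition of a reflection. -/
theorem not_sameSide_smul (hA : IsCoxeterTransformationGroup l W X) {r : W}
    (hr : r ∈ reflections W X) (y : X) : ¬ SameSide r y (r • y) := by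
  have := hA.continuousConstSMul
  intro h
  refine hr.2 (isPreconnected_of_forall y fun z hz => ?_)
  refine ⟨_, connectedComponentIn_subset _ y, SameSide.refl h.notMem_left, ?_,
    isPreconnected_connectedComponentIn⟩
  rcases sameSide_or hA hr h.notMem_left hz with h1 | h1
  · exact h1
  · have h2 := h1.smul_self
    rw [smul_smul_self hr] at h2
    exact SameSide.trans h h2

theorem sameSide_of_not (hA : IsCoxeterTransformationGroup l W X) {r : W}
    (hr : r ∈ reflections W X) {y z t : X} (hy : y ∉ wall X r) (hz : z ∉ wall X r)
    (ht : t ∉ wall X r) (h1 : ¬ SameSide r y z) (h2 : ¬ SameSide r z t) : SameSide r y t := by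
  have := hA.continuousConstSMul
  have h3 := (sameSide_or hA hr hy hz).resolve_left h1
  have h4 := ((sameSide_or hA hr hz ht).resolve_left h2).smul_self
  rw [smul_smul_self hr] at h4
  exact h3.trans h4

/-- In a linearised chart a reflection is a linear reflection, and its functional tells the two
sides of the wall apart. -/
theorem LinModel.exists_root (hA : IsCoxeterTransformationGroup l W X) {x : X}
    (M : LinModel l W x) {r : W} (hr : r ∈ reflections W X) (hx : r • x = x) :
    ∃ (f : EuclideanSpace ℝ (Fin l) →ₗ[ℝ] ℝ) (a : EuclideanSpace ℝ (Fin l)), f a = 2 ∧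
      (∀ v, M.ρ r v = v - f v • a) ∧
      (∀ y ∈ M.e.source, y ∈ wall X r ↔ f (M.e y) = 0) ∧
      ∀ y ∈ M.e.source, ∀ z ∈ M.e.source, SameSide r y z ↔ 0 < f (M.e y) * f (M.e z) := by
  have := hA.continuousConstSMul
  have : LocallyConnectedSpace X :=
    ChartedSpace.locallyConnectedSpace (EuclideanSpace ℝ (Fin l)) X
  have hopen : ∀ y, IsOpen (connectedComponentIn (wall X r)ᶜ y) := fun y =>
    (isClosed_wall r).isOpen_compl.connectedComponentIn
  obtain ⟨f, hf, hfr⟩ := M.exists_anti hA hr hx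
  have hwall : ∀ c ∈ M.e.source, f (M.e c) ≠ 0 → c ∉ wall X r := by
    intro c hc hfc hcw
    have := hfr (M.e c)
    rw [← M.e_smul r hx c hc, mem_wall.1 hcw] at this
    exact hfc (by linarith)
  have hpos : ∀ y ∈ M.e.source, ∀ z ∈ M.e.source, 0 < f (M.e y) → 0 < f (M.e z) →
      SameSide r y z := by
    intro y hy z hz h1 h2
    refine SameSide.of_isPreconnected
      (M.isPreconnected_preimage (convex_halfSpace_gt f.isLinear 0)) ?_ ⟨hy, h1⟩ ⟨hz, h2⟩
    rintro a ⟨h1, h2⟩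
    exact hwall a h1 (ne_of_gt h2)
  have hneg : ∀ y ∈ M.e.source, ∀ z ∈ M.e.source, f (M.e y) < 0 → f (M.e z) < 0 →
      SameSide r y z := by
    intro y hy z hz h1 h2
    refine SameSide.of_isPreconnected
      (M.isPreconnected_preimage (convex_halfSpace_lt f.isLinear 0)) ?_ ⟨hy, h1⟩ ⟨hz, h2⟩
    rintro a ⟨h1, h2⟩
    exact hwall a h1 (ne_of_lt h2)
  have hopp : ∀ y ∈ M.e.source, ∀ z ∈ M.e.source, 0 < f (M.e y) → f (M.e z) < 0 →
      ¬ SameSide r y z := by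
    intro y hy z hz h1 h2 h3
    have h4 := hpos y hy (r • z) (M.smul_mem r hx z hz) h1 (by
      rw [M.e_smul r hx z hz, hfr]; linarith)
    exact not_sameSide_smul hA hr z (h3.symm.trans h4)
  obtain ⟨p, hp⟩ : ∃ p, 0 < f p := by
    obtain ⟨v, hv⟩ : ∃ v, f v ≠ 0 := by
      by_contra! hc
      exact hf (LinearMap.ext hc)
    rcases hv.lt_or_gt with h | h
    · exact ⟨-v, by rw [map_neg]; linarith⟩
    · exact ⟨v, h⟩
  -- Here separation forces the wall to be a full hyperplane: the side of a point of `ker f` off the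
  -- wall would be open, hence would meet both `f > 0` and `f < 0`, which lie on different sides.
  have hzero : ∀ y ∈ M.e.source, f (M.e y) = 0 → y ∈ wall X r := by
    intro y hy hfy
    by_contra hyw
    have hd : ∀ v, ∀ᶠ t in 𝓝[>] (0 : ℝ), 0 < t ∧ M.e y + t • v ∈ M.e.target ∧
        SameSide r y (M.e.symm (M.e y + t • v)) := by
      intro v
      have h1 := (M.tendsto_line hy v).eventually ((hopen y).mem_nhds (SameSide.refl hyw))
      have h2 := M.eventually_line hy v
      filter_upwards [self_mem_nhdsWithin, h1.filter_mono nhdsWithin_le_nhds,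
        h2.filter_mono nhdsWithin_le_nhds] with t h3 h4 h5
      exact ⟨h3, h5, h4⟩
    obtain ⟨t, ⟨ht, h1, h2⟩, -, h3, h4⟩ := ((hd p).and (hd (-p))).exists
    refine hopp _ (M.e.map_target h1) _ (M.e.map_target h3) ?_ ?_ (h2.symm.trans h4)
    · rw [M.e.right_inv h1, map_add, hfy, map_smul, smul_eq_mul, zero_add]
      positivity
    · rw [M.e.right_inv h3, map_add, hfy, map_smul, map_neg, smul_eq_mul, zero_add]
      nlinarith
  have hfix : ∀ v, f v = 0 → M.ρ r v = v := by
    intro v hv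
    have h2 := M.eventually_line M.mem_source v
    obtain ⟨t, h3, ht⟩ := ((h2.filter_mono nhdsWithin_le_nhds).and self_mem_nhdsWithin).exists
        (f := 𝓝[≠] (0 : ℝ))
    rw [M.map_self, zero_add] at h3
    have hs := M.e.map_target h3
    have h4 := hzero _ hs (by rw [M.e.right_inv h3, map_smul, hv, smul_zero])
    have h5 := M.e_smul r hx _ hs
    rw [mem_wall.1 h4, M.e.right_inv h3, map_smul] at h5
    exact (smul_right_injective _ ht h5).symm
  -- As `f` changes sign under `ρ r`, it takes the value `2 * f p` on `p - ρ r p`; dividing by `f p`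
  -- normalises the coroot to value `2`.
  refine ⟨f, (f p)⁻¹ • (p - M.ρ r p), ?_, ?_, ?_, ?_⟩
  · rw [map_smul, map_sub, hfr, smul_eq_mul]
    field_simp
    norm_num
  · intro v
    have h1 := hfix (v - (f v * (f p)⁻¹) • p) (by
      rw [map_sub, map_smul, smul_eq_mul]; field_simp; ring)
    rw [map_sub, map_smul] at h1
    rw [smul_smul, smul_sub, ← sub_eq_zero]
    rw [← sub_eq_zero] at h1
    rw [← h1]
    abel
  · exact fun y hy => ⟨fun h => by_contra fun hc => hwall y hy hc h, hzero y hy⟩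
  · intro y hy z hz
    constructor
    · intro h
      have h1 : f (M.e y) ≠ 0 := fun hc => h.notMem_left (hzero y hy hc)
      have h2 : f (M.e z) ≠ 0 := fun hc => h.notMem_right (hzero z hz hc)
      rcases h1.lt_or_gt with h3 | h3 <;> rcases h2.lt_or_gt with h4 | h4
      · exact mul_pos_of_neg_of_neg h3 h4
      · exact absurd h.symm (hopp z hz y hy h4 h3)
      · exact absurd h (hopp y hy z hz h3 h4)
      · exact mul_pos h3 h4
    · intro h
      rcases mul_pos_iff.1 h with ⟨h1, h2⟩ | ⟨h1, h2⟩
      · exact hpos y hy z hz h1 h2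
      · exact hneg y hy z hz h1 h2

end Sides

/-! ### Roots, chambers and panels -/

section Chambers

open Topology

set_option linter.unusedSectionVars false

/-- A linearised chart around `x` together with the roots of the reflections fixing `x`. -/
structure LocalModel (l : ℕ) (W : Type*) [Group W] {X : Type*} [TopologicalSpace X]
    [ChartedSpace (EuclideanSpace ℝ (Fin l)) X] [MulAction W X] (x : X)
    extends LinModel l W x where
  /-- the functional vanishing on the wall of a reflection -/
  root : W → EuclideanSpace ℝ (Fin l) →ₗ[ℝ] ℝ
  /-- the vector reversed by a reflection -/
  coroot : W → EuclideanSpace ℝ (Fin l)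
  root_coroot : ∀ r ∈ reflections W X, r • x = x → root r (coroot r) = 2
  ρ_apply : ∀ r ∈ reflections W X, r • x = x → ∀ v, ρ r v = v - root r v • coroot r
  mem_wall_iff : ∀ r ∈ reflections W X, r • x = x → ∀ y ∈ e.source,
    y ∈ wall X r ↔ root r (e y) = 0
  sameSide_iff : ∀ r ∈ reflections W X, r • x = x → ∀ y ∈ e.source, ∀ z ∈ e.source,
    SameSide r y z ↔ 0 < root r (e y) * root r (e z)

variable {l : ℕ} {W : Type*} [Group W] {X : Type*} [TopologicalSpace X] [T2Space X]
  [ChartedSpace (EuclideanSpace ℝ (Fin l)) X] [MulAction W X]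
  [IsManifold (𝓡 l) ∞ X] [ProperlyDiscontinuousSMul W X] [ConnectedSpace X]

theorem exists_localModel (hA : IsCoxeterTransformationGroup l W X) (x : X) :
    Nonempty (LocalModel l W x) := by
  obtain ⟨M⟩ := exists_linModel hA.smooth x
  have key : ∀ r : W, ∃ (f : EuclideanSpace ℝ (Fin l) →ₗ[ℝ] ℝ) (a : EuclideanSpace ℝ (Fin l)),
      r ∈ reflections W X → r • x = x → f a = 2 ∧
      (∀ v, M.ρ r v = v - f v • a) ∧
      (∀ y ∈ M.e.source, y ∈ wall X r ↔ f (M.e y) = 0) ∧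
      ∀ y ∈ M.e.source, ∀ z ∈ M.e.source, SameSide r y z ↔ 0 < f (M.e y) * f (M.e z) := by
    intro r
    by_cases h : r ∈ reflections W X ∧ r • x = x
    · obtain ⟨f, a, h1⟩ := M.exists_root hA h.1 h.2
      exact ⟨f, a, fun _ _ => h1⟩
    · exact ⟨0, 0, fun h1 h2 => absurd ⟨h1, h2⟩ h⟩
  choose f a h using key
  exact ⟨{ M with
    root := f
    coroot := a
    root_coroot := fun r hr hx => (h r hr hx).1
    ρ_apply := fun r hr hx => (h r hr hx).2.1
    mem_wall_iff := fun r hr hx => (h r hr hx).2.2.1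
    sameSide_iff := fun r hr hx => (h r hr hx).2.2.2 }⟩

variable (W X) in
/-- The complement of the union of all walls. -/
def regularSet : Set X := (⋃ r ∈ reflections W X, wall X r)ᶜ

theorem mem_regularSet {y : X} : y ∈ regularSet W X ↔ ∀ r ∈ reflections W X, y ∉ wall X r := by
  simp [regularSet]

theorem smul_mem_regularSet [ContinuousConstSMul W X] {y : X} (hy : y ∈ regularSet W X) (g : W) :
    g • y ∈ regularSet W X := by
  rw [mem_regularSet] at hy ⊢
  intro r hr hc
  refine hy _ (conj_mem_reflections hr g⁻¹) ?_
  rw [← smul_mem_wall_conj g]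
  convert hc using 2
  group

namespace LocalModel

variable {x : X} (M : LocalModel l W x)

/-- An invariant inner product. -/
noncomputable def form : EuclideanSpace ℝ (Fin l) →ₗ[ℝ] EuclideanSpace ℝ (Fin l) →ₗ[ℝ] ℝ :=
  ∑ g ∈ (finite_stabilizer (W := W) x).toFinset,
    (innerₗ (EuclideanSpace ℝ (Fin l))).compl₁₂ (M.ρ g) (M.ρ g)

theorem form_apply (v w : EuclideanSpace ℝ (Fin l)) : M.form v w =
    ∑ g ∈ (finite_stabilizer (W := W) x).toFinset, inner ℝ (M.ρ g v) (M.ρ g w) := by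
  simp [form, LinearMap.sum_apply]

theorem form_ρ {g : W} (hg : g • x = x) (v w : EuclideanSpace ℝ (Fin l)) :
    M.form (M.ρ g v) (M.ρ g w) = M.form v w := by
  rw [form_apply, form_apply]
  refine Finset.sum_equiv (Equiv.mulRight g) (fun h => ?_) (fun h hh => ?_)
  · simp [mul_smul, hg]
  · have hh' : h • x = x := by simpa using hh
    rw [Equiv.coe_mulRight, M.ρ_mul h g hh' hg]
    rfl

theorem form_self_pos {v : EuclideanSpace ℝ (Fin l)} (hv : v ≠ 0) : 0 < M.form v v := by
  rw [form_apply]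
  refine Finset.sum_pos' (fun g _ => real_inner_self_nonneg) ⟨1, by simp, ?_⟩
  rw [M.ρ_one]
  exact real_inner_self_pos.2 hv

/-- The reflection sends its coroot to its negative; invariance of the form then expresses the root
through the form. -/
theorem form_coroot {r : W} (hr : r ∈ reflections W X) (hx : r • x = x)
    (v : EuclideanSpace ℝ (Fin l)) :
    2 * M.form v (M.coroot r) = M.root r v * M.form (M.coroot r) (M.coroot r) := by
  have h := M.form_ρ hx v (M.coroot r)
  rw [M.ρ_apply r hr hx, M.ρ_apply r hr hx, M.root_coroot r hr hx] at h
  simp only [map_sub, map_smul, LinearMap.sub_apply, LinearMap.smul_apply, smul_eq_mul] at h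
  linarith

theorem coroot_ne_zero {r : W} (hr : r ∈ reflections W X) (hx : r • x = x) : M.coroot r ≠ 0 := by
  intro h
  have := M.root_coroot r hr hx
  rw [h, map_zero] at this
  norm_num at this

theorem root_ne_zero {r : W} (hr : r ∈ reflections W X) (hx : r • x = x) : M.root r ≠ 0 := by
  intro h
  have := M.root_coroot r hr hx
  rw [h, LinearMap.zero_apply] at this
  norm_num at this

/-- Reflections through the same hyperplane are equal. -/
theorem eq_of_ker_le (hA : IsCoxeterTransformationGroup l W X) {r r' : W}
    (hr : r ∈ reflections W X) (hx : r • x = x) (hr' : r' ∈ reflections W X) (hx' : r' • x = x)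
    (h : ∀ v, M.root r v = 0 → M.root r' v = 0) : r = r' := by
  set c : ℝ := M.root r' (M.coroot r) / 2 with hc
  have hroot : ∀ v, M.root r' v = c * M.root r v := by
    intro v
    have h1 := h (v - (M.root r v / 2) • M.coroot r) (by
      rw [map_sub, map_smul, M.root_coroot r hr hx, smul_eq_mul]; ring)
    rw [map_sub, map_smul, smul_eq_mul] at h1
    rw [hc]
    linarith
  -- Proportional roots have proportional coroots by `form_coroot`, and the normalisation `2` makes
  -- the two factors inverse to each other. The linear reflections agree, so `r * r'` acts trivially
  -- near `x`.
  set k : ℝ := c * M.form (M.coroot r') (M.coroot r') / M.form (M.coroot r) (M.coroot r) with hk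
  have hpos := M.form_self_pos (M.coroot_ne_zero hr hx)
  have hcoroot : M.coroot r' = k • M.coroot r := by
    have h0 : ∀ v, M.form v (M.coroot r' - k • M.coroot r) = 0 := by
      intro v
      have h1 := M.form_coroot hr hx v
      have h2 := M.form_coroot hr' hx' v
      rw [hroot] at h2
      have h3 : k * M.form (M.coroot r) (M.coroot r) = c * M.form (M.coroot r') (M.coroot r') :=
        div_mul_cancel₀ _ hpos.ne'
      rw [map_sub, map_smul, smul_eq_mul]
      have h4 : 2 * (k * M.form v (M.coroot r)) =
          M.root r v * (k * M.form (M.coroot r) (M.coroot r)) := by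
        rw [mul_left_comm, h1]; ring
      rw [h3] at h4
      linarith
    by_contra hne
    exact (M.form_self_pos (sub_ne_zero.2 hne)).ne' (h0 _)
  have hck : c * k = 1 := by
    have h1 := M.root_coroot r' hr' hx'
    rw [hroot, hcoroot, map_smul, M.root_coroot r hr hx, smul_eq_mul] at h1
    linarith
  have hρ : M.ρ (r * r') = LinearMap.id := by
    ext1 v
    rw [M.ρ_mul r r' hx hx']
    have h1 : M.ρ r' v = M.ρ r v := by
      rw [M.ρ_apply r hr hx, M.ρ_apply r' hr' hx', hroot, hcoroot, smul_smul, mul_right_comm, hck,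
        one_mul]
    have h2 : M.ρ r (M.ρ r v) = v := by
      have := M.ρ_mul r r hx hx
      rw [hr.1, M.ρ_one] at this
      exact (LinearMap.congr_fun this v).symm
    rw [LinearMap.comp_apply, h1, h2]
    rfl
  have h1 := M.eq_one hA (by rw [mul_smul, hx', hx]) hρ
  rw [← inv_reflection hr']
  exact eq_inv_of_mul_eq_one_left h1

theorem smul_eq_of_mem_wall {y : X} (hy : y ∈ M.e.source) {r : W} (h : y ∈ wall X r) :
    r • x = x := M.eq_of_mem r y hy (by rwa [mem_wall.1 h])

theorem mem_regularSet_iff {y : X} (hy : y ∈ M.e.source) : y ∈ regularSet W X ↔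
    ∀ r ∈ reflections W X, r • x = x → M.root r (M.e y) ≠ 0 := by
  rw [mem_regularSet]
  refine forall₂_congr fun r hr => ⟨fun h hx hc => h ((M.mem_wall_iff r hr hx y hy).2 hc),
    fun h hc => ?_⟩
  have hx := M.smul_eq_of_mem_wall hy hc
  exact h hx ((M.mem_wall_iff r hr hx y hy).1 hc)

theorem eventually_smul_mem (v : EuclideanSpace ℝ (Fin l)) :
    ∀ᶠ t : ℝ in 𝓝[>] 0, 0 < t ∧ t • v ∈ M.e.target := by
  have h2 := M.eventually_line M.mem_source v
  rw [M.map_self] at h2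
  simp only [zero_add] at h2
  filter_upwards [self_mem_nhdsWithin, h2.filter_mono nhdsWithin_le_nhds] with t h1 h2
  exact ⟨h1, h2⟩

theorem tendsto_smul (v : EuclideanSpace ℝ (Fin l)) :
    Filter.Tendsto (fun t : ℝ => M.e.symm (t • v)) (𝓝[>] 0) (𝓝 x) := by
  have h2 := M.tendsto_line M.mem_source v
  rw [M.map_self] at h2
  simp only [zero_add] at h2
  exact h2.mono_left nhdsWithin_le_nhds

/-- Near `x` there are points of the wall of `r` (of any point, if `P` is all of space) which lie
on no other wall. -/
theorem exists_generic (P : Submodule ℝ (EuclideanSpace ℝ (Fin l))) {A : Set W}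
    (hA : ∀ r ∈ A, r • x = x) (h : ∀ r ∈ A, ∃ v ∈ P, M.root r v ≠ 0) {O : Set X} (hO : O ∈ 𝓝 x) :
    ∃ y ∈ O, y ∈ M.e.source ∧ M.e y ∈ P ∧ ∀ r ∈ A, M.root r (M.e y) ≠ 0 := by
  have hfin : A.Finite := (finite_stabilizer (W := W) x).subset hA
  have : Finite A := hfin
  obtain ⟨v, hvP, hv⟩ := Module.Dual.exists_forall_mem_ne_zero_of_forall_exists P
    (fun r : A => M.root r) (fun r => h r r.2)
  obtain ⟨t, ⟨ht, h1⟩, h2⟩ :=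
    ((M.eventually_smul_mem v).and ((M.tendsto_smul v).eventually hO)).exists
  refine ⟨_, h2, M.e.map_target h1, ?_, fun r hr => ?_⟩
  · rw [M.e.right_inv h1]
    exact P.smul_mem _ hvP
  · rw [M.e.right_inv h1, map_smul, smul_eq_mul]
    exact mul_ne_zero ht.ne' (hv ⟨r, hr⟩)

end LocalModel

theorem dense_regularSet (hA : IsCoxeterTransformationGroup l W X) :
    Dense (regularSet W X) := by
  intro x
  obtain ⟨M⟩ := exists_localModel hA x
  rw [mem_closure_iff_nhds]
  intro O hO
  obtain ⟨y, hyO, hy, -, h⟩ := M.exists_generic ⊤ (A := {r | r ∈ reflections W X ∧ r • x = x})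
    (fun r hr => hr.2) (fun r hr => ⟨M.coroot r, trivial, by
      rw [M.root_coroot r hr.1 hr.2]; norm_num⟩) hO
  exact ⟨y, hyO, (M.mem_regularSet_iff hy).2 fun r hr hx => h r ⟨hr, hx⟩⟩

/-- A wall meeting the linearised chart around a regular point would pass through that point. -/
theorem isOpen_regularSet (hA : IsCoxeterTransformationGroup l W X) :
    IsOpen (regularSet W X) := by
  rw [isOpen_iff_mem_nhds]
  intro x hx
  obtain ⟨M⟩ := exists_localModel hA x
  filter_upwards [M.e.open_source.mem_nhds M.mem_source] with y hy
  exact (M.mem_regularSet_iff hy).2 fun r hr hrx => absurd hrx (mem_regularSet.1 hx r hr)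

section ChamberBasics

variable {C : Set X}

theorem chamber_subset (hC : C ∈ chambers W X) : C ⊆ regularSet W X := by
  obtain ⟨x, -, rfl⟩ := hC
  exact connectedComponentIn_subset _ _

theorem chamber_isPreconnected (hC : C ∈ chambers W X) : IsPreconnected C := by
  obtain ⟨x, -, rfl⟩ := hC
  exact isPreconnected_connectedComponentIn

theorem chamber_nonempty (hC : C ∈ chambers W X) : C.Nonempty := by
  obtain ⟨x, hx, rfl⟩ := hC
  exact ⟨x, mem_connectedComponentIn hx⟩

theorem chamber_eq (hC : C ∈ chambers W X) {p : X} (hp : p ∈ C) :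
    C = connectedComponentIn (regularSet W X) p := by
  obtain ⟨x, -, rfl⟩ := hC
  exact connectedComponentIn_eq hp

theorem chamber_mem {p : X} (hp : p ∈ regularSet W X) :
    connectedComponentIn (regularSet W X) p ∈ chambers W X := ⟨p, hp, rfl⟩

theorem subset_chamber (hC : C ∈ chambers W X) {A : Set X} (hA : IsPreconnected A)
    (hAr : A ⊆ regularSet W X) {p : X} (hp : p ∈ C) (hpA : p ∈ A) : A ⊆ C := by
  rw [chamber_eq hC hp]
  exact hA.subset_connectedComponentIn hpA hAr

theorem chamber_ext {D : Set X} (hC : C ∈ chambers W X) (hD : D ∈ chambers W X) {p : X}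
    (hp : p ∈ C) (hpD : p ∈ D) : C = D := by
  rw [chamber_eq hC hp, chamber_eq hD hpD]

theorem chamber_isOpen (hA : IsCoxeterTransformationGroup l W X) (hC : C ∈ chambers W X) :
    IsOpen C := by
  have : LocallyConnectedSpace X :=
    ChartedSpace.locallyConnectedSpace (EuclideanSpace ℝ (Fin l)) X
  obtain ⟨x, -, rfl⟩ := hC
  exact (isOpen_regularSet hA).connectedComponentIn

theorem chamber_sameSide (hC : C ∈ chambers W X) {r : W} (hr : r ∈ reflections W X) {p q : X}
    (hp : p ∈ C) (hq : q ∈ C) : SameSide r p q :=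
  SameSide.of_isPreconnected (chamber_isPreconnected hC)
    (fun _ ha => mem_regularSet.1 (chamber_subset hC ha) r hr) hp hq

theorem smul_chamber [ContinuousConstSMul W X] (hC : C ∈ chambers W X) (g : W) :
    g • C ∈ chambers W X := by
  have sub : ∀ (g : W) (C : Set X), C ∈ chambers W X → g • C ⊆ regularSet W X ∧
      IsPreconnected (g • C) := by
    intro g C hC
    refine ⟨?_, (chamber_isPreconnected hC).image _ (continuous_const_smul g).continuousOn⟩
    rintro _ ⟨y, hy, rfl⟩
    exact smul_mem_regularSet (chamber_subset hC hy) g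
  obtain ⟨p, hp⟩ := chamber_nonempty hC
  have hgp : g • p ∈ regularSet W X := smul_mem_regularSet (chamber_subset hC hp) g
  have hD := chamber_mem hgp
  have hmem := mem_connectedComponentIn hgp
  set D := connectedComponentIn (regularSet W X) (g • p) with hDdef
  have : g • C = D := by
    refine (subset_chamber hD (sub g C hC).2 (sub g C hC).1 hmem
      (Set.smul_mem_smul_set hp)).antisymm ?_
    rw [Set.subset_smul_set_iff]
    refine subset_chamber hC (sub g⁻¹ D hD).2 (sub g⁻¹ D hD).1 hp ?_
    rw [Set.mem_smul_set_iff_inv_smul_mem, inv_inv]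
    exact hmem
  rw [this]
  exact hD

/-- Inside a linearised chart, a chamber is determined by the signs of the roots. -/
theorem LocalModel.mem_chamber_iff {x : X} (M : LocalModel l W x) (hC : C ∈ chambers W X)
    {p q : X} (hp : p ∈ C) (hps : p ∈ M.e.source) (hq : q ∈ M.e.source) :
    q ∈ C ↔ ∀ r ∈ reflections W X, r • x = x → 0 < M.root r (M.e p) * M.root r (M.e q) := by
  constructor
  · intro hqC r hr hx
    exact (M.sameSide_iff r hr hx p hps q hq).1 (chamber_sameSide hC hr hp hqC)
  · intro h
    have hconv : Convex ℝ {v | ∀ r ∈ reflections W X, r • x = x →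
        0 < M.root r (M.e p) * M.root r v} := by
      have : {v | ∀ r ∈ reflections W X, r • x = x → 0 < M.root r (M.e p) * M.root r v} =
          ⋂ r, ⋂ (_ : r ∈ reflections W X), ⋂ (_ : r • x = x),
            {v | 0 < (M.root r (M.e p) • M.root r) v} := by
        ext v; simp
      rw [this]
      exact convex_iInter fun r => convex_iInter fun _ => convex_iInter fun _ =>
        convex_halfSpace_gt (LinearMap.isLinear _) 0
    refine subset_chamber hC (M.isPreconnected_preimage hconv) ?_ hp ⟨hps, fun r hr hx => ?_⟩
      ⟨hq, h⟩
    · rintro y ⟨hy, hy'⟩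
      exact (M.mem_regularSet_iff hy).2 fun r hr hx hc => by
        have := hy' r hr hx
        rw [hc, mul_zero] at this
        exact lt_irrefl _ this
    · have := (M.mem_regularSet_iff hps).1 (chamber_subset hC hp) r hr hx
      exact mul_self_pos.2 this

/-- A point of a chart whose roots weakly agree with a chamber is in its closure. -/
theorem LocalModel.mem_closure_chamber {x : X} (M : LocalModel l W x) (hC : C ∈ chambers W X)
    {p y : X} (hp : p ∈ C) (hps : p ∈ M.e.source) (hy : y ∈ M.e.source)
    (h : ∀ᶠ t : ℝ in 𝓝[>] 0, ∀ r ∈ reflections W X, r • x = x →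
      0 < M.root r (M.e p) * M.root r (M.e y + t • (M.e p - M.e y))) : y ∈ closure C := by
  refine mem_closure_of_tendsto
    ((M.tendsto_line hy (M.e p - M.e y)).mono_left (nhdsWithin_le_nhds (s := Set.Ioi 0))) ?_
  filter_upwards [h, (M.eventually_line hy (M.e p - M.e y)).filter_mono nhdsWithin_le_nhds]
    with t h1 h2
  refine (M.mem_chamber_iff hC hp hps (M.e.map_target h2)).2 fun r hr hx => ?_
  rw [M.e.right_inv h2]
  exact h1 r hr hx

end ChamberBasics

end Chambers

/-! ### The action on chambers -/

section Transitivity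

open Topology

set_option linter.unusedSectionVars false

variable {l : ℕ} {W : Type*} [Group W] {X : Type*} [TopologicalSpace X] [T2Space X]
  [ChartedSpace (EuclideanSpace ℝ (Fin l)) X] [MulAction W X]
  [IsManifold (𝓡 l) ∞ X] [ProperlyDiscontinuousSMul W X] [ConnectedSpace X]

/-- The reflections whose wall contains a point of the closed chamber lying on no other wall. -/
def panelReflections (W : Type*) [Group W] {X : Type*} [TopologicalSpace X] [MulAction W X]
    (C : Set X) : Set W :=
  {s | s ∈ reflections W X ∧ ∃ y ∈ closure C, y ∈ wall X s ∧
    ∀ r ∈ reflections W X, y ∈ wall X r → r = s}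

variable {C : Set X}

theorem nonneg_of_segment {a b : ℝ} (h : ∀ t : ℝ, 0 < t → t < 1 → 0 < a + t * (b - a)) :
    0 ≤ a := by
  have h1 : Filter.Tendsto (fun t : ℝ => a + t * (b - a)) (𝓝[>] 0) (𝓝 a) := by
    have : Continuous fun t : ℝ => a + t * (b - a) := by fun_prop
    simpa using (this.tendsto 0).mono_left nhdsWithin_le_nhds
  refine ge_of_tendsto h1 ?_
  filter_upwards [Ioo_mem_nhdsGT (zero_lt_one (α := ℝ))] with t ht
  exact (h t ht.1 ht.2).le

/-- A point of a linearised chart outside the chamber `C` is not strictly on the side of `C` of some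
panel. -/
theorem LocalModel.exists_panel (hA : IsCoxeterTransformationGroup l W X) {x : X}
    (M : LocalModel l W x) (hC : C ∈ chambers W X) {p q : X} (hp : p ∈ C) (hps : p ∈ M.e.source)
    (hqs : q ∈ M.e.source) (hqC : q ∉ C) :
    ∃ s ∈ panelReflections W C, s • x = x ∧ M.root s (M.e p) * M.root s (M.e q) ≤ 0 := by
  classical
  set R : Finset W := (finite_stabilizer (W := W) x).toFinset.filter (· ∈ reflections W X) with hR
  have hmemR : ∀ r, r ∈ R ↔ r ∈ reflections W X ∧ r • x = x := fun r => by
    simp [hR, and_comm]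
  set F : W → EuclideanSpace ℝ (Fin l) →ₗ[ℝ] ℝ := fun r => M.root r (M.e p) • M.root r with hF
  have hFapp : ∀ r v, F r v = M.root r (M.e p) * M.root r v := fun r v => rfl
  have hpreg := (M.mem_regularSet_iff hps).1 (chamber_subset hC hp)
  have hFp : ∀ r ∈ R, 0 < F r (M.e p) := fun r hr => by
    have := hpreg r ((hmemR r).1 hr).1 ((hmemR r).1 hr).2
    exact mul_self_pos.2 this
  have hCiff : ∀ y ∈ M.e.source, y ∈ C ↔ ∀ r ∈ R, 0 < F r (M.e y) := by
    intro y hy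
    rw [M.mem_chamber_iff hC hp hps hy]
    exact ⟨fun h r hr => h r ((hmemR r).1 hr).1 ((hmemR r).1 hr).2,
      fun h r hr hx => h r ((hmemR r).2 ⟨hr, hx⟩)⟩
  -- `A` is an irredundant set of inequalities cutting out the chamber in the chart. The point `q`
  -- violates one of them, say that of `s`.
  obtain ⟨A, ⟨hAR, hcut⟩, hmin⟩ := WellFounded.has_min (r := ((· < ·) : Finset W → _ → _))
    wellFounded_lt {A | A ⊆ R ∧ ∀ v ∈ M.e.target, (∀ r ∈ A, 0 < F r v) → ∀ r ∈ R, 0 < F r v}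
    ⟨R, subset_rfl, fun v _ h => h⟩
  obtain ⟨s, hsA, hs⟩ : ∃ s ∈ A, ¬ 0 < F s (M.e q) := by
    by_contra! hc
    exact hqC ((hCiff q hqs).2 (hcut _ (M.e.map_source hqs) hc))
  obtain ⟨hsR, hsx⟩ := (hmemR s).1 (hAR hsA)
  refine ⟨s, ?_, hsx, not_lt.1 hs⟩
  obtain ⟨z, hz, hzA, hzR⟩ : ∃ z ∈ M.e.target, (∀ r ∈ A, r ≠ s → 0 < F r z) ∧
      ¬ ∀ r ∈ R, 0 < F r z := by
    by_contra! hc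
    refine hmin (A.erase s) ⟨(Finset.erase_subset _ _).trans hAR, fun v hv h => ?_⟩
      (Finset.erase_ssubset hsA)
    exact hc v hv fun r hr hrs => h r (Finset.mem_erase.2 ⟨hrs, hr⟩)
  have hFsz : F s z ≤ 0 := by
    by_contra! hc
    refine hzR (hcut z hz fun r hr => ?_)
    by_cases hrs : r = s
    · rwa [hrs]
    · exact hzA r hr hrs
  have hpt := M.e.map_source hps
  have hd : 0 < F s (M.e p) - F s z := by linarith [hFp s (hAR hsA)]
  -- By irredundancy some `z` violates only `s` among `A`. The segment from `p` to `z` meets the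
  -- hyperplane of `s` at parameter `t₀`, where all other inequalities of `A` remain strict.
  set t₀ : ℝ := F s (M.e p) / (F s (M.e p) - F s z) with ht₀
  have ht₀0 : 0 < t₀ := div_pos (hFp s (hAR hsA)) hd
  have ht₀1 : t₀ ≤ 1 := by rw [ht₀, div_le_one hd]; linarith
  set z₀ := M.e p + t₀ • (z - M.e p) with hz₀
  have hz₀t : z₀ ∈ M.e.target := M.convex.add_smul_sub_mem hpt hz ⟨ht₀0.le, ht₀1⟩
  have hFz₀ : ∀ r, F r z₀ = (1 - t₀) * F r (M.e p) + t₀ * F r z := by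
    intro r
    rw [hz₀, map_add, map_smul, map_sub, smul_eq_mul]
    ring
  have hFs : F s z₀ = 0 := by
    rw [hFz₀]
    have : t₀ * (F s (M.e p) - F s z) = F s (M.e p) := div_mul_cancel₀ _ hd.ne'
    linarith
  have hFr : ∀ r ∈ A, r ≠ s → 0 < F r z₀ := by
    intro r hr hrs
    rw [hFz₀]
    have h1 := hFp r (hAR hr)
    have h2 := mul_pos ht₀0 (hzA r hr hrs)
    have h3 := mul_nonneg (sub_nonneg.2 ht₀1) h1.le
    linarith
  have hpush : ∀ v ∈ M.e.target, (∀ r ∈ A, 0 ≤ F r v) → ∀ t : ℝ, 0 < t → t < 1 →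
      ∀ r ∈ R, 0 < F r (v + t • (M.e p - v)) := by
    intro v hv hvA t ht ht1
    refine hcut _ (M.convex.add_smul_sub_mem hv hpt ⟨ht.le, ht1.le⟩) fun r hr => ?_
    rw [map_add, map_smul, map_sub, smul_eq_mul]
    have h1 := mul_pos ht (hFp r (hAR hr))
    have h2 := mul_nonneg (sub_nonneg.2 ht1.le) (hvA r hr)
    linarith
  have hz₀A : ∀ r ∈ A, 0 ≤ F r z₀ := fun r hr => by
    by_cases hrs : r = s
    · rw [hrs, hFs]
    · exact (hFr r hr hrs).le
  have hy₀ := M.e.map_target hz₀t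
  refine ⟨hsR, M.e.symm z₀, ?_, ?_, ?_⟩
  · refine M.mem_closure_chamber hC hp hps hy₀ ?_
    rw [M.e.right_inv hz₀t]
    filter_upwards [Ioo_mem_nhdsGT (zero_lt_one (α := ℝ))] with t ht r hr hx
    exact hpush z₀ hz₀t hz₀A t ht.1 ht.2 r ((hmemR r).2 ⟨hr, hx⟩)
  · rw [M.mem_wall_iff s hsR hsx _ hy₀, M.e.right_inv hz₀t]
    rw [hFapp] at hFs
    exact (mul_eq_zero.1 hFs).resolve_left (hpreg s hsR hsx)
  · intro r' hr' hw
    have hx' := M.smul_eq_of_mem_wall hy₀ hw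
    have hroot : M.root r' z₀ = 0 := by
      rwa [M.mem_wall_iff r' hr' hx' _ hy₀, M.e.right_inv hz₀t] at hw
    refine (M.eq_of_ker_le hA hsR hsx hr' hx' ?_).symm
    -- Near `z₀` the hyperplane of `s` lies in the closed cone of the chamber, so a root vanishing
    -- at `z₀` is nonnegative in every direction of that hyperplane and in the opposite one; hence
    -- it vanishes on it and `r' = s`.
    have key : ∀ h, M.root s h = 0 → 0 ≤ F r' h := by
      intro h hh
      have h1 : ∀ᶠ t : ℝ in 𝓝 0, z₀ + t • h ∈ M.e.target ∧
          ∀ r ∈ A, r ≠ s → 0 < F r (z₀ + t • h) := by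
        have hcont : Continuous fun t : ℝ => z₀ + t • h := by fun_prop
        have h2 : ∀ r ∈ A, ∀ᶠ t : ℝ in 𝓝 0, r ≠ s → 0 < F r (z₀ + t • h) := by
          intro r hr
          by_cases hrs : r = s
          · simp [hrs]
          have hc2 : Continuous fun t : ℝ => F r (z₀ + t • h) :=
            (F r).continuous_of_finiteDimensional.comp hcont
          have := hc2.continuousAt (x := 0) |>.eventually (lt_mem_nhds (a := 0) (by
            simpa using hFr r hr hrs))
          filter_upwards [this] with t ht _ using ht
        refine (hcont.continuousAt.eventually (M.e.open_target.mem_nhds (by simpa))).and ?_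
        exact (Filter.eventually_all_finset A).2 h2
      obtain ⟨t, ⟨h2, h3⟩, ht⟩ :=
        ((h1.filter_mono nhdsWithin_le_nhds).and self_mem_nhdsWithin).exists (f := 𝓝[>] (0 : ℝ))
      have h4 : 0 ≤ F r' (z₀ + t • h) := by
        refine nonneg_of_segment (b := F r' (M.e p)) fun δ h5 h6 => ?_
        have := hpush _ h2 (fun r hr => ?_) δ h5 h6 r' ((hmemR r').2 ⟨hr', hx'⟩)
        · rwa [map_add, map_smul, map_sub, smul_eq_mul] at this
        · by_cases hrs : r = s
          · rw [hrs, map_add, hFs, map_smul, hFapp, hh]; simp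
          · exact (h3 r hr hrs).le
      rw [map_add, map_smul, hFapp, hroot, mul_zero, zero_add, smul_eq_mul] at h4
      exact nonneg_of_mul_nonneg_right h4 ht
    intro h hh
    have h1 := key h hh
    have h2 := key (-h) (by rw [map_neg, hh, neg_zero])
    rw [map_neg] at h2
    have h3 : F r' h = 0 := by linarith
    rw [hFapp] at h3
    exact (mul_eq_zero.1 h3).resolve_left (hpreg r' hr' hx')

theorem closure_le_stabilizer {T : Set W} {x : X} (hT : ∀ s ∈ T, s • x = x) :
    ∀ g ∈ Subgroup.closure T, g • x = x := by
  intro g hg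
  have : Subgroup.closure T ≤ MulAction.stabilizer W x := (Subgroup.closure_le _).2 hT
  exact this hg

/-- The panels through a point of the closed chamber generate a group moving any nearby point
into the chamber. -/
theorem LocalModel.exists_smul_mem (hA : IsCoxeterTransformationGroup l W X) {x : X}
    (M : LocalModel l W x) (hC : C ∈ chambers W X) (hx : x ∈ closure C) {q : X}
    (hqs : q ∈ M.e.source) (hq : q ∈ regularSet W X) :
    ∃ g ∈ Subgroup.closure {s | s ∈ panelReflections W C ∧ s • x = x}, g • q ∈ C := by
  have := hA.continuousConstSMul
  obtain ⟨p, hps, hp⟩ := mem_closure_iff.1 hx _ M.e.open_source M.mem_source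
  have hfix : ∀ g ∈ Subgroup.closure {s | s ∈ panelReflections W C ∧ s • x = x}, g • x = x :=
    closure_le_stabilizer fun s hs => hs.2
  obtain ⟨g, hg, hmax⟩ := Set.exists_max_image
    (Subgroup.closure {s | s ∈ panelReflections W C ∧ s • x = x} : Set W)
    (fun g => M.form (M.e p) (M.ρ g (M.e q)))
    ((finite_stabilizer (W := W) x).subset hfix) ⟨1, Subgroup.one_mem _⟩
  refine ⟨g, hg, ?_⟩
  by_contra hgq
  obtain ⟨s, hsP, hsx, hs⟩ := M.exists_panel hA hC hp hps
    (M.smul_mem g (hfix g hg) q hqs) hgq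
  -- If the panel `s` separates `p` from `g • q`, applying `s` increases the inner product with `p`,
  -- since `form_coroot` makes the correction term positive.
  have h1 := hmax (s * g) (mul_mem (Subgroup.subset_closure ⟨hsP, hsx⟩) hg)
  have hsR := hsP.1
  have hs := lt_of_le_of_ne hs (mul_ne_zero
    ((M.mem_regularSet_iff hps).1 (chamber_subset hC hp) s hsR hsx)
    ((M.mem_regularSet_iff (M.smul_mem g (hfix g hg) q hqs)).1 (smul_mem_regularSet hq g)
      s hsR hsx))
  rw [M.e_smul g (hfix g hg) q hqs] at hs
  rw [M.ρ_mul s g hsx (hfix g hg), LinearMap.comp_apply, M.ρ_apply s hsR hsx, map_sub,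
    map_smul, smul_eq_mul] at h1
  have h2 := M.form_coroot hsR hsx (M.e p)
  have h3 := M.form_self_pos (M.coroot_ne_zero hsR hsx)
  have h4 : M.root s (M.ρ g (M.e q)) * (2 * M.form (M.e p) (M.coroot s)) =
      (M.root s (M.e p) * M.root s (M.ρ g (M.e q))) *
        M.form (M.coroot s) (M.coroot s) := by rw [h2]; ring
  have h5 := mul_neg_of_neg_of_pos hs h3
  linarith

/-- The group generated by the panel reflections is transitive on the chambers. -/
theorem exists_smul_mem_chamber (hA : IsCoxeterTransformationGroup l W X)
    (hC : C ∈ chambers W X) {q : X} (hq : q ∈ regularSet W X) :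
    ∃ g ∈ Subgroup.closure (panelReflections W C), g • q ∈ C := by
  have := hA.continuousConstSMul
  set B : Set X := {q | q ∈ regularSet W X ∧
    ∃ g ∈ Subgroup.closure (panelReflections W C), g • q ∈ C} with hB
  have hCB : C ⊆ B := fun c hc => ⟨chamber_subset hC hc, 1, one_mem _, by rwa [one_smul]⟩
  have hBD : ∀ b ∈ B, ∀ D ∈ chambers W X, b ∈ D → D ⊆ B := by
    rintro b ⟨hb, g, hg, hgb⟩ D hD hbD d hd
    refine ⟨chamber_subset hD hd, g, hg, ?_⟩
    have h1 := smul_chamber hD g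
    rw [chamber_ext hC h1 hgb (Set.smul_mem_smul_set hbD)]
    exact Set.smul_mem_smul_set hd
  -- A point of the closure is moved by some `g` into the closed chamber, where
  -- `LocalModel.exists_smul_mem` handles all nearby regular points; these are dense.
  have hco : IsOpen (closure B) := by
    rw [isOpen_iff_mem_nhds]
    intro x hx
    obtain ⟨M⟩ := exists_localModel hA x
    obtain ⟨b, hbs, hb⟩ := mem_closure_iff.1 hx _ M.e.open_source M.mem_source
    obtain ⟨hbr, g, hg, hgb⟩ := hb
    have hD := chamber_mem hbr
    have hbD := mem_connectedComponentIn hbr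
    set D := connectedComponentIn (regularSet W X) b with hDdef
    have hxD : x ∈ closure D := by
      refine M.mem_closure_chamber hD hbD hbs M.mem_source ?_
      rw [M.map_self]
      filter_upwards [self_mem_nhdsWithin] with t ht r hr hrx
      rw [sub_zero, zero_add, map_smul, smul_eq_mul, mul_left_comm]
      have := (M.mem_regularSet_iff hbs).1 hbr r hr hrx
      exact mul_pos ht (mul_self_pos.2 this)
    have hgD : g • D = C := chamber_ext (smul_chamber hD g) hC (Set.smul_mem_smul_set hbD) hgb
    have hgx : g • x ∈ closure C := by
      rw [← hgD, ← Set.image_smul]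
      exact image_closure_subset_closure_image (continuous_const_smul g) ⟨x, hxD, rfl⟩
    obtain ⟨M'⟩ := exists_localModel hA (g • x)
    have hO : (fun y => g • y) ⁻¹' M'.e.source ∈ 𝓝 x :=
      (M'.e.open_source.preimage (continuous_const_smul g)).mem_nhds M'.mem_source
    filter_upwards [mem_interior_iff_mem_nhds.2 hO |> isOpen_interior.mem_nhds] with y hy
    rw [mem_closure_iff]
    intro O hOo hyO
    obtain ⟨d, hdr, hd⟩ := (dense_regularSet (l := l) hA).exists_mem_open
      (hOo.inter isOpen_interior) ⟨y, hyO, hy⟩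
    have hgd : d ∈ (fun y => g • y) ⁻¹' M'.e.source := interior_subset hd.2
    obtain ⟨h, hh, hhd⟩ := M'.exists_smul_mem hA hC hgx hgd
      (smul_mem_regularSet hdr g)
    refine ⟨d, hd.1, hdr, h * g, mul_mem (Subgroup.closure_mono (fun s hs => hs.1) hh) hg, ?_⟩
    rwa [mul_smul]
  obtain ⟨c, hc⟩ := chamber_nonempty hC
  have huniv : closure B = Set.univ :=
    IsClopen.eq_univ ⟨isClosed_closure, hco⟩ ⟨c, subset_closure (hCB hc)⟩
  have hD := chamber_mem hq
  have hqD := mem_connectedComponentIn hq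
  obtain ⟨b, hbD, hb⟩ := mem_closure_iff.1 (huniv ▸ Set.mem_univ q : q ∈ closure B) _
    (chamber_isOpen hA hD) hqD
  exact (hBD b hb _ hD hbD hqD).2

theorem wall_nonempty {r : W} (hr : r ∈ reflections W X) : (wall X r).Nonempty := by
  by_contra hc
  rw [Set.not_nonempty_iff_eq_empty] at hc
  apply hr.2
  rw [hc, Set.compl_empty]
  exact isPreconnected_univ

theorem smul_mem_closure [ContinuousConstSMul W X] {x : X} {D : Set X} (hx : x ∈ closure D)
    (g : W) : g • x ∈ closure (g • D) := by
  rw [← Set.image_smul]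
  exact image_closure_subset_closure_image (continuous_const_smul g) ⟨x, hx, rfl⟩

/-- The panel reflections generate the group. -/
theorem closure_panelReflections (hA : IsCoxeterTransformationGroup l W X)
    (hC : C ∈ chambers W X) : Subgroup.closure (panelReflections W C) = ⊤ := by
  have := hA.continuousConstSMul
  obtain ⟨A, -, hAR, hAtop⟩ := hA.generated
  rw [eq_top_iff, ← hAtop, Subgroup.closure_le]
  intro r hrA
  have hr := hAR hrA
  obtain ⟨x, hx⟩ := wall_nonempty hr
  obtain ⟨M⟩ := exists_localModel hA x
  -- Choose a point of the wall of `r` on no other wall. Moving an adjacent chamber to `C` by some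
  -- `g` in the panel group turns `r` into a panel reflection `g * r * g⁻¹`.
  obtain ⟨y, -, hys, hyr, hy⟩ := M.exists_generic (LinearMap.ker (M.root r))
    (A := {r' | r' ∈ reflections W X ∧ r' • x = x ∧ r' ≠ r}) (fun r' h => h.2.1) (by
      rintro r' ⟨h1, h2, h3⟩
      by_contra! hc
      exact h3 (M.eq_of_ker_le hA hr hx h1 h2 hc).symm) Filter.univ_mem
  have hyw : y ∈ wall X r := (M.mem_wall_iff r hr hx y hys).2 hyr
  have hyu : ∀ r' ∈ reflections W X, y ∈ wall X r' → r' = r := by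
    intro r' hr' hw
    by_contra hne
    have hx' := M.smul_eq_of_mem_wall hys hw
    exact hy r' ⟨hr', hx', hne⟩ ((M.mem_wall_iff r' hr' hx' y hys).1 hw)
  obtain ⟨M'⟩ := exists_localModel hA y
  obtain ⟨q, hq, hqs⟩ := (dense_regularSet (l := l) hA).exists_mem_open M'.e.open_source
    ⟨y, M'.mem_source⟩
  obtain ⟨g, hg, hgq⟩ := exists_smul_mem_chamber hA hC hq
  have hD := chamber_mem hq
  have hqD := mem_connectedComponentIn hq
  have hyD : y ∈ closure (connectedComponentIn (regularSet W X) q) := by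
    refine M'.mem_closure_chamber hD hqD hqs M'.mem_source ?_
    rw [M'.map_self]
    filter_upwards [self_mem_nhdsWithin] with t ht r hr hrx
    rw [sub_zero, zero_add, map_smul, smul_eq_mul, mul_left_comm]
    exact mul_pos ht (mul_self_pos.2 ((M'.mem_regularSet_iff hqs).1 hq r hr hrx))
  have hgD := chamber_ext (smul_chamber hD g) hC (Set.smul_mem_smul_set hqD) hgq
  have hgy := smul_mem_closure hyD g
  rw [hgD] at hgy
  have hs : g * r * g⁻¹ ∈ panelReflections W C := by
    refine ⟨conj_mem_reflections hr g, g • y, hgy, (smul_mem_wall_conj g r y).2 hyw, ?_⟩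
    intro r' hr' hw
    have h1 := hyu (g⁻¹ * r' * g⁻¹⁻¹) (conj_mem_reflections hr' g⁻¹) (by
      have := (smul_mem_wall_conj g⁻¹ r' (g • y)).2 hw
      rwa [inv_smul_smul] at this)
    rw [← h1]
    group
  have h2 := mul_mem (mul_mem (inv_mem hg) (Subgroup.subset_closure hs)) hg
  have h3 : g⁻¹ * (g * r * g⁻¹) * g = r := by group
  rwa [h3] at h2

/-! ### The separation cocycle and simple transitivity -/

/-- The reflections separating `p` from its translate by `w`. -/
def separating (W : Type*) [Group W] {X : Type*} [TopologicalSpace X] [MulAction W X] (p : X)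
    (w : W) : Set W :=
  {r | r ∈ reflections W X ∧ ¬ SameSide r p (w • p)}

/-- Join `C` and `sC` through a linearised chart at a point lying on the wall of `s` alone: every
wall meeting the chart contains its centre. -/
theorem panel_sameSide (hA : IsCoxeterTransformationGroup l W X) (hC : C ∈ chambers W X) {p : X}
    (hp : p ∈ C) {s : W} (hs : s ∈ panelReflections W C) :
    ∃ A : Set X, IsPreconnected A ∧ p ∈ A ∧ s • p ∈ A ∧
      ∀ r ∈ reflections W X, r ≠ s → ∀ a ∈ A, a ∉ wall X r := by
  have := hA.continuousConstSMul
  obtain ⟨hsR, y, hyC, hys, hyu⟩ := hs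
  obtain ⟨M⟩ := exists_localModel hA y
  obtain ⟨q, hqs, hq⟩ := mem_closure_iff.1 hyC _ M.e.open_source M.mem_source
  have hCs := smul_chamber hC s
  have h1 : IsPreconnected (C ∪ M.e.source) :=
    (chamber_isPreconnected hC).union q hq hqs M.isPreconnected_source
  have h2 : IsPreconnected (C ∪ M.e.source ∪ s • C) :=
    h1.union (s • q) (Or.inr (M.smul_mem s hys q hqs)) (Set.smul_mem_smul_set hq)
      (chamber_isPreconnected hCs)
  refine ⟨_, h2, Or.inl (Or.inl hp), Or.inr (Set.smul_mem_smul_set hp), ?_⟩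
  rintro r hr hrs a ((ha | ha) | ha) hw
  · exact mem_regularSet.1 (chamber_subset hC ha) r hr hw
  · exact hrs (hyu r hr (M.smul_eq_of_mem_wall ha hw))
  · exact mem_regularSet.1 (chamber_subset hCs ha) r hr hw

/-- This links geometry to words: a wall has two sides, so it separates `p` from `vw • p` exactly
when it separates one of the pairs `p, v • p` and `v • p, vw • p` but not the other. -/
theorem isSeparation (hA : IsCoxeterTransformationGroup l W X) (hC : C ∈ chambers W X) {p : X}
    (hp : p ∈ C) : IsSeparation (panelReflections W C) (separating W p) := by
  have := hA.continuousConstSMul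
  have hpr : ∀ (g : W) (r : W), r ∈ reflections W X → g • p ∉ wall X r := fun g r hr =>
    mem_regularSet.1 (smul_mem_regularSet (chamber_subset hC hp) g) r hr
  refine ⟨fun s hs => hs.1.1, fun s hs => ?_, fun v w r => ?_⟩
  · ext r
    simp only [separating, Set.mem_ofPred_eq, Set.mem_singleton_iff]
    constructor
    · rintro ⟨hr, h⟩
      by_contra hne
      obtain ⟨A, hAc, h1, h2, h3⟩ := panel_sameSide hA hC hp hs
      exact h (SameSide.of_isPreconnected hAc (h3 r hr hne) h1 h2)
    · rintro rfl
      exact ⟨hs.1, not_sameSide_smul hA hs.1 p⟩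
  · by_cases hr : r ∈ reflections W X
    · have hr' : v⁻¹ * r * v ∈ reflections W X := by
        have := conj_mem_reflections hr v⁻¹
        rwa [inv_inv] at this
      have e : SameSide (v⁻¹ * r * v) p (w • p) ↔ SameSide r (v • p) ((v * w) • p) := by
        rw [← SameSide.smul_iff v, mul_smul]
        have : v * (v⁻¹ * r * v) * v⁻¹ = r := by group
        rw [this]
      have hpp : p ∉ wall X r := by simpa using hpr 1 r hr
      simp only [separating, Set.mem_ofPred_eq, hr, hr', true_and, e]
      constructor
      · intro h
        by_cases h1 : SameSide r p (v • p)
        · exact Or.inr ⟨fun h2 => h (h1.trans h2), not_not.2 h1⟩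
        · exact Or.inl ⟨h1, not_not.2 (by_contra fun h2 =>
            h (sameSide_of_not hA hr hpp (hpr v r hr) (hpr _ r hr) h1 h2))⟩
      · rintro (⟨h1, h2⟩ | ⟨h1, h2⟩) h
        · exact h1 (h.trans (not_not.1 h2).symm)
        · exact h1 ((not_not.1 h2).symm.trans h)
    · have hr' : v⁻¹ * r * v ∉ reflections W X := by
        intro hc
        have := conj_mem_reflections hc v
        refine hr ?_
        convert this using 1
        group
      simp [separating, hr, hr', Xor]

theorem smul_chamber_injective (hA : IsCoxeterTransformationGroup l W X) (hC : C ∈ chambers W X)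
    {v w : W} (h : v • C = w • C) : v = w := by
  have := hA.continuousConstSMul
  obtain ⟨p, hp⟩ := chamber_nonempty hC
  have h1 : v⁻¹ * w = 1 := by
    refine (isSeparation hA hC hp).eq_one_of_empty
      (closure_panelReflections hA hC ▸ Subgroup.mem_top _) ?_
    have hmem : (v⁻¹ * w) • p ∈ C := by
      rw [mul_smul, ← Set.mem_smul_set_iff_inv_smul_mem, h]
      exact Set.smul_mem_smul_set hp
    rw [Set.eq_empty_iff_forall_notMem]
    rintro r ⟨hr, hrs⟩
    exact hrs (chamber_sameSide hC hr hp hmem)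
  rw [← mul_one v, ← h1, mul_inv_cancel_left]

theorem exists_eq_smul_chamber (hA : IsCoxeterTransformationGroup l W X)
    (hC : C ∈ chambers W X) {D : Set X} (hD : D ∈ chambers W X) : ∃ w : W, D = w • C := by
  have := hA.continuousConstSMul
  obtain ⟨q, hq⟩ := chamber_nonempty hD
  obtain ⟨g, -, hg⟩ := exists_smul_mem_chamber hA hC (chamber_subset hD hq)
  refine ⟨g⁻¹, chamber_ext hD (smul_chamber hC g⁻¹) hq ?_⟩
  rwa [Set.mem_smul_set_iff_inv_smul_mem, inv_inv]

/-- The closed chamber is a strict fundamental domain. -/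
theorem mem_closure_of_mem_closure_smul (hA : IsCoxeterTransformationGroup l W X)
    (hC : C ∈ chambers W X) {x : X} {u : W} (hx : x ∈ closure C) (hxu : x ∈ closure (u • C)) :
    u ∈ Subgroup.closure {s | s ∈ panelReflections W C ∧ s • x = x} := by
  have := hA.continuousConstSMul
  obtain ⟨M⟩ := exists_localModel hA x
  have huC := smul_chamber hC u
  obtain ⟨q, hqs, hq⟩ := mem_closure_iff.1 hxu _ M.e.open_source M.mem_source
  -- A product of panel reflections fixing `x` moves `uC` back to `C`; freeness on chambers
  -- identifies it with `u⁻¹`.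
  obtain ⟨g, hg, hgq⟩ := M.exists_smul_mem hA hC hx hqs (chamber_subset huC hq)
  have h1 : (g * u) • C = (1 : W) • C := by
    rw [one_smul, mul_smul]
    exact chamber_ext (smul_chamber huC g) hC (Set.smul_mem_smul_set hq) hgq
  have h2 := smul_chamber_injective hA hC h1
  rw [eq_inv_of_mul_eq_one_right h2]
  exact inv_mem hg

end Transitivity

/-! ### Strata -/

section StrataTheory

open Topology

set_option linter.unusedSectionVars false

variable {l : ℕ} {W : Type*} [Group W] {X : Type*} [TopologicalSpace X] [T2Space X]
  [ChartedSpace (EuclideanSpace ℝ (Fin l)) X] [MulAction W X]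
  [IsManifold (𝓡 l) ∞ X]

/-- The dimension of a submanifold bounds that of any linear slice contained in it. -/
theorem HasCodimAt.finrank_le {e : OpenPartialHomeomorph X (EuclideanSpace ℝ (Fin l))}
    (he : e ∈ IsManifold.maximalAtlas (𝓡 l) ∞ X) {Y : Set X} {d : ℕ} {y : X}
    (hy : y ∈ e.source) (hYd : HasCodimAt l Y d y) (V : Submodule ℝ (EuclideanSpace ℝ (Fin l)))
    (hV : ∀ v ∈ V, ∀ᶠ t : ℝ in 𝓝 0, e.symm (e y + t • v) ∈ Y) :
    Module.finrank ℝ V + d ≤ l := by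
  obtain ⟨hyY, e', he', hy', V', hV', hslice⟩ := hYd
  have hds : ∀ e e' : OpenPartialHomeomorph X (EuclideanSpace ℝ (Fin l)),
      e ∈ IsManifold.maximalAtlas (𝓡 l) ∞ X → e' ∈ IsManifold.maximalAtlas (𝓡 l) ∞ X →
      y ∈ e.source → y ∈ e'.source → DifferentiableAt ℝ (fun v => e' (e.symm v)) (e y) := by
    intro e e' he he' hy hy'
    refine ContDiffAt.differentiableAt (n := ∞) ?_ (by simp)
    rw [← contMDiffAt_iff_contDiffAt]
    refine ContMDiffAt.comp (e y) (contMDiffAt_of_mem_maximalAtlas he' ?_)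
      (contMDiffAt_symm_of_mem_maximalAtlas he (e.map_source hy))
    rwa [e.left_inv hy]
  have h1 := (hds e e' he he' hy hy').hasFDerivAt
  have h2 := (hds e' e he' he hy' hy).hasFDerivAt
  set A := fderiv ℝ (fun v => e' (e.symm v)) (e y) with hA
  set B := fderiv ℝ (fun v => e (e'.symm v)) (e' y) with hB
  have hey : e' (e.symm (e y)) = e' y := by rw [e.left_inv hy]
  have hBA : B.comp A = ContinuousLinearMap.id ℝ _ := by
    rw [← hey] at h2
    have h3 := h2.comp (e y) h1
    refine h3.unique ((hasFDerivAt_id (e y)).congr_of_eventuallyEq ?_)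
    have hc := (e.continuousAt_symm (e.map_source hy)).eventually
      (e'.open_source.mem_nhds (by rwa [e.left_inv hy]))
    filter_upwards [hc, e.open_target.mem_nhds (e.map_source hy)] with v hv hvt
    change e (e'.symm (e' (e.symm v))) = v
    rw [e'.left_inv hv, e.right_inv hvt]
  have hAinj : Function.Injective A := by
    intro v w hvw
    have : B.comp A v = B.comp A w := congrArg B hvw
    rwa [hBA] at this
  -- The line in direction `v` stays in `Y`, so in the slice chart its difference quotients lie in
  -- `V'`, and so does their limit.
  have hAV : V.map A.toLinearMap ≤ V' := by
    rintro _ ⟨v, hv, rfl⟩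
    have h3 : HasDerivAt (fun t : ℝ => e' (e.symm (e y + t • v))) (A v) 0 :=
      h1.hasLineDerivAt v
    rw [hasDerivAt_iff_tendsto_slope_zero] at h3
    refine V'.closed_of_finiteDimensional.mem_of_tendsto h3 ?_
    have hc : Filter.Tendsto (fun t : ℝ => e.symm (e y + t • v)) (𝓝 0) (𝓝 y) := by
      have h4 : Filter.Tendsto (fun t : ℝ => e y + t • v) (𝓝 0) (𝓝 (e y)) := by
        have : Continuous fun t : ℝ => e y + t • v := by fun_prop
        simpa using this.tendsto 0
      have h5 := (e.continuousAt_symm (e.map_source hy)).tendsto.comp h4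
      rwa [e.left_inv hy] at h5
    filter_upwards [((hV v hv).and (hc.eventually (e'.open_source.mem_nhds hy'))).filter_mono
      nhdsWithin_le_nhds] with t ht
    have h6 := (hslice _ ht.2).1 ht.1
    simp only [zero_add, zero_smul, add_zero, hey]
    exact V'.smul_mem _ h6
  have h3 := LinearEquiv.finrank_eq
    (Submodule.equivMapOfInjective A.toLinearMap (by exact hAinj) V)
  have h4 := Submodule.finrank_mono hAV
  omega

theorem finrank_ker_functional {E : Type*} [AddCommGroup E] [Module ℝ E] [FiniteDimensional ℝ E]
    {f : E →ₗ[ℝ] ℝ} (hf : f ≠ 0) :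
    Module.finrank ℝ (LinearMap.ker f) + 1 = Module.finrank ℝ E := by
  have h1 := f.finrank_range_add_finrank_ker
  rw [LinearMap.range_eq_top.2 (LinearMap.surjective hf), finrank_top, Module.finrank_self] at h1
  omega

theorem finrank_inf_ker {E : Type*} [AddCommGroup E] [Module ℝ E] [FiniteDimensional ℝ E]
    (U : Submodule ℝ E) (f : E →ₗ[ℝ] ℝ) :
    Module.finrank ℝ U ≤ Module.finrank ℝ (U ⊓ LinearMap.ker f : Submodule ℝ E) + 1 := by
  by_cases hf : f = 0
  · rw [hf, LinearMap.ker_zero, inf_top_eq]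
    omega
  have h1 := Submodule.finrank_sup_add_finrank_inf_eq U (LinearMap.ker f)
  have h2 := finrank_ker_functional hf
  have h3 := Submodule.finrank_le (U ⊔ LinearMap.ker f)
  omega

/-- Between a finite intersection of hyperplanes and the whole space every dimension is attained
by a partial intersection. -/
theorem exists_subset_finrank {ι E : Type*} [AddCommGroup E] [Module ℝ E]
    [FiniteDimensional ℝ E] (f : ι → E →ₗ[ℝ] ℝ) (A : Finset ι) {k : ℕ}
    (h1 : Module.finrank ℝ (⨅ r ∈ A, LinearMap.ker (f r) : Submodule ℝ E) ≤ k)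
    (h2 : k ≤ Module.finrank ℝ E) :
    ∃ B ⊆ A, Module.finrank ℝ (⨅ r ∈ B, LinearMap.ker (f r) : Submodule ℝ E) = k := by
  classical
  induction A using Finset.induction_on with
  | empty =>
    refine ⟨∅, subset_rfl, le_antisymm h1 ?_⟩
    have : (⨅ r ∈ (∅ : Finset ι), LinearMap.ker (f r)) = ⊤ := by simp
    rwa [this, finrank_top]
  | insert r A hr ih =>
    by_cases h3 : Module.finrank ℝ (⨅ r ∈ A, LinearMap.ker (f r) : Submodule ℝ E) ≤ k
    · obtain ⟨B, hB, h⟩ := ih h3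
      exact ⟨B, hB.trans (Finset.subset_insert _ _), h⟩
    · refine ⟨insert r A, subset_rfl, le_antisymm h1 ?_⟩
      have h4 := finrank_inf_ker (⨅ r ∈ A, LinearMap.ker (f r)) (f r)
      rw [Finset.iInf_insert, inf_comm]
      omega

variable [ProperlyDiscontinuousSMul W X] [ConnectedSpace X]

namespace LocalModel

variable {x : X} (M : LocalModel l W x)

/-- The intersection of the linear hyperplanes of the walls through `y`. -/
def centre (y : X) : Submodule ℝ (EuclideanSpace ℝ (Fin l)) :=
  ⨅ r ∈ {r | r ∈ reflections W X ∧ y ∈ wall X r}, LinearMap.ker (M.root r)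

theorem mem_centre {y : X} {v : EuclideanSpace ℝ (Fin l)} :
    v ∈ M.centre y ↔ ∀ r ∈ reflections W X, y ∈ wall X r → M.root r v = 0 := by
  simp [centre, Submodule.mem_iInf]

theorem mem_centre_self {y : X} (hy : y ∈ M.e.source) : M.e y ∈ M.centre y :=
  M.mem_centre.2 fun r hr hw => (M.mem_wall_iff r hr (M.smul_eq_of_mem_wall hy hw) y hy).1 hw

theorem mem_component {y z : X} (hy : y ∈ M.e.source) (hz : z ∈ M.e.source) {r : W}
    (hr : r ∈ reflections W X) (hyr : y ∈ wall X r) (hzr : M.root r (M.e z) = 0) :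
    z ∈ connectedComponentIn (wall X r) y := by
  have hx := M.smul_eq_of_mem_wall hy hyr
  refine (M.isPreconnected_preimage (LinearMap.ker (M.root r)).convex).subset_connectedComponentIn
    (x := y) ⟨hy, ?_⟩ ?_ ⟨hz, hzr⟩
  · exact (M.mem_wall_iff r hr hx y hy).1 hyr
  · rintro a ⟨ha, ha'⟩
    exact (M.mem_wall_iff r hr hx a ha).2 ha'

/-- An intersection of wall components through `y` contains a slice parallel to `centre y`, which
bounds its codimension. Conversely, imposing the walls through `y` one at a time reaches every
smaller codimension. So `codimUnion` collects the points of codimension at least `d`, and successive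
differences fix the dimension of the centre. -/
theorem mem_codimUnion_iff {y : X} (hy : y ∈ M.e.source) (d : ℕ) :
    y ∈ codimUnion l W X d ↔ Module.finrank ℝ (M.centre y) + d ≤ l := by
  constructor
  · rintro ⟨𝓗, h𝓗, hd⟩
    refine hd.finrank_le M.mem_atlas hy _ fun v hv => ?_
    filter_upwards [M.eventually_line hy v] with t ht
    intro H hH
    obtain ⟨r, hr, x', hx', rfl⟩ := h𝓗 hH
    have hyH : y ∈ connectedComponentIn (wall X r) x' := hd.1 _ hH
    have hyr := connectedComponentIn_subset _ _ hyH
    rw [connectedComponentIn_eq hyH]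
    refine M.mem_component hy (M.e.map_target ht) hr hyr ?_
    rw [M.e.right_inv ht, map_add, map_smul, M.mem_centre.1 hv r hr hyr,
      M.mem_centre.1 (M.mem_centre_self hy) r hr hyr, smul_zero, add_zero]
  · intro h
    have hfin : {r | r ∈ reflections W X ∧ y ∈ wall X r}.Finite :=
      (finite_stabilizer (W := W) y).subset fun r hr => hr.2
    have hA : ∀ r, r ∈ hfin.toFinset ↔ r ∈ reflections W X ∧ y ∈ wall X r := fun r => by
      rw [Set.Finite.mem_toFinset]; rfl
    have h1 : (⨅ r ∈ hfin.toFinset, LinearMap.ker (M.root r)) = M.centre y := by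
      ext v
      simp only [Submodule.mem_iInf, hA, mem_centre, LinearMap.mem_ker, and_imp]
    obtain ⟨B, hBA, hB⟩ := exists_subset_finrank M.root hfin.toFinset (k := l - d)
      (by rw [h1]; omega) (by simp)
    have hBr : ∀ r ∈ B, r ∈ reflections W X ∧ y ∈ wall X r := fun r hr => (hA r).1 (hBA hr)
    have hroot : ∀ r ∈ B, M.root r (M.e y) = 0 := fun r hr =>
      M.mem_centre.1 (M.mem_centre_self hy) r (hBr r hr).1 (hBr r hr).2
    refine ⟨(fun r => connectedComponentIn (wall X r) y) '' (B : Set W), ?_, ?_, M.e, M.mem_atlas, hy,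
      ⨅ r ∈ B, LinearMap.ker (M.root r), by omega, ?_⟩
    · rintro _ ⟨r, hr, rfl⟩
      exact ⟨r, (hBr r hr).1, y, (hBr r hr).2, rfl⟩
    · rintro _ ⟨r, hr, rfl⟩
      exact mem_connectedComponentIn (hBr r hr).2
    · intro z hz
      simp only [Submodule.mem_iInf, LinearMap.mem_ker, map_sub]
      constructor
      · intro hzH r hr
        have hzr := connectedComponentIn_subset _ _ (hzH _ ⟨r, hr, rfl⟩)
        rw [hroot r hr, sub_zero]
        exact (M.mem_wall_iff r (hBr r hr).1 (M.smul_eq_of_mem_wall hy (hBr r hr).2) z hz).1 hzr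
      · rintro h2 _ ⟨r, hr, rfl⟩
        have := h2 r hr
        rw [hroot r hr, sub_zero] at this
        exact M.mem_component hy hz (hBr r hr).1 (hBr r hr).2 this

theorem mem_codim_iff {y : X} (hy : y ∈ M.e.source) (d : ℕ) :
    y ∈ codimUnion l W X d \ codimUnion l W X (d + 1) ↔
      Module.finrank ℝ (M.centre y) + d = l := by
  rw [Set.mem_sdiff, M.mem_codimUnion_iff hy, M.mem_codimUnion_iff hy]
  omega

theorem centre_eq_top_iff {y : X} (hy : y ∈ M.e.source) :
    M.centre y = ⊤ ↔ y ∈ regularSet W X := by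
  rw [mem_regularSet]
  constructor
  · intro h r hr hw
    refine M.root_ne_zero hr (M.smul_eq_of_mem_wall hy hw) (LinearMap.ext fun v => ?_)
    exact M.mem_centre.1 (h ▸ Submodule.mem_top : v ∈ M.centre y) r hr hw
  · intro h
    rw [eq_top_iff]
    exact fun v _ => M.mem_centre.2 fun r hr hw => absurd hw (h r hr)

end LocalModel

/-! ### Faces and the walls through them -/

theorem face_nonempty {F : Set X} (hF : F ∈ faces l W X) : F.Nonempty := by
  obtain ⟨d, x, hx, rfl⟩ := hF
  exact ⟨x, mem_connectedComponentIn hx⟩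

theorem face_isPreconnected {F : Set X} (hF : F ∈ faces l W X) : IsPreconnected F := by
  obtain ⟨d, x, hx, rfl⟩ := hF
  exact isPreconnected_connectedComponentIn

theorem exists_face (hA : IsCoxeterTransformationGroup l W X) (x : X) :
    ∃ F ∈ faces l W X, x ∈ F := by
  obtain ⟨M⟩ := exists_localModel hA x
  have h := (M.centre x).finrank_le
  rw [finrank_euclideanSpace_fin] at h
  have hx := (M.mem_codim_iff M.mem_source (l - Module.finrank ℝ (M.centre x))).2 (by omega)
  exact ⟨_, ⟨_, x, hx, rfl⟩, mem_connectedComponentIn hx⟩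

/-- Along a face, the set of walls containing a point is locally constant. -/
theorem eventually_mem_wall (hA : IsCoxeterTransformationGroup l W X) {F : Set X}
    (hF : F ∈ faces l W X) {x : X} (hx : x ∈ F) :
    ∀ᶠ y in 𝓝 x, y ∈ F → ∀ r ∈ reflections W X, x ∈ wall X r → y ∈ wall X r := by
  obtain ⟨M⟩ := exists_localModel hA x
  obtain ⟨d, x₀, -, rfl⟩ := hF
  filter_upwards [M.e.open_source.mem_nhds M.mem_source] with y hy hyF r hr hxr
  have h1 := (M.mem_codim_iff M.mem_source d).1 (connectedComponentIn_subset _ _ hx)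
  have h2 := (M.mem_codim_iff hy d).1 (connectedComponentIn_subset _ _ hyF)
  have hle : M.centre x ≤ M.centre y := fun v hv => M.mem_centre.2 fun r hr hw =>
    M.mem_centre.1 hv r hr (M.smul_eq_of_mem_wall hy hw)
  have heq := Submodule.eq_of_le_of_finrank_eq hle (by omega)
  have h3 := M.mem_centre_self hy
  rw [← heq] at h3
  exact (M.mem_wall_iff r hr hxr y hy).2 (M.mem_centre.1 h3 r hr hxr)

/-- Along a face nearby points keep the same walls, so `Z` is relatively open as well as closed in
the connected set `F`. Walls and closed chambers are the intended `Z`. -/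
theorem face_subset_of_closed (hA : IsCoxeterTransformationGroup l W X) {F Z : Set X}
    (hF : F ∈ faces l W X) (hZ : IsClosed Z) (h : ∀ x ∈ Z, ∀ᶠ y in 𝓝 x,
      (∀ r ∈ reflections W X, x ∈ wall X r → y ∈ wall X r) → y ∈ Z) {x₀ : X} (hx₀ : x₀ ∈ F)
    (hx₀Z : x₀ ∈ Z) : F ⊆ Z := by
  by_contra hc
  obtain ⟨z, hzF, hzZ⟩ := Set.not_subset.1 hc
  have hO : IsOpen {x | ∀ᶠ y in 𝓝 x, y ∈ F → y ∈ Z} := isOpen_setOfPred_eventually_nhds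
  have hFO : ∀ x ∈ F, x ∈ Z → ∀ᶠ y in 𝓝 x, y ∈ F → y ∈ Z := by
    intro x hx hxZ
    filter_upwards [eventually_mem_wall hA hF hx, h x hxZ] with y h1 h2 hyF
    exact h2 (h1 hyF)
  obtain ⟨w, hwF, hwO, hwZ⟩ := face_isPreconnected hF _ Zᶜ hO hZ.isOpen_compl
    (fun x hx => (em (x ∈ Z)).imp (hFO x hx) id) ⟨x₀, hx₀, hFO x₀ hx₀ hx₀Z⟩ ⟨z, hzF, hzZ⟩
  exact hwZ (Filter.Eventually.self_of_nhds hwO hwF)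

theorem face_subset_wall (hA : IsCoxeterTransformationGroup l W X) {F : Set X}
    (hF : F ∈ faces l W X) {x : X} (hx : x ∈ F) {r : W} (hr : r ∈ reflections W X)
    (hxr : x ∈ wall X r) : F ⊆ wall X r := by
  have := hA.continuousConstSMul
  exact face_subset_of_closed hA hF (isClosed_wall r)
    (fun x hx => Filter.Eventually.of_forall fun y hy => hy r hr hx) hx hxr

theorem face_subset_closure_chamber (hA : IsCoxeterTransformationGroup l W X) {F C : Set X}
    (hF : F ∈ faces l W X) (hC : C ∈ chambers W X) {x : X} (hx : x ∈ F) (hxC : x ∈ closure C) :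
    F ⊆ closure C := by
  refine face_subset_of_closed hA hF isClosed_closure (fun x hx => ?_) hx hxC
  obtain ⟨M⟩ := exists_localModel hA x
  obtain ⟨p, hps, hp⟩ := mem_closure_iff.1 hx _ M.e.open_source M.mem_source
  filter_upwards [M.e.open_source.mem_nhds M.mem_source] with y hy h
  refine M.mem_closure_chamber hC hp hps hy ?_
  filter_upwards [self_mem_nhdsWithin] with t ht r hr hrx
  -- All roots at `x` vanish at `y`, so along the segment from `y` to `p` they have the signs of
  -- `p`.
  have h1 := (M.mem_wall_iff r hr hrx y hy).1 (h r hr hrx)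
  rw [map_add, map_smul, map_sub, h1, smul_eq_mul, sub_zero, zero_add, mul_left_comm]
  exact mul_pos ht (mul_self_pos.2
    ((M.mem_regularSet_iff hps).1 (chamber_subset hC hp) r hr hrx))

theorem codim_zero (hA : IsCoxeterTransformationGroup l W X) :
    codimUnion l W X 0 \ codimUnion l W X (0 + 1) = regularSet W X := by
  ext x
  obtain ⟨M⟩ := exists_localModel hA x
  rw [M.mem_codim_iff M.mem_source, ← M.centre_eq_top_iff M.mem_source]
  constructor
  · intro h
    exact Submodule.eq_top_of_finrank_eq (by rw [finrank_euclideanSpace_fin]; omega)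
  · intro h
    rw [h, finrank_top, finrank_euclideanSpace_fin, add_zero]

theorem strata_zero (hA : IsCoxeterTransformationGroup l W X) :
    strata l W X 0 = chambers W X := by
  rw [strata, codim_zero hA]
  rfl

theorem chamber_mem_faces (hA : IsCoxeterTransformationGroup l W X) {C : Set X}
    (hC : C ∈ chambers W X) : C ∈ faces l W X := ⟨0, by rwa [strata_zero hA]⟩

/-- If the centre has codimension one it equals the hyperplane of any wall through `y`, and
reflections with the same hyperplane coincide. -/
theorem codim_one_iff (hA : IsCoxeterTransformationGroup l W X) (y : X) :
    y ∈ codimUnion l W X 1 \ codimUnion l W X (1 + 1) ↔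
      ∃ s ∈ reflections W X, y ∈ wall X s ∧ ∀ r ∈ reflections W X, y ∈ wall X r → r = s := by
  obtain ⟨M⟩ := exists_localModel hA y
  have hker : ∀ s ∈ reflections W X, y ∈ wall X s →
      Module.finrank ℝ (LinearMap.ker (M.root s)) + 1 = l := fun s hs hys => by
    rw [finrank_ker_functional (M.root_ne_zero hs hys), finrank_euclideanSpace_fin]
  have hle : ∀ s ∈ reflections W X, y ∈ wall X s → M.centre y ≤ LinearMap.ker (M.root s) :=
    fun s hs hys v hv => M.mem_centre.1 hv s hs hys
  rw [M.mem_codim_iff M.mem_source]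
  constructor
  · intro h
    have hne : y ∉ regularSet W X := by
      rw [← M.centre_eq_top_iff M.mem_source]
      intro hc
      rw [hc, finrank_top, finrank_euclideanSpace_fin] at h
      omega
    rw [mem_regularSet] at hne
    push Not at hne
    obtain ⟨s, hs, hys⟩ := hne
    refine ⟨s, hs, hys, fun r hr hyr => (M.eq_of_ker_le hA hs hys hr hyr fun v hv => ?_).symm⟩
    have h1 := Submodule.eq_of_le_of_finrank_eq (hle s hs hys) (by have := hker s hs hys; omega)
    have h2 : v ∈ M.centre y := h1 ▸ hv
    exact hle r hr hyr h2
  · rintro ⟨s, hs, hys, hu⟩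
    have : M.centre y = LinearMap.ker (M.root s) := by
      refine (hle s hs hys).antisymm fun v hv => M.mem_centre.2 fun r hr hyr => ?_
      rw [hu r hr hyr]
      exact hv
    rw [this, hker s hs hys]

/-- This lets the word combinatorics, proved for panel reflections, be applied to the set `S` of the
theorem. -/
theorem simpleReflections_eq (hA : IsCoxeterTransformationGroup l W X) {C : Set X}
    (hC : C ∈ chambers W X) : simpleReflections l W C = panelReflections W C := by
  ext s
  constructor
  · rintro ⟨hs, F, hF, hFm⟩
    obtain ⟨y, hy, rfl⟩ := hF
    obtain ⟨s', hs', hys', hu⟩ := (codim_one_iff hA y).1 hy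
    have hym := hFm (mem_connectedComponentIn hy)
    refine ⟨hs, y, hym.1, hym.2, fun r hr hyr => ?_⟩
    rw [hu r hr hyr, hu s hs hym.2]
  · rintro ⟨hs, y, hyC, hys, hu⟩
    have hy := (codim_one_iff hA y).2 ⟨s, hs, hys, hu⟩
    have hF : connectedComponentIn (codimUnion l W X 1 \ codimUnion l W X (1 + 1)) y ∈
        strata l W X 1 := ⟨y, hy, rfl⟩
    refine ⟨hs, _, hF, fun z hz => ⟨?_, ?_⟩⟩
    · exact face_subset_closure_chamber hA ⟨1, hF⟩ hC (mem_connectedComponentIn hy) hyC hz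
    · exact face_subset_wall hA ⟨1, hF⟩ (mem_connectedComponentIn hy) hs hys hz

/-! ### Equivariance of the faces -/

theorem smul_connectedComponentIn [ContinuousConstSMul W X] (g : W) {A : Set X} {x : X}
    (hx : x ∈ A) :
    g • connectedComponentIn A x = connectedComponentIn (g • A) (g • x) :=
  (Homeomorph.smul g).image_connectedComponentIn hx

theorem smul_wall (g r : W) : g • wall X r = wall X (g * r * g⁻¹) := by
  ext y
  rw [Set.mem_smul_set_iff_inv_smul_mem, ← smul_mem_wall_conj g, smul_inv_smul]

theorem HasCodimAt.smul (hA : IsCoxeterTransformationGroup l W X) {Y : Set X} {d : ℕ} {x : X}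
    (h : HasCodimAt l Y d x) (g : W) : HasCodimAt l (g • Y) d (g • x) := by
  have := hA.continuousConstSMul
  obtain ⟨hxY, e, he, hx, V, hV, hs⟩ := h
  refine ⟨Set.smul_mem_smul_set hxY,
    ((Homeomorph.smul g⁻¹ : X ≃ₜ X).toOpenPartialHomeomorph.trans e), ?_, ?_, V, hV, ?_⟩
  · refine OpenPartialHomeomorph.mem_maximalAtlas_of_contMDiffOn _ ?_ ?_
    · intro y hy
      have hy' : g⁻¹ • y ∈ e.source := by simpa using hy
      exact ((contMDiffAt_of_mem_maximalAtlas he hy').comp y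
        (hA.smooth g⁻¹).contMDiffAt).contMDiffWithinAt
    · intro v hv
      have hv' : v ∈ e.target := by simpa using hv
      have h1 := ((hA.smooth g).contMDiffAt.comp v
        (contMDiffAt_symm_of_mem_maximalAtlas he hv')).contMDiffWithinAt
          (s := ((Homeomorph.smul g⁻¹ : X ≃ₜ X).toOpenPartialHomeomorph.trans e).target)
      refine h1.congr (fun w _ => ?_) ?_ <;> simp
  · simpa using hx
  · intro y hy
    have hy' : g⁻¹ • y ∈ e.source := by simpa using hy
    rw [Set.mem_smul_set_iff_inv_smul_mem, hs _ hy']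
    simp

theorem smul_codimUnion (hA : IsCoxeterTransformationGroup l W X) (g : W) (d : ℕ) :
    g • codimUnion l W X d = codimUnion l W X d := by
  have := hA.continuousConstSMul
  have key : ∀ (g : W) (x : X), x ∈ codimUnion l W X d → g • x ∈ codimUnion l W X d := by
    rintro g x ⟨𝓗, h𝓗, hd⟩
    refine ⟨(fun H => g • H) '' 𝓗, ?_, ?_⟩
    · rintro _ ⟨H, hH, rfl⟩
      obtain ⟨r, hr, x', hx', rfl⟩ := h𝓗 hH
      refine ⟨g * r * g⁻¹, conj_mem_reflections hr g, g • x', ?_, ?_⟩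
      · rwa [smul_mem_wall_conj]
      · change g • connectedComponentIn (wall X r) x' = _
        rw [smul_connectedComponentIn g hx', smul_wall]
    · convert hd.smul hA g using 1
      ext y
      simp only [Set.mem_sInter, Set.forall_mem_image, Set.mem_smul_set_iff_inv_smul_mem]
  ext y
  rw [Set.mem_smul_set_iff_inv_smul_mem]
  refine ⟨fun h => ?_, key g⁻¹ y⟩
  have := key g _ h
  rwa [smul_inv_smul] at this

theorem smul_face (hA : IsCoxeterTransformationGroup l W X) {F : Set X} (hF : F ∈ faces l W X)
    (g : W) : g • F ∈ faces l W X := by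
  have := hA.continuousConstSMul
  obtain ⟨d, x, hx, rfl⟩ := hF
  have h1 : g • (codimUnion l W X d \ codimUnion l W X (d + 1)) =
      codimUnion l W X d \ codimUnion l W X (d + 1) := by
    rw [Set.smul_set_sdiff, smul_codimUnion hA, smul_codimUnion hA]
  refine ⟨d, g • x, ?_, ?_⟩
  · rw [← h1]
    exact Set.smul_mem_smul_set hx
  · rw [smul_connectedComponentIn g hx, h1]

end StrataTheory

/-! ### The faces of a chamber and their Coxeter types -/

section ChamberFaces

open Topology

set_option linter.unusedSectionVars false

variable {l : ℕ} {W : Type*} [Group W] {X : Type*} [TopologicalSpace X] [T2Space X]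
  [ChartedSpace (EuclideanSpace ℝ (Fin l)) X] [MulAction W X]
  [IsManifold (𝓡 l) ∞ X] [ProperlyDiscontinuousSMul W X] [ConnectedSpace X] {C : Set X}

theorem sigma_eq (hA : IsCoxeterTransformationGroup l W X) (hC : C ∈ chambers W X) {F : Set X}
    (hF : F ∈ facesOf l W C) {x : X} (hx : x ∈ F) :
    sigma l W C F = {s | s ∈ panelReflections W C ∧ s • x = x} := by
  ext s
  rw [sigma, simpleReflections_eq hA hC]
  constructor
  · rintro ⟨hs, h⟩
    exact ⟨hs, (h hx).2⟩
  · rintro ⟨hs, h⟩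
    exact ⟨hs, Set.subset_inter hF.2 (face_subset_wall hA hF.1 hx hs.1 h)⟩

theorem sigma_subset (hA : IsCoxeterTransformationGroup l W X) (hC : C ∈ chambers W X)
    (F : Set X) : sigma l W C F ⊆ panelReflections W C := by
  rw [← simpleReflections_eq hA hC]
  exact fun s hs => hs.1

theorem smul_eq_of_mem_closure_sigma {F : Set X} {g : W}
    (hg : g ∈ Subgroup.closure (sigma l W C F)) {x : X} (hx : x ∈ F) : g • x = x :=
  closure_le_stabilizer (fun _ hs => (hs.2 hx).2) g hg

theorem smul_face_eq {F : Set X} {g : W} (hg : g ∈ Subgroup.closure (sigma l W C F)) :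
    g • F = F := by
  ext y
  rw [Set.mem_smul_set_iff_inv_smul_mem]
  constructor
  · intro h
    have := smul_eq_of_mem_closure_sigma hg h
    rw [smul_inv_smul] at this
    rwa [this]
  · intro h
    rwa [smul_eq_of_mem_closure_sigma (inv_mem hg) h]

theorem mem_chambers_of_face (hA : IsCoxeterTransformationGroup l W X) {F : Set X}
    (hF : F ∈ faces l W X) {x : X} (hx : x ∈ F) (hxr : x ∈ regularSet W X) :
    F ∈ chambers W X := by
  obtain ⟨d, x₀, hx₀, rfl⟩ := hF
  obtain ⟨M⟩ := exists_localModel hA x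
  have h1 := (M.mem_codim_iff M.mem_source d).1 (connectedComponentIn_subset _ _ hx)
  rw [(M.centre_eq_top_iff M.mem_source).2 hxr, finrank_top, finrank_euclideanSpace_fin] at h1
  have hd : d = 0 := by omega
  subst hd
  rw [← strata_zero hA]
  exact ⟨x₀, hx₀, rfl⟩

theorem eq_chamber_of_subset_closure (hA : IsCoxeterTransformationGroup l W X)
    (hC : C ∈ chambers W X) {D : Set X} (hD : D ∈ chambers W X) {x : X} (hx : x ∈ D)
    (hxC : x ∈ closure C) : D = C := by
  obtain ⟨y, hyD, hyC⟩ := mem_closure_iff.1 hxC _ (chamber_isOpen hA hD) hx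
  exact chamber_ext hD hC hyD hyC

/-- A boundary point of a chamber lies on one of its panels. -/
theorem exists_panel_of_notMem (hA : IsCoxeterTransformationGroup l W X) (hC : C ∈ chambers W X)
    {x : X} (hx : x ∈ closure C) (hxr : x ∉ regularSet W X) :
    ∃ s ∈ panelReflections W C, s • x = x := by
  rw [mem_regularSet] at hxr
  push Not at hxr
  obtain ⟨r, hr, hrx⟩ := hxr
  obtain ⟨M⟩ := exists_localModel hA x
  obtain ⟨p, hps, hp⟩ := mem_closure_iff.1 hx _ M.e.open_source M.mem_source
  obtain ⟨s, hs, hsx, -⟩ := M.exists_panel hA hC hp hps (M.smul_mem r hrx p hps) fun hc =>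
    not_sameSide_smul hA hr p (chamber_sameSide hC hr hp hc)
  exact ⟨s, hs, hsx⟩

theorem chamber_mem_facesOf (hA : IsCoxeterTransformationGroup l W X) (hC : C ∈ chambers W X) :
    C ∈ facesOf l W C := ⟨chamber_mem_faces hA hC, subset_closure⟩

/-- A maximal proper face of a chamber is dense in a mirror. -/
theorem exists_mirror_eq_closure (hA : IsCoxeterTransformationGroup l W X)
    (hC : C ∈ chambers W X) (hm : MirrorsAreFaces l W C) {H : Set X} (hH : H ∈ facesOf l W C)
    (hne : H ≠ C) (hmax : ∀ H₁ ∈ facesOf l W C, H ⊆ closure H₁ → H₁ = H ∨ H₁ = C) :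
    ∃ s ∈ simpleReflections l W C, mirror C s = closure H := by
  obtain ⟨x, hx⟩ := face_nonempty hH.1
  have hxr : x ∉ regularSet W X := fun hc =>
    hne (eq_chamber_of_subset_closure hA hC (mem_chambers_of_face hA hH.1 hx hc) hx (hH.2 hx))
  obtain ⟨s, hs, hsx⟩ := exists_panel_of_notMem hA hC (hH.2 hx) hxr
  have hs' : s ∈ simpleReflections l W C := by rwa [simpleReflections_eq hA hC]
  obtain ⟨F, hF, hFm⟩ := hm s hs'
  have hFC : F ⊆ closure C := fun y hy => by
    have : y ∈ mirror C s := hFm ▸ subset_closure hy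
    exact this.1
  have hHF : H ⊆ closure F := by
    rw [← hFm]
    exact Set.subset_inter hH.2 (face_subset_wall hA hH.1 hx hs.1 hsx)
  -- The mirror through `H` is the closure of a face above `H`. By maximality this is `H`, since the
  -- other option `C` contains no wall points.
  rcases hmax F ⟨⟨1, hF⟩, hFC⟩ hHF with h | h
  · exact ⟨s, hs', by rw [hFm, h]⟩
  · obtain ⟨c, hc⟩ := chamber_nonempty hC
    have : c ∈ mirror C s := hFm ▸ subset_closure (h ▸ hc)
    exact absurd this.2 (mem_regularSet.1 (chamber_subset hC hc) s hs.1)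

/-- A closed face is the intersection of the mirrors containing it. -/
theorem mem_closure_face (hA : IsCoxeterTransformationGroup l W X)
    (hC : C ∈ chambers W X) (hP : IsCombinatoriallySimplePolytope l W C)
    (hm : MirrorsAreFaces l W C) {F : Set X} (hF : F ∈ facesOf l W C) {y : X}
    (hy : y ∈ closure C) (hyF : ∀ s ∈ sigma l W C F, y ∈ wall X s) : y ∈ closure F := by
  obtain ⟨G, hG, hyG⟩ := exists_face hA y
  have hGC : G ∈ facesOf l W C := ⟨hG, face_subset_closure_chamber hA hG hC hyG hy⟩
  suffices h : G ⊆ closure F from h hyG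
  obtain ⟨P, ⟨⟨V, hV, rfl⟩, -, -⟩, φ, hφ⟩ := hP
  have hCf := chamber_mem_facesOf hA hC
  have hφC : (φ ⟨C, hCf⟩).1 = convexHull ℝ V := by
    have hPP : convexHull ℝ V ∈ polytopeFaces (convexHull ℝ V) := by
      obtain ⟨v, hv⟩ := (φ ⟨C, hCf⟩).2.1
      exact ⟨⟨v, (φ ⟨C, hCf⟩).2.2.subset hv⟩, IsExposed.refl _⟩
    refine (φ ⟨C, hCf⟩).2.2.subset.antisymm ?_
    have h1 := (hφ (φ.symm ⟨_, hPP⟩) ⟨C, hCf⟩).1 (φ.symm ⟨_, hPP⟩).2.2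
    rwa [Equiv.apply_symm_apply] at h1
  by_contra hGF
  have h1 : ¬ (φ ⟨G, hGC⟩).1 ⊆ (φ ⟨F, hF⟩).1 := fun hc => hGF ((hφ ⟨G, hGC⟩ ⟨F, hF⟩).2 hc)
  -- The maximal proper face `M` above `F` but not above `G` corresponds to a mirror containing `F`.
  -- By assumption `y`, hence all of `G`, lies on it: a contradiction.
  obtain ⟨M, hM, hFM, hGM, hmax⟩ := exists_coatom_face hV (φ ⟨F, hF⟩).2 (φ ⟨G, hGC⟩).2 h1
  obtain ⟨⟨H, hH⟩, hφH⟩ := φ.surjective ⟨M, hM⟩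
  have hφH' : (φ ⟨H, hH⟩).1 = M := congrArg Subtype.val hφH
  have hHC : H ≠ C := by
    rintro rfl
    rw [hφC] at hφH'
    exact hGM (hφH' ▸ (φ ⟨G, hGC⟩).2.2.subset)
  obtain ⟨s, hs, hsH⟩ := exists_mirror_eq_closure hA hC hm hH hHC fun H₁ hH₁ hHH₁ => by
    have h2 := (hφ ⟨H, hH⟩ ⟨H₁, hH₁⟩).1 hHH₁
    rw [hφH'] at h2
    rcases hmax _ (φ ⟨H₁, hH₁⟩).2 h2 with h3 | h3
    · exact Or.inl (congrArg Subtype.val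
        (φ.injective (Subtype.ext (h3.trans hφH'.symm)) : (⟨H₁, hH₁⟩ : facesOf l W C) = ⟨H, hH⟩))
    · exact Or.inr (congrArg Subtype.val
        (φ.injective (Subtype.ext (h3.trans hφC.symm)) : (⟨H₁, hH₁⟩ : facesOf l W C) = ⟨C, hCf⟩))
  have hFH : F ⊆ closure H := (hφ ⟨F, hF⟩ ⟨H, hH⟩).2 (by rwa [hφH'])
  have hys : y ∈ wall X s := hyF s ⟨hs, by rwa [hsH]⟩
  have hGH : G ⊆ closure H := by
    rw [← hsH]
    exact Set.subset_inter hGC.2 (face_subset_wall hA hG hyG hs.1 hys)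
  have h4 := (hφ ⟨G, hGC⟩ ⟨H, hH⟩).1 hGH
  rw [hφH'] at h4
  exact hGM h4

theorem inter_mirrors_eq (hA : IsCoxeterTransformationGroup l W X)
    (hC : C ∈ chambers W X) (hP : IsCombinatoriallySimplePolytope l W C)
    (hm : MirrorsAreFaces l W C) {F : Set X} (hF : F ∈ facesOf l W C) :
    closure C ∩ ⋂ s ∈ sigma l W C F, mirror C s = closure F := by
  have := hA.continuousConstSMul
  refine Set.Subset.antisymm ?_ (Set.subset_inter (closure_minimal hF.2 isClosed_closure) ?_)
  · rintro y ⟨hy, hyF⟩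
    exact mem_closure_face hA hC hP hm hF hy fun s hs => (Set.mem_iInter₂.1 hyF s hs).2
  · exact Set.subset_iInter₂ fun s hs =>
      closure_minimal hs.2 (isClosed_closure.inter (isClosed_wall s))

/-- Finiteness of the parabolic subgroup holds because it fixes every point of `F`, and stabilisers
are finite. -/
theorem sigma_mem_acceptable (hA : IsCoxeterTransformationGroup l W X)
    (hC : C ∈ chambers W X) (hP : IsCombinatoriallySimplePolytope l W C)
    (hm : MirrorsAreFaces l W C) {F : Set X} (hF : F ∈ facesOf l W C) :
    sigma l W C F ∈ acceptable l W C := by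
  obtain ⟨x, hx⟩ := face_nonempty hF.1
  refine ⟨fun s hs => hs.1, ?_, F, hF, inter_mirrors_eq hA hC hP hm hF⟩
  exact ((finite_stabilizer (W := W) x).subset fun g hg =>
    smul_eq_of_mem_closure_sigma hg hx).to_subtype

theorem eq_of_closure_eq (hP : IsCombinatoriallySimplePolytope l W C) {F G : Set X}
    (hF : F ∈ facesOf l W C) (hG : G ∈ facesOf l W C) (h : closure F = closure G) : F = G := by
  obtain ⟨P, -, φ, hφ⟩ := hP
  have h1 := (hφ ⟨F, hF⟩ ⟨G, hG⟩).1 (h ▸ subset_closure)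
  have h2 := (hφ ⟨G, hG⟩ ⟨F, hF⟩).1 (h ▸ subset_closure)
  exact congrArg Subtype.val
    (φ.injective (Subtype.ext (h1.antisymm h2)) : (⟨F, hF⟩ : facesOf l W C) = ⟨G, hG⟩)

/-- An acceptable set of simple reflections is the type of the face it defines. -/
theorem eq_sigma_of_inter_eq (hA : IsCoxeterTransformationGroup l W X)
    (hC : C ∈ chambers W X) {F : Set X} (hF : F ∈ facesOf l W C) {T : Set W}
    (hT : T ⊆ simpleReflections l W C) (h : closure C ∩ ⋂ s ∈ T, mirror C s = closure F) :
    T = sigma l W C F := by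
  have := hA.continuousConstSMul
  have hTF : T ⊆ sigma l W C F := fun s hs => ⟨hT hs, fun y hy =>
    Set.mem_iInter₂.1 (h.symm ▸ subset_closure hy : y ∈ closure C ∩ ⋂ s ∈ T, mirror C s).2 s hs⟩
  refine hTF.antisymm ?_
  rw [simpleReflections_eq hA hC] at hT
  obtain ⟨x, hx⟩ := face_nonempty hF.1
  rw [sigma_eq hA hC hF hx] at hTF ⊢
  rintro s ⟨hs, hsx⟩
  by_contra hsT
  obtain ⟨M⟩ := exists_localModel hA x
  obtain ⟨p, hps, hp⟩ := mem_closure_iff.1 (hF.2 hx) _ M.e.open_source M.mem_source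
  have hfix : ∀ g ∈ Subgroup.closure T, g • x = x := closure_le_stabilizer fun s hs => (hTF hs).2
  have hfin : (Subgroup.closure T : Set W).Finite := (finite_stabilizer (W := W) x).subset hfix
  have hmem : ∀ g, g ∈ hfin.toFinset ↔ g ∈ Subgroup.closure T := fun g => by
    rw [Set.Finite.mem_toFinset]; rfl
  have hcard : (0 : ℝ) < hfin.toFinset.card := by
    exact_mod_cast Finset.card_pos.2 ⟨1, (hmem 1).2 (one_mem _)⟩
  set c : ℝ := (hfin.toFinset.card : ℝ)⁻¹ with hc
  have hc0 : 0 < c := inv_pos.2 hcard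
  -- The barycentre of the `W_T`-orbit of a point of the chamber is fixed by `T`, so it lies on all
  -- mirrors of `T`; the aim is that it lies on no other panel through `x`.
  set v := ∑ g ∈ hfin.toFinset, c • M.ρ g (M.e p) with hv
  have hρt : ∀ g ∈ Subgroup.closure T, M.ρ g (M.e p) ∈ M.e.target := fun g hg => by
    rw [← M.e_smul g (hfix g hg) p hps]
    exact M.e.map_source (M.smul_mem g (hfix g hg) p hps)
  have hvt : v ∈ M.e.target := by
    refine M.convex.sum_mem (fun _ _ => hc0.le) ?_ fun g hg => hρt g ((hmem g).1 hg)
    rw [Finset.sum_const, nsmul_eq_mul, hc, mul_inv_cancel₀ hcard.ne']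
  have hpt := M.e.map_source hps
  have hzero : ∀ t ∈ T, M.root t v = 0 := by
    intro t ht
    have htR := (hT ht).1
    have htx := (hTF ht).2
    have h1 : M.ρ t v = v := by
      rw [hv, map_sum]
      refine Finset.sum_equiv (Equiv.mulLeft t) (fun g => ?_) (fun g hg => ?_)
      · rw [hmem, hmem, Equiv.coe_mulLeft]
        exact (Subgroup.mul_mem_cancel_left _ (Subgroup.subset_closure ht)).symm
      · rw [map_smul, Equiv.coe_mulLeft, M.ρ_mul t g htx (hfix g ((hmem g).1 hg))]
        rfl
    rw [M.ρ_apply t htR htx, sub_eq_self, smul_eq_zero] at h1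
    exact h1.resolve_right (M.coroot_ne_zero htR htx)
  have hpos : ∀ t ∈ panelReflections W C, t • x = x → t ∉ T →
      0 < M.root t (M.e p) * M.root t v := by
    intro t ht htx htT
    rw [hv, map_sum, Finset.mul_sum]
    refine Finset.sum_pos (fun g hg => ?_) ⟨1, (hmem 1).2 (one_mem _)⟩
    have hg' := (hmem g).1 hg
    rw [map_smul, smul_eq_mul, mul_left_comm]
    refine mul_pos hc0 ?_
    rw [← M.e_smul g (hfix g hg') p hps]
    refine (M.sameSide_iff t ht.1 htx p hps _ (M.smul_mem g (hfix g hg') p hps)).1 ?_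
    -- A panel reflection separating `p` from `g • p` with `g ∈ W_T` lies in `W_T`, hence in `T`. So
    -- every summand is strictly on the chamber's side.
    by_contra hns
    have hsep := isSeparation hA hC hp
    exact htT (hsep.mem_of_mem_closure hT ht (hsep.subset_closure hT hg' ⟨ht.1, hns⟩))
  have hys := M.e.map_target hvt
  -- By `exists_panel` it suffices to test panel inequalities, and these become strict after moving
  -- from `v` towards `p`.
  have hyC : M.e.symm v ∈ closure C := by
    refine mem_closure_of_tendsto
      ((M.tendsto_line hys (M.e p - v)).mono_left (nhdsWithin_le_nhds (s := Set.Ioi 0))) ?_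
    rw [M.e.right_inv hvt]
    filter_upwards [Ioo_mem_nhdsGT (zero_lt_one (α := ℝ))] with t ht
    have hqt : v + t • (M.e p - v) ∈ M.e.target :=
      M.convex.add_smul_sub_mem hvt hpt ⟨ht.1.le, ht.2.le⟩
    by_contra hqC
    obtain ⟨s', hs', hs'x, hle⟩ := M.exists_panel hA hC hp hps (M.e.map_target hqt) hqC
    rw [M.e.right_inv hqt, map_add, map_smul, map_sub, smul_eq_mul] at hle
    have h1 : 0 < M.root s' (M.e p) * M.root s' (M.e p) :=
      mul_self_pos.2 ((M.mem_regularSet_iff hps).1 (chamber_subset hC hp) s' hs'.1 hs'x)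
    have h2 : 0 ≤ M.root s' (M.e p) * M.root s' v := by
      by_cases hs'T : s' ∈ T
      · rw [hzero s' hs'T, mul_zero]
      · exact (hpos s' hs' hs'x hs'T).le
    have h3 := mul_pos ht.1 h1
    have h4 := mul_nonneg (sub_nonneg.2 ht.2.le) h2
    linarith
  have hyF : M.e.symm v ∈ closure F := by
    rw [← h]
    refine ⟨hyC, Set.mem_iInter₂.2 fun t ht => ⟨hyC, ?_⟩⟩
    rw [M.mem_wall_iff t (hT ht).1 (hTF ht).2 _ hys, M.e.right_inv hvt]
    exact hzero t ht
  have hyw : M.e.symm v ∈ wall X s :=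
    closure_minimal (face_subset_wall hA hF.1 hx hs.1 hsx) (isClosed_wall s) hyF
  rw [M.mem_wall_iff s hs.1 hsx _ hys, M.e.right_inv hvt] at hyw
  have := hpos s hs hsx hsT
  rw [hyw, mul_zero] at this
  exact lt_irrefl _ this

/-- The type map from the faces of a chamber to the acceptable sets of simple reflections. -/
def typeMap (hA : IsCoxeterTransformationGroup l W X)
    (hC : C ∈ chambers W X) (hP : IsCombinatoriallySimplePolytope l W C)
    (hm : MirrorsAreFaces l W C) (F : facesOf l W C) : acceptable l W C :=
  ⟨sigma l W C F, sigma_mem_acceptable hA hC hP hm F.2⟩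

/-- The type gives the closure of the face as an intersection of mirrors, and the face order is
antisymmetric because it is that of a polytope. -/
theorem typeMap_bijective (hA : IsCoxeterTransformationGroup l W X)
    (hC : C ∈ chambers W X) (hP : IsCombinatoriallySimplePolytope l W C)
    (hm : MirrorsAreFaces l W C) : Function.Bijective (typeMap hA hC hP hm) := by
  constructor
  · rintro ⟨F, hF⟩ ⟨G, hG⟩ h
    have h1 : sigma l W C F = sigma l W C G := congrArg Subtype.val h
    refine Subtype.ext (eq_of_closure_eq hP hF hG ?_)
    rw [← inter_mirrors_eq hA hC hP hm hF, ← inter_mirrors_eq hA hC hP hm hG, h1]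
  · rintro ⟨T, hT, hTf, F, hF, hTF⟩
    exact ⟨⟨F, hF⟩, Subtype.ext (eq_sigma_of_inter_eq hA hC hF hT hTF).symm⟩

end ChamberFaces

/-! ### The Salvetti poset -/

section SalvettiPoset

open Topology

set_option linter.unusedSectionVars false

variable {l : ℕ} {W : Type*} [Group W] {X : Type*} [TopologicalSpace X] [T2Space X]
  [ChartedSpace (EuclideanSpace ℝ (Fin l)) X] [MulAction W X]
  [IsManifold (𝓡 l) ∞ X] [ProperlyDiscontinuousSMul W X] [ConnectedSpace X] {C : Set X}

theorem smul_mem_Sal (hA : IsCoxeterTransformationGroup l W X) (hC : C ∈ chambers W X) (w : W)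
    {F : Set X} (hF : F ∈ facesOf l W C) : (w • F, w • C) ∈ Sal l W X := by
  have := hA.continuousConstSMul
  refine ⟨smul_face hA hF.1 w, smul_chamber hC w, ?_⟩
  change w • F ⊆ closure (w • C)
  rw [closure_smul]
  exact Set.smul_set_mono hF.2

/-- The pair `(wF, wC)` as an element of the Salvetti poset. -/
def salMk (hA : IsCoxeterTransformationGroup l W X) (hC : C ∈ chambers W X)
    (q : facesOf l W C × W) : Sal l W X :=
  ⟨(q.2 • q.1.1, q.2 • C), smul_mem_Sal hA hC q.2 q.1.2⟩

/-- Simple transitivity on chambers determines `w` from `wC`; translating back by `w⁻¹` determines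
the face. -/
theorem salMk_bijective (hA : IsCoxeterTransformationGroup l W X) (hC : C ∈ chambers W X) :
    Function.Bijective (salMk hA hC) := by
  have := hA.continuousConstSMul
  constructor
  · rintro ⟨⟨F, hF⟩, w⟩ ⟨⟨F', hF'⟩, w'⟩ h
    have h1 : (w • F, w • C) = (w' • F', w' • C) := congrArg Subtype.val h
    rw [Prod.mk.injEq] at h1
    have h2 := smul_chamber_injective hA hC h1.2
    subst h2
    have h3 := smul_left_cancel w h1.1
    subst h3
    rfl
  · rintro ⟨⟨A, D⟩, hA', hD, hAD⟩
    change D ∈ chambers W X at hD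
    change A ⊆ closure D at hAD
    obtain ⟨w, rfl⟩ := exists_eq_smul_chamber hA hC hD
    have hF : w⁻¹ • A ∈ facesOf l W C := by
      refine ⟨smul_face hA hA' _, ?_⟩
      rw [closure_smul] at hAD
      exact Set.smul_set_subset_iff_subset_inv_smul_set.2 (by rwa [inv_inv])
    refine ⟨(⟨w⁻¹ • A, hF⟩, w), Subtype.ext ?_⟩
    change (w • w⁻¹ • A, w • C) = (A, w • C)
    rw [smul_inv_smul]

/-- Chambers not separated by any of the reflections in `A` lie on the same side of the
arrangement of the walls of `A`. -/
theorem mem_connectedComponentIn_of_separating (hA : IsCoxeterTransformationGroup l W X)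
    (hC : C ∈ chambers W X) {p : X} (hp : p ∈ C) {A : Set W} (hAR : A ⊆ reflections W X)
    (w u : W) (h : ∀ r ∈ A, w⁻¹ * r * w ∉ separating W p u) :
    (w * u) • p ∈ connectedComponentIn (⋃ r ∈ A, wall X r)ᶜ (w • p) := by
  have := hA.continuousConstSMul
  have hmem : ∀ g : W, g • p ∈ (⋃ r ∈ A, wall X r)ᶜ := by
    intro g hc
    obtain ⟨r, hr, hw⟩ := Set.mem_iUnion₂.1 hc
    exact mem_regularSet.1 (smul_mem_regularSet (chamber_subset hC hp) g) r (hAR hr) hw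
  refine (isSeparation hA hC hp).gallery (A := A)
    (P := fun g g' => g' • p ∈ connectedComponentIn (⋃ r ∈ A, wall X r)ᶜ (g • p))
    (fun g => mem_connectedComponentIn (hmem g)) (fun g g' g'' h1 h2 => ?_)
    (fun g s hs hsA => ?_) u (closure_panelReflections hA hC ▸ Subgroup.mem_top _) w h
  · rwa [connectedComponentIn_eq h1]
  · obtain ⟨B, hB, hpB, hspB, hBr⟩ := panel_sameSide hA hC hp hs
    have hgB : IsPreconnected (g • B) := hB.image _ (continuous_const_smul g).continuousOn
    refine hgB.subset_connectedComponentIn (Set.smul_mem_smul_set hpB) ?_ ?_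
    · rintro _ ⟨b, hb, rfl⟩ hc
      obtain ⟨r, hr, hw⟩ := Set.mem_iUnion₂.1 hc
      have e : g * (g⁻¹ * r * g) * g⁻¹ = r := by group
      have hr' : g⁻¹ * r * g ∈ reflections W X := by
        have := conj_mem_reflections (hAR hr) g⁻¹
        rwa [inv_inv] at this
      have hw' : b ∈ wall X (g⁻¹ * r * g) := by
        rw [← smul_mem_wall_conj g, e]
        exact hw
      refine hBr _ hr' (fun hrs => hsA ?_) b hb hw'
      rw [← hrs, e]
      exact hr
    · rw [mul_smul]
      exact Set.smul_mem_smul_set hspB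

theorem wall_subset_iff (v r : W) (G : Set X) :
    v • G ⊆ wall X r ↔ G ⊆ wall X (v⁻¹ * r * v) := by
  rw [Set.smul_set_subset_iff_subset_inv_smul_set, smul_wall, inv_inv]

/-- A reflection fixing a face of the chamber belongs to its parabolic subgroup. -/
theorem mem_closure_sigma (hA : IsCoxeterTransformationGroup l W X) (hC : C ∈ chambers W X)
    {F : Set X} (hF : F ∈ facesOf l W C) {x : X} (hx : x ∈ F) {u : W}
    (hu : x ∈ closure (u • C)) : u ∈ Subgroup.closure (sigma l W C F) := by
  rw [sigma_eq hA hC hF hx]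
  exact mem_closure_of_mem_closure_smul hA hC (hF.2 hx) hu

theorem conj_mem_closure_sigma (hA : IsCoxeterTransformationGroup l W X) (hC : C ∈ chambers W X)
    {G : Set X} (hG : G ∈ facesOf l W C) {g : W} (hg : G ⊆ wall X g) :
    g ∈ Subgroup.closure (sigma l W C G) := by
  have := hA.continuousConstSMul
  obtain ⟨z, hz⟩ := face_nonempty hG.1
  refine mem_closure_sigma hA hC hG hz ?_
  have := smul_mem_closure (hG.2 hz) g
  rwa [mem_wall.1 (hg hz)] at this

/-- Walls through `vG` also contain `wF`, so the inclusion only asks that `wC` and `vC` share a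
component off the walls through `vG`. Translated by `w⁻¹`, a wall through `vG` separating them is a
member of `N (w⁻¹v)` conjugate into `W_{σ(G)}`, the obstruction to minimality. -/
theorem localChamber_subset_iff (hA : IsCoxeterTransformationGroup l W X)
    (hC : C ∈ chambers W X) {F G : Set X} (hG : G ∈ facesOf l W C) {w v : W}
    (hFG : w • F ⊆ closure (v • G)) :
    localChamber W (w • F) (w • C) ⊆ localChamber W (v • G) (v • C) ↔
      IsMinimal (simpleReflections l W C) (sigma l W C G) (w⁻¹ * v) := by
  have := hA.continuousConstSMul
  obtain ⟨p, hp⟩ := chamber_nonempty hC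
  have hsep := isSeparation hA hC hp
  rw [simpleReflections_eq hA hC, hsep.isMinimal_iff (closure_panelReflections hA hC)
    (sigma_subset hA hC G)]
  set N : Set X → Set X := fun G =>
    (⋃ r ∈ {r | r ∈ reflections W X ∧ G ⊆ wall X r}, wall X r)ᶜ with hN
  have hregN : ∀ G, regularSet W X ⊆ N G := by
    intro G y hy hc
    obtain ⟨r, hr, hw⟩ := Set.mem_iUnion₂.1 hc
    exact mem_regularSet.1 hy r hr.1 hw
  constructor
  · rintro h r ⟨hr, hrs⟩ hrG
    have hwp : w • p ∈ localChamber W (w • F) (w • C) :=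
      ⟨w • p, Set.smul_mem_smul_set hp, mem_connectedComponentIn
        (hregN _ (chamber_subset (smul_chamber hC w) (Set.smul_mem_smul_set hp)))⟩
    obtain ⟨x, hx, hxp⟩ := h hwp
    have hr' := conj_mem_reflections hr w
    have hGr : v • G ⊆ wall X (w * r * w⁻¹) := by
      rw [wall_subset_iff]
      intro z hz
      have := smul_eq_of_mem_closure_sigma hrG hz
      rw [mem_wall]
      convert this using 2
      group
    have h1 : SameSide (w * r * w⁻¹) x (w • p) := by
      refine connectedComponentIn_mono x ?_ hxp
      exact Set.compl_subset_compl.2 (Set.subset_biUnion_of_mem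
        (u := fun r => wall X r) (⟨hr', hGr⟩ : w * r * w⁻¹ ∈
          {r | r ∈ reflections W X ∧ v • G ⊆ wall X r}))
    have h2 : SameSide (w * r * w⁻¹) (v • p) x :=
      chamber_sameSide (smul_chamber hC v) hr' (Set.smul_mem_smul_set hp) hx
    have h3 := (h2.trans h1).symm
    rw [← mul_inv_cancel_left w v, mul_smul, SameSide.smul_iff] at h3
    exact hrs h3
  · rintro h y ⟨x, hx, hxy⟩
    have hmono : N (w • F) ⊆ N (v • G) := by
      refine Set.compl_subset_compl.2 (Set.biUnion_subset_biUnion_left ?_)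
      rintro r ⟨hr, hGr⟩
      exact ⟨hr, hFG.trans (closure_minimal hGr (isClosed_wall r))⟩
    have h1 : y ∈ connectedComponentIn (N (v • G)) x := connectedComponentIn_mono x hmono hxy
    have hwC := smul_chamber hC w
    have h2 : x ∈ connectedComponentIn (N (v • G)) (w • p) :=
      (chamber_isPreconnected hwC).subset_connectedComponentIn (Set.smul_mem_smul_set hp)
        ((chamber_subset hwC).trans (hregN _)) hx
    have h3 : (w * (w⁻¹ * v)) • p ∈ connectedComponentIn (N (v • G)) (w • p) := by
      -- Being on the same side of each wall separately does not by itself give a common component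
      -- off their union; the gallery supplies the connection.
      refine mem_connectedComponentIn_of_separating hA hC hp (fun r hr => hr.1) w (w⁻¹ * v) ?_
      rintro r ⟨hr, hGr⟩ hrs
      refine h _ hrs (conj_mem_closure_sigma hA hC hG ?_)
      rw [wall_subset_iff] at hGr
      convert hGr using 2
      group
    rw [mul_inv_cancel_left] at h3
    refine ⟨v • p, Set.smul_mem_smul_set hp, ?_⟩
    rw [← connectedComponentIn_eq h3, connectedComponentIn_eq h2]
    exact h1

/-- If `F` lies in the closure of `uG`, `u = w⁻¹v`, then `u` belongs to `W_{σ(F)}` because the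
closed chamber is a strict fundamental domain; such `u` fixes `F` pointwise and drops out, leaving
`F ≤ G`, that is `σ(G) ⊆ σ(F)`. -/
theorem salLE_iff (hA : IsCoxeterTransformationGroup l W X)
    (hC : C ∈ chambers W X) (hP : IsCombinatoriallySimplePolytope l W C)
    (hm : MirrorsAreFaces l W C) {F G : Set X} (hF : F ∈ facesOf l W C)
    (hG : G ∈ facesOf l W C) (w v : W) :
    (w • F ⊆ closure (v • G) ∧
      localChamber W (w • F) (w • C) ⊆ localChamber W (v • G) (v • C)) ↔
    (sigma l W C G ⊆ sigma l W C F ∧ w⁻¹ * v ∈ Subgroup.closure (sigma l W C F) ∧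
      IsMinimal (simpleReflections l W C) (sigma l W C G) (w⁻¹ * v)) := by
  have := hA.continuousConstSMul
  have key : w • F ⊆ closure (v • G) ↔
      sigma l W C G ⊆ sigma l W C F ∧ w⁻¹ * v ∈ Subgroup.closure (sigma l W C F) := by
    have e : w • F ⊆ closure (v • G) ↔ F ⊆ (w⁻¹ * v) • closure G := by
      rw [Set.smul_set_subset_iff_subset_inv_smul_set, closure_smul, smul_smul]
    rw [e]
    constructor
    · intro h
      obtain ⟨x, hx⟩ := face_nonempty hF.1
      have hu : w⁻¹ * v ∈ Subgroup.closure (sigma l W C F) := by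
        refine mem_closure_sigma hA hC hF hx ?_
        rw [closure_smul]
        exact Set.smul_set_mono (closure_minimal hG.2 isClosed_closure) (h hx)
      refine ⟨fun s hs => ⟨hs.1, Set.subset_inter hF.2 ?_⟩, hu⟩
      have hFG : F ⊆ closure G := by
        rw [← smul_face_eq hu] at h
        exact Set.smul_set_subset_smul_set_iff.1 h
      exact hFG.trans (closure_minimal (hs.2.trans Set.inter_subset_right) (isClosed_wall s))
    · rintro ⟨h1, h2⟩
      rw [← smul_face_eq h2]
      refine Set.smul_set_mono fun x hx => ?_
      exact mem_closure_face hA hC hP hm hG (hF.2 hx) fun s hs => ((h1 hs).2 hx).2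
  rw [← and_assoc, ← key]
  exact and_congr_right fun h => localChamber_subset_iff hA hC hG h

theorem salLE_trans {p q r : Sal l W X} (h1 : salLE l W X p q) (h2 : salLE l W X q r) :
    salLE l W X p r :=
  ⟨h1.1.trans (closure_minimal h2.1 isClosed_closure), h1.2.trans h2.2⟩

theorem coxLE_refl (p : acceptable l W C × W) : coxLE l W C p p := by
  refine ⟨subset_rfl, ?_, ?_⟩
  · rw [inv_mul_cancel]
    exact one_mem _
  · rw [inv_mul_cancel]
    intro u _
    have : wordLength (simpleReflections l W C) (1 : W) = 0 :=
      Nat.sInf_eq_zero.2 (Or.inl ⟨[], by simp, rfl, rfl⟩)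
    rw [this]
    exact Nat.zero_le _

/-- With equal types, `w⁻¹v` lies in `W_T` and is minimal in its coset, which is `W_T` itself; so no
reflection separates and it is trivial. -/
theorem coxLE_antisymm (hA : IsCoxeterTransformationGroup l W X) (hC : C ∈ chambers W X)
    {p q : acceptable l W C × W} (h1 : coxLE l W C p q) (h2 : coxLE l W C q p) : p = q := by
  obtain ⟨⟨T, hT⟩, v⟩ := p
  obtain ⟨⟨U, hU⟩, w⟩ := q
  have hTU : T = U := h1.1.antisymm h2.1
  subst hTU
  obtain ⟨x, hx⟩ := chamber_nonempty hC
  have hsep := isSeparation hA hC hx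
  have hTp : T ⊆ panelReflections W C := by
    rw [← simpleReflections_eq hA hC]
    exact hT.1
  have hmem : w⁻¹ * v ∈ Subgroup.closure T := h1.2.1
  have hmin : IsMinimal (simpleReflections l W C) T (w⁻¹ * v) := h1.2.2
  rw [simpleReflections_eq hA hC, hsep.isMinimal_iff (closure_panelReflections hA hC) hTp] at hmin
  have h3 : w⁻¹ * v = 1 := by
    refine hsep.eq_one_of_empty (closure_panelReflections hA hC ▸ Subgroup.mem_top _) ?_
    rw [Set.eq_empty_iff_forall_notMem]
    exact fun r hr => hmin r hr
      (mul_mem (mul_mem (inv_mem hmem) (hsep.subset_closure hTp hmem hr)) hmem)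
  rw [inv_mul_eq_one.1 h3]

end SalvettiPoset

end ReflArr
-- The isomorphism of posets
theorem mainTheorem4 (l : ℕ) (W : Type*) [Group W] (X : Type*) [TopologicalSpace X] [T2Space X]
    [SecondCountableTopology X] [ConnectedSpace X]
    [ChartedSpace (EuclideanSpace ℝ (Fin l)) X] [IsManifold (𝓡 l) ∞ X]
    [MulAction W X] [ProperlyDiscontinuousSMul W X]
    (hA : ReflArr.IsReflectionArrangement l W X)
    (C₀ : Set X) (hC₀ : C₀ ∈ ReflArr.chambers W X)
    (hmirror : ReflArr.MirrorsAreFaces l W C₀) :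
    -- every element of the Salvetti poset is uniquely of the form `(wF, wC₀)` with `F ≤ C₀`
    (∀ p : ReflArr.Sal l W X, ∃! q : W × ReflArr.facesOf l W C₀,
      (p : Set X × Set X) = (q.1 • q.2.1, q.1 • C₀)) ∧
    -- both relations are partial orders
    IsPartialOrder (ReflArr.Sal l W X) (ReflArr.salLE l W X) ∧
    IsPartialOrder (ReflArr.acceptable l W C₀ × W) (ReflArr.coxLE l W C₀) ∧
    -- `Φ (wF, wC₀) = (σ F, w)` is an order reversing isomorphism
    ∃ Φ : ReflArr.Sal l W X ≃ ReflArr.acceptable l W C₀ × W,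
      (∀ (w : W) (F : Set X), F ∈ ReflArr.facesOf l W C₀ →
        ∃ h : (w • F, w • C₀) ∈ ReflArr.Sal l W X,
          ((Φ ⟨(w • F, w • C₀), h⟩).1 : Set W) = ReflArr.sigma l W C₀ F ∧
          (Φ ⟨(w • F, w • C₀), h⟩).2 = w) ∧
      ∀ p q : ReflArr.Sal l W X,
        ReflArr.salLE l W X p q ↔ ReflArr.coxLE l W C₀ (Φ q) (Φ p) := by
  have hG := hA.group
  have hP := hA.polytopal C₀ hC₀
  let e := Equiv.ofBijective _ (ReflArr.salMk_bijective hG hC₀)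
  let t := Equiv.ofBijective _ (ReflArr.typeMap_bijective hG hC₀ hP hmirror)
  let Φ : ReflArr.Sal l W X ≃ ReflArr.acceptable l W C₀ × W :=
    e.symm.trans (t.prodCongr (Equiv.refl W))
  have hΦ (q : ReflArr.facesOf l W C₀ × W) : Φ (e q) = (t q.1, q.2) := by
    simp [Φ, Prod.map]
  have iso (p q : ReflArr.Sal l W X) :
      ReflArr.salLE l W X p q ↔ ReflArr.coxLE l W C₀ (Φ q) (Φ p) := by
    obtain ⟨⟨F, w⟩, rfl⟩ := e.surjective p
    obtain ⟨⟨G, v⟩, rfl⟩ := e.surjective q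
    rw [hΦ, hΦ]
    exact ReflArr.salLE_iff hG hC₀ hP hmirror F.2 G.2 w v
  refine ⟨fun p => ?_, ?_, ?_, Φ, fun w F hF => ?_, iso⟩
  · obtain ⟨⟨F, w⟩, rfl⟩ := e.surjective p
    refine ⟨(w, F), rfl, fun q hq => ?_⟩
    have h : e (F, w) = e (q.2, q.1) := Subtype.ext hq
    have h' := e.injective h
    rw [Prod.mk.injEq] at h'
    exact Prod.ext h'.2.symm h'.1.symm
  · exact
      { refl := fun p => ⟨subset_closure, subset_rfl⟩
        trans := fun _ _ _ => ReflArr.salLE_trans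
        -- Antisymmetry is easy on the Coxeter side and transitivity on the geometric side; the
        -- equivalence `iso` carries each to the other.
        antisymm := fun p q h1 h2 => Φ.injective
          (ReflArr.coxLE_antisymm hG hC₀ ((iso q p).1 h2) ((iso p q).1 h1)) }
  · refine
      { refl := ReflArr.coxLE_refl
        trans := fun a b c h1 h2 => ?_
        antisymm := fun _ _ => ReflArr.coxLE_antisymm hG hC₀ }
    obtain ⟨p, rfl⟩ := Φ.surjective a
    obtain ⟨q, rfl⟩ := Φ.surjective b
    obtain ⟨r, rfl⟩ := Φ.surjective c
    exact (iso r p).1 (ReflArr.salLE_trans ((iso r q).2 h2) ((iso q p).2 h1))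
  · refine ⟨ReflArr.smul_mem_Sal hG hC₀ w hF, ?_⟩
    have h := hΦ (⟨F, hF⟩, w)
    exact ⟨congrArg (fun z => (z.1 : Set W)) h, congrArg Prod.snd h⟩
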